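/- Let $d\ge 1$, let $\mathbb{T}^d=\mathbb{R}^d/2\pi\mathbb{Z}^d$, and let $V\in L^{\rho}(\mathbb{T}^d,\mathbb{R})$, where $\rho=2$ if $d=1$, $\rho=2^+$ if $d=2$ (i.e. $V\in L^p$ for some $p>2$), and $\rho=d$ if $d\ge 3$. Put $V_0=1$, $V_{2j-1}(x)=\sin(x_j)$, $V_{2j}(x)=\cos(x_j)$ for $1\le j\le d$, and consider, for real-valued functions, the control system $$\frac{dW}{dt}(t)=\Big(A+VB+\sum_{j=0}^{2d}u_j(t)V_jB\Big)W(t),\qquad A=\begin{pmatrix}0&1\\ \Delta-1&0\end{pmatrix},\quad B=\begin{pmatrix}0&0\\1&0\end{pmatrix},$$ that is, $\partial_t^2 w=(\Delta-1+V+\sum_{j=0}^{2d} u_j(t)V_j)w$ with $W=(w,\partial_t w)$. For $T\geq 0$, a piecewise constant control $u:[0,T]\to\mathbb{R}^{2d+1}$ and $W_0\in H^1\times L^2(\mathbb{T}^d)$, let $W(\cdot\,;u,W_0)\in C^0([0,T],H^1\times L^2(\mathbb{T}^d))$ be the solution with $W(0)=W_0$; the equation holds in $L^2\times H^{-1}(\mathbb{T}^d)$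 at all but finitely many times. The system is approximately controllable in time $T^+$ from $W_0$ if for every $W_f\in H^1\times L^2(\mathbb{T}^d)$ and every $\epsilon>0$ there are $T_1\in[T,T+\epsilon]$ and a piecewise constant $u:[0,T_1]\to\mathbb{R}^{2d+1}$ with $\|W(T_1;u,W_0)-W_f\|_{H^1\times L^2}<\epsilon$. Let $\mathcal{T}(W_0)\in[0,\infty]$ be the infimum of the $T\ge 0$ such that the system is approximately controllable in time $T^+$ from $W_0$ ($+\infty$ if there is none). For a function $f$ on $\mathbb{T}^d$ let $Z(f)=f^{-1}(\{0\})$ (defined up to a null set), and let $|\cdot|$ be the Lebesgue measure on $\mathbb{T}^d$. Then $\mathcal{T}(W_0)=0$ (small-time approximate controllability from $W_0$) in each of the following two cases: 1. $W_0=(w_0,\dot w_0)\in H^1\times L^2(\mathbb{T}^d)$ and $|Z(w_0)|=0$; 2. $W_0=(w_0,\dot w_0)\in H^1\times H^1(\mathbb{T}^d)$ and $|Z(W_0)|=0$, where $Z(W_0)$ is the set of common zeros of $w_0$ and $\dot w_0$. -/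

import Mathlib

open MeasureTheory Set
open scoped ENNReal NNReal ContDiff Real

noncomputable section

namespace BilinearWave

/-- The length `2π` of each factor of the torus is positive. -/
instance factTwoPiPos : Fact (0 < 2 * π) := ⟨Real.two_pi_pos⟩

/-- The torus `𝕋^d = ℝ^d / 2πℤ^d`, with its Lebesgue measure `volume`, of total mass `(2π)^d`. -/
abbrev Torus (d : ℕ) : Type := Fin d → AddCircle (2 * π)

/-- The projection `ℝ^d → 𝕋^d`. -/
def Torus.mk {d : ℕ} (x : Fin d → ℝ) : Torus d := fun i => (x i : AddCircle (2 * π))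

/-- The space `L²(𝕋^d, ℝ)`. -/
abbrev L2 (d : ℕ) : Type := Lp ℝ 2 (volume : Measure (Torus d))

/-! ### Smooth functions on the torus -/

/-- `φ ∈ C^∞(𝕋^d, ℝ)`: the `2πℤ^d`-periodic function on `ℝ^d` that `φ` lifts to is smooth. -/
def IsSmooth {d : ℕ} (φ : Torus d → ℝ) : Prop :=
  ContDiff ℝ ∞ (fun x : Fin d → ℝ => φ (Torus.mk x))

/-- The partial derivative `∂φ/∂x_i` of a function on the torus. -/
def pderiv {d : ℕ} (i : Fin d) (φ : Torus d → ℝ) (x : Torus d) : ℝ :=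
  deriv (fun t : ℝ => φ (x + Torus.mk (Pi.single i t))) 0

theorem Torus.isOpenQuotientMap_mk (d : ℕ) : IsOpenQuotientMap (Torus.mk (d := d)) := by
  have : IsOpenQuotientMap (Pi.map (fun (_ : Fin d) (t : ℝ) => (t : AddCircle (2 * π)))) :=
    IsOpenQuotientMap.piMap (fun _ => QuotientAddGroup.isOpenQuotientMap_mk)
  exact this

theorem Torus.mk_add {d : ℕ} (x y : Fin d → ℝ) :
    Torus.mk (x + y) = Torus.mk x + Torus.mk y := by
  funext i
  simp [Torus.mk]

theorem IsSmooth.continuous {d : ℕ} {φ : Torus d → ℝ} (hφ : IsSmooth φ) : Continuous φ :=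
  (Torus.isOpenQuotientMap_mk d).isQuotientMap.continuous_iff.2 (ContDiff.continuous hφ)

theorem IsSmooth.pderiv_mk {d : ℕ} {φ : Torus d → ℝ} (hφ : IsSmooth φ) (i : Fin d)
    (x : Fin d → ℝ) :
    pderiv i φ (Torus.mk x) = fderiv ℝ (fun y => φ (Torus.mk y)) x (Pi.single i 1) := by
  have h1 : HasFDerivAt (fun y => φ (Torus.mk y)) (fderiv ℝ (fun y => φ (Torus.mk y)) x)
      (x + Pi.single i (0 : ℝ)) := by
    simpa using ((ContDiff.differentiable hφ (by simp)) x).hasFDerivAt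
  have h2 : HasDerivAt (fun t : ℝ => x + Pi.single i t) (Pi.single i (1 : ℝ)) 0 :=
    (hasDerivAt_single i (0 : ℝ)).const_add x
  have h3 := h1.comp_hasDerivAt (0 : ℝ) h2
  have h4 : (fun t : ℝ => φ (Torus.mk x + Torus.mk (Pi.single i t)))
      = (fun y => φ (Torus.mk y)) ∘ (fun t : ℝ => x + Pi.single i t) := by
    funext t
    simp [Torus.mk_add]
  rw [pderiv, h4]
  exact h3.deriv

theorem IsSmooth.continuous_pderiv {d : ℕ} {φ : Torus d → ℝ} (hφ : IsSmooth φ) (i : Fin d) :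
    Continuous (pderiv i φ) := by
  refine (Torus.isOpenQuotientMap_mk d).isQuotientMap.continuous_iff.2 ?_
  have : pderiv i φ ∘ Torus.mk
      = fun x => fderiv ℝ (fun y => φ (Torus.mk y)) x (Pi.single i 1) :=
    funext fun x => hφ.pderiv_mk i x
  rw [this]
  exact (ContDiff.continuous_fderiv hφ (by simp)).clm_apply continuous_const

theorem integrable_mul_of_continuous {d : ℕ} (f : L2 d) {g : Torus d → ℝ} (hg : Continuous g) :
    Integrable (fun x => f x * g x) := by
  have h : MemLp g 2 (volume : Measure (Torus d)) := by
    obtain ⟨C, hC⟩ := isCompact_univ.exists_bound_of_continuousOn hg.continuousOn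
    exact MemLp.of_bound hg.aestronglyMeasurable C
      (Filter.Eventually.of_forall fun x => hC x (mem_univ x))
  exact (Lp.memLp f).integrable_mul h

/-! ### Sobolev spaces -/

/-- `g = (g_1, …, g_d)` is the weak gradient of `f`:
`∫ f ∂_iφ = - ∫ g_i φ` for all test functions `φ ∈ C^∞(𝕋^d)` and all `i`. -/
def IsWeakGradient {d : ℕ} (f : L2 d) (g : PiLp 2 (fun _ : Fin d => L2 d)) : Prop :=
  ∀ φ : Torus d → ℝ, IsSmooth φ → ∀ i : Fin d,
    ∫ x, f x * pderiv i φ x = - ∫ x, g i x * φ x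

/-- The Sobolev space `H¹(𝕋^d, ℝ)`, as the space of the pairs `(w, ∇w)` where `w ∈ L²` has the weak
gradient `∇w ∈ (L²)^d`. The norm it inherits is `‖w‖² = ∫ |w|² + |∇w|²`. -/
def H1 (d : ℕ) : Submodule ℝ (WithLp 2 (L2 d × PiLp 2 (fun _ : Fin d => L2 d))) where
  carrier := {p | IsWeakGradient p.fst p.snd}
  zero_mem' := by
    intro φ _ i
    have h : ∀ g : Torus d → ℝ, ∫ x, (0 : L2 d) x * g x = 0 := fun g =>
      integral_eq_zero_of_ae ((Lp.coeFn_zero ℝ 2 volume).mono fun x hx => by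
        simp only [hx, Pi.zero_apply, zero_mul])
    have e : ∫ x, (0 : L2 d) x * pderiv i φ x = - ∫ x, (0 : L2 d) x * φ x := by
      rw [h, h, neg_zero]
    exact e
  add_mem' := by
    intro p q hp hq φ hφ i
    have key : ∀ (a b : L2 d) {g : Torus d → ℝ}, Continuous g →
        ∫ x, (a + b) x * g x = (∫ x, a x * g x) + ∫ x, b x * g x := by
      intro a b g hg
      rw [← integral_add (integrable_mul_of_continuous a hg) (integrable_mul_of_continuous b hg)]
      refine integral_congr_ae ((Lp.coeFn_add a b).mono fun x hx => ?_)
      simp only [hx, Pi.add_apply]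
      ring
    have e1 := key p.fst q.fst (hφ.continuous_pderiv i)
    have e2 := key (p.snd i) (q.snd i) hφ.continuous
    have e3 := hp φ hφ i
    have e4 := hq φ hφ i
    simp only [WithLp.add_fst, WithLp.add_snd, PiLp.add_apply]
    linarith
  smul_mem' := by
    intro c p hp φ hφ i
    have key : ∀ (a : L2 d) (g : Torus d → ℝ),
        ∫ x, (c • a) x * g x = c * ∫ x, a x * g x := by
      intro a g
      rw [← integral_const_mul]
      refine integral_congr_ae ((Lp.coeFn_smul c a).mono fun x hx => ?_)
      simp only [hx, Pi.smul_apply, smul_eq_mul]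
      ring
    have e1 := key p.fst (pderiv i φ)
    have e2 := key (p.snd i) φ
    have e3 := hp φ hφ i
    simp only [WithLp.smul_fst, WithLp.smul_snd, PiLp.smul_apply]
    rw [e1, e2, e3]
    ring

/-- The inclusion `H¹(𝕋^d) → L²(𝕋^d)`. -/
def H1.toL2 {d : ℕ} : H1 d →L[ℝ] L2 d :=
  (WithLp.fstL 2 ℝ (L2 d) (PiLp 2 (fun _ : Fin d => L2 d))).comp (H1 d).subtypeL

/-- The space `H^{-1}(𝕋^d)`, the dual of `H¹(𝕋^d)`. -/
abbrev HNeg1 (d : ℕ) : Type := StrongDual ℝ (H1 d)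

/-- The inclusion `L²(𝕋^d) → H^{-1}(𝕋^d)`, `f ↦ (φ ↦ ∫ f φ)`. -/
def toHNeg1 {d : ℕ} (f : L2 d) : HNeg1 d := (innerSL ℝ f).comp H1.toL2

/-- The operator `Δ - 1 : H¹(𝕋^d) → H^{-1}(𝕋^d)`, `w ↦ (φ ↦ - ∫ ∇w · ∇φ - ∫ w φ)`. -/
def laplacianSubOne {d : ℕ} (w : H1 d) : HNeg1 d := -(innerSL ℝ w)

/-- The state space `H¹ × L²(𝕋^d)`, with the norm `‖(w₁, w₂)‖² = ∫ |∇w₁|² + |w₁|² + |w₂|²`. -/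
abbrev State (d : ℕ) : Type := WithLp 2 (H1 d × L2 d)

/-- The inclusion `H¹ × L²(𝕋^d) → L² × H^{-1}(𝕋^d)`. -/
def State.incl {d : ℕ} (W : State d) : L2 d × HNeg1 d := (H1.toL2 W.fst, toHNeg1 W.snd)

/-! ### The control system -/

/-- The potential `V` belongs to `L^ρ(𝕋^d)`, where `ρ = 2` if `d = 1`, `ρ = 2⁺` if `d = 2` (that is,
`V ∈ L^p` for some `p > 2`) and `ρ = d` if `d ≥ 3`. -/
def AdmissiblePotential {d : ℕ} (V : Torus d → ℝ) : Prop :=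
  (d = 1 → MemLp V 2) ∧ (d = 2 → ∃ p : ℝ≥0∞, 2 < p ∧ MemLp V p) ∧ (3 ≤ d → MemLp V (d : ℝ≥0∞))

/-- The control potentials `V_0 = 1`, `V_{2j-1}(x) = sin x_j`, `V_{2j}(x) = cos x_j`,
`j = 1, …, d`. (The coordinate `x_j` is `x (j - 1)`, the indices of `x` being `0, …, d - 1`.) -/
def controlPotential {d : ℕ} (k : Fin (2 * d + 1)) (x : Torus d) : ℝ :=
  if hk : k.val = 0 then 1
  else if k.val % 2 = 1 then Real.Angle.sin (x ⟨(k.val - 1) / 2, by omega⟩)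
  else Real.Angle.cos (x ⟨(k.val - 1) / 2, by omega⟩)

/-- `u : [0, T] → ℝ^{2d+1}` is piecewise constant: there are finitely many times such that `u` is
constant on each subinterval of `[0, T]` that contains none of them. -/
def IsPiecewiseConstant {d : ℕ} (T : ℝ) (u : ℝ → Fin (2 * d + 1) → ℝ) : Prop :=
  ∃ S : Finset ℝ, ∀ s ∈ Icc 0 T, ∀ t ∈ Icc 0 T, s ≤ t → Disjoint (S : Set ℝ) (Icc s t) → u s = u t

/-- `Z ∈ L² × H^{-1}` is the vector `(A + V B + ∑ c_j V_j B) W`, that is,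
`(ẇ, (Δ - 1) w + (V + ∑ c_j V_j) w)` for `W = (w, ẇ)`, where `(V + ∑ c_j V_j) w ∈ L²`. -/
def IsGenerator {d : ℕ} (V : Torus d → ℝ) (c : Fin (2 * d + 1) → ℝ) (W : State d)
    (Z : L2 d × HNeg1 d) : Prop :=
  Z.1 = W.snd ∧
  ∃ f : L2 d, (∀ᵐ x, f x = (V x + ∑ j, c j * controlPotential j x) * H1.toL2 W.fst x) ∧
    Z.2 = laplacianSubOne W.fst + toHNeg1 f

/-- `W` is the solution on `[0, T]` of `dW/dt = (A + V B + ∑ u_j(t) V_j B) W`, `W(0) = W₀`, for the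
piecewise constant control `u`: it is continuous on `[0, T]` with values in `H¹ × L²`, and the
equation holds in `L² × H^{-1}` at all but finitely many times (those where `u` may jump). -/
def IsSolution {d : ℕ} (V : Torus d → ℝ) (T : ℝ) (u : ℝ → Fin (2 * d + 1) → ℝ) (W₀ : State d)
    (W : ℝ → State d) : Prop :=
  ContinuousOn W (Icc 0 T) ∧ W 0 = W₀ ∧
  ∃ S : Finset ℝ, ∀ t ∈ Ioo 0 T, t ∉ S →
    ∃ Z : L2 d × HNeg1 d, IsGenerator V (u t) (W t) Z ∧
      HasDerivAt (fun s => State.incl (W s)) Z t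

/-- The target `W_f` is `H¹ × L²`-approximately reachable in time `T⁺` from `W₀`. -/
def ApproxReachable {d : ℕ} (V : Torus d → ℝ) (T : ℝ≥0) (W₀ Wf : State d) : Prop :=
  ∀ ε : ℝ, 0 < ε → ∃ T₁ ∈ Icc (T : ℝ) (T + ε), ∃ u : ℝ → Fin (2 * d + 1) → ℝ,
    IsPiecewiseConstant T₁ u ∧ ∃ W : ℝ → State d, IsSolution V T₁ u W₀ W ∧ ‖W T₁ - Wf‖ < ε

/-- The system is `H¹ × L²`-approximately controllable in time `T⁺` from `W₀`. -/
def ApproxControllable {d : ℕ} (V : Torus d → ℝ) (T : ℝ≥0) (W₀ : State d) : Prop :=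
  ∀ Wf : State d, ApproxReachable V T W₀ Wf

/-- The minimum time `𝒯(W₀)` for `H¹ × L²`-approximate controllability from `W₀`, equal to `∞` if
the system is not approximately controllable from `W₀` in any time. -/
def minimalTime {d : ℕ} (V : Torus d → ℝ) (W₀ : State d) : ℝ≥0∞ :=
  sInf {T : ℝ≥0∞ | ∃ t : ℝ≥0, T = t ∧ ApproxControllable V t W₀}

/-- The set `Z(f)` of the zeros of `f` (for a class `f`, defined up to a null set). -/
def zeroSet {d : ℕ} {E : Type} [Zero E] (f : Torus d → E) : Set (Torus d) := f ⁻¹' {0}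

end BilinearWave

end

/-!
The time a control acts can tend to `0` while its size, or the size of a conjugating kick, tends to
infinity; the solution then converges to explicit motions, called reachable here. Call the map
`(w, p) ↦ (w, p + φ w)` the kick by `φ`. The following motions of `H¹ × L²` are reachable in
arbitrarily small time, each as such a limit (`reach_limit`, `reach_drift`).

* The kicks by the multiples of the `V_j`: the control `a / τ` during the time `τ`.
* The kick by `-φ²`, if those by the multiples of `φ` are reachable: kick by `φ / √τ`, let the free
  equation run for the time `τ`, and kick by `-φ / √τ` (`isKick_neg_sq`). By the addition formulas,
  `(cos a + cos b)² + (sin a - sin b)² = 2 + 2 cos (a + b)` and similarly for the sine, the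
  frequencies `k` for which `cos (k · x)` and `sin (k · x)` are reachable kicks form a group
  (`kickFrequencies`), so that all the trigonometric polynomials are.
* The dilations `(w, p) ↦ (e^c w, e^{-c} p)`: conjugate by the constant kick `c / τ`, with the
  control `c² / τ²` on `V_0 = 1` (`reach_dilate`).
* The drift `(w, p) ↦ (w + s p, p)` for `p ∈ H¹` and `s > 0`: conjugating the free equation by a
  dilation slows down everything but the term `∂_t w = p` (`reach_drift`).

If `w₀` vanishes only on a null set, the products of `w₀` and trigonometric polynomials are dense in
`L²`, because an integrable function is determined by its Fourier coefficients. Hence the velocity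
can be changed arbitrarily by kicks (`reach_velocity`). To reach `(w_f, p_f)`, kick the velocity to
`v = w_f - w₀`, drift for `s = 1` to the position `w_f`, and kick the velocity to `p_f`; for the
last kick `w_f` is replaced by `w_f + s` with a small constant `s` for which it has almost no zeros,
which holds for all but countably many `s` (`exists_volume_zeroSet_eq_zero`). If only the common zeros of
`w₀` and its velocity in `H¹` are negligible, a drift by a generic `s` leads to the former case.

The equation with a bounded potential term is solved as follows. With the inclusion `J : H¹ → L²`,
whose adjoint is `(1 - Δ)⁻¹`, the operator `A` is the inverse of the bounded skew operator
`G(w, p) = (-J* p, J w)` (`waveInv`), which generates a unitary group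
(`IsSkew.exists_isUnitaryGroup`); a bounded perturbation is treated in the interaction picture, as
an ordinary differential equation with Lipschitz coefficients. The Sobolev inequality makes the
multiplication by `V` a bounded operator `H¹ → L²` (`AdmissiblePotential.exists_mul`). A kick by `φ`
conjugates the generator with the potential `V - φ²` and the damping terms `± φ` to the one with the
potential `V` (`IsUnitaryGroup.hasDerivAt_kick`), so that the limits follow from the continuous
dependence of solutions on bounded generators (`IsUnitaryGroup.tendsto_of_isInteractionSol`).
-/

noncomputable section

namespace BilinearWave

open Filter Topology
open scoped InnerProductSpace

/-! ### Unitary groups of inverses of bounded skew operators -/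

section UnitaryGroup

variable {X : Type*} [NormedAddCommGroup X] [InnerProductSpace ℝ X]

/-- A bounded operator on a real Hilbert space is skew if it is minus its adjoint. -/
def IsSkew (A : X →L[ℝ] X) : Prop := ∀ x y, ⟪A x, y⟫_ℝ = -⟪x, A y⟫_ℝ

theorem IsSkew.sub {A B : X →L[ℝ] X} (hA : IsSkew A) (hB : IsSkew B) : IsSkew (A - B) := by
  intro x y
  simp only [sub_apply, inner_sub_left, inner_sub_right, hA x y, hB x y]
  ring

theorem IsSkew.inner_self_eq_zero {A : X →L[ℝ] X} (hA : IsSkew A) (x : X) : ⟪x, A x⟫_ℝ = 0 := by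
  have h := hA x x
  rw [real_inner_comm] at h
  linarith

variable [CompleteSpace X]

theorem hasDerivAt_exp_smul_apply (A : X →L[ℝ] X) (x : X) (t : ℝ) :
    HasDerivAt (fun s : ℝ => NormedSpace.exp (s • A) x) (NormedSpace.exp (t • A) (A x)) t := by
  have h := (hasDerivAt_exp_smul_const (𝕂 := ℝ) A t).clm_apply (hasDerivAt_const t x)
  simpa using h

theorem IsSkew.norm_exp_apply {A : X →L[ℝ] X} (hA : IsSkew A) (t : ℝ) (x : X) :
    ‖NormedSpace.exp (t • A) x‖ = ‖x‖ := by
  have hd : ∀ s : ℝ, HasDerivAt (fun s : ℝ => ‖NormedSpace.exp (s • A) x‖ ^ 2) 0 s := by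
    intro s
    have h := (hasDerivAt_exp_smul_const' (𝕂 := ℝ) A s).clm_apply (hasDerivAt_const s x)
    have h2 := h.norm_sq
    simpa [hA.inner_self_eq_zero] using h2
  have hc := is_const_of_deriv_eq_zero (fun s => (hd s).differentiableAt)
    (fun s => (hd s).deriv) t 0
  have h0 : NormedSpace.exp ((0 : ℝ) • A) x = x := by simp
  simp only [h0] at hc
  exact (sq_eq_sq₀ (norm_nonneg _) (norm_nonneg _)).1 hc

/-- The orbits of a bounded skew operator are Lipschitz in time. -/
theorem IsSkew.norm_exp_sub_le {A : X →L[ℝ] X} (hA : IsSkew A) (x : X) (s t : ℝ) :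
    ‖NormedSpace.exp (t • A) x - NormedSpace.exp (s • A) x‖ ≤ ‖A x‖ * ‖t - s‖ :=
  Convex.norm_image_sub_le_of_norm_hasDerivWithin_le (s := univ)
    (fun r _ => (hasDerivAt_exp_smul_apply A x r).hasDerivWithinAt)
    (fun r _ => (hA.norm_exp_apply r (A x)).le) convex_univ (mem_univ s) (mem_univ t)

/-- For skew `G`, the positive operator `c - G²` is invertible. -/
theorem IsSkew.exists_inverse {G : X →L[ℝ] X} (hG : IsSkew G) {c : ℝ} (hc : 0 < c) :
    ∃ S : X →L[ℝ] X, S * (c • 1 - G * G) = 1 ∧ (c • 1 - G * G) * S = 1 ∧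
      (∀ x y, ⟪S x, y⟫_ℝ = ⟪x, S y⟫_ℝ) ∧ ∀ x, ‖c • S x‖ ≤ ‖x‖ := by
  set H : X →L[ℝ] X := c • 1 - G * G with hH
  have hHx : ∀ x, H x = c • x - G (G x) := fun x => rfl
  have hpos : ∀ x, c * ‖x‖ * ‖x‖ ≤ ⟪H x, x⟫_ℝ := by
    intro x
    rw [hHx, inner_sub_left, hG (G x) x, inner_smul_left, real_inner_self_eq_norm_sq,
      real_inner_self_eq_norm_sq]
    simp only [conj_trivial]
    nlinarith [sq_nonneg ‖G x‖]
  have hsymm : ∀ x y, ⟪H x, y⟫_ℝ = ⟪x, H y⟫_ℝ := by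
    intro x y
    simp only [hHx, inner_sub_left, inner_sub_right, inner_smul_left, inner_smul_right, hG (G x) y,
      hG x (G y), conj_trivial]
    rw [neg_neg]
  have hco : IsCoercive ((innerSL ℝ).comp H) := ⟨c, hc, fun u => hpos u⟩
  let e := hco.continuousLinearEquivOfBilin
  have he : ∀ x, e x = H x := fun x =>
    ext_inner_right ℝ fun y => hco.continuousLinearEquivOfBilin_apply x y
  have hHS : ∀ x, H (e.symm x) = x := fun x => by rw [← he, e.apply_symm_apply]
  refine ⟨e.symm, ?_, ?_, ?_, ?_⟩
  · ext x
    change e.symm (H x) = x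
    rw [← he, e.symm_apply_apply]
  · ext x
    exact hHS x
  · intro x y
    change ⟪e.symm x, y⟫_ℝ = ⟪x, e.symm y⟫_ℝ
    conv_lhs => rw [← hHS y]
    conv_rhs => rw [← hHS x]
    exact (hsymm _ _).symm
  · intro x
    change ‖c • e.symm x‖ ≤ ‖x‖
    have h1 := hpos (e.symm x)
    rw [hHS] at h1
    have h2 := h1.trans (real_inner_le_norm _ _)
    rw [norm_smul, Real.norm_eq_abs, abs_of_pos hc]
    rcases (norm_nonneg (e.symm x)).eq_or_lt with h | h
    · rw [← h]; simp
    · exact le_of_mul_le_mul_right h2 h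

/-- A skew operator `G` with dense range has an unbounded skew inverse; the bounded skew operators
`-G (c - G²)⁻¹` approximate this inverse as `c → 0`. -/
theorem IsSkew.exists_approx_inverse {G : X →L[ℝ] X} (hG : IsSkew G) (hd : DenseRange G) :
    ∃ A : ℕ → X →L[ℝ] X, (∀ n, IsSkew (A n)) ∧ (∀ n, Commute G (A n)) ∧
      (∀ m n, Commute (A m) (A n)) ∧ (∀ n y, ‖A n (G y)‖ ≤ 2 * ‖y‖) ∧
      ∀ y, Tendsto (fun n => A n (G y)) atTop (𝓝 y) := by
  have hc : ∀ n : ℕ, (0 : ℝ) < 1 / ((n : ℝ) + 1) := fun n => Nat.one_div_pos_of_nat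
  choose S hS1 hS2 hS3 hS4 using fun n : ℕ => hG.exists_inverse (hc n)
  set c : ℕ → ℝ := fun n => 1 / ((n : ℝ) + 1) with hcdef
  let u : ∀ n, (X →L[ℝ] X)ˣ := fun n => ⟨_, S n, hS2 n, hS1 n⟩
  have hcomm : ∀ B : X →L[ℝ] X, Commute B G → ∀ n, Commute B (S n) := by
    intro B hB n
    have h : Commute B (u n : X →L[ℝ] X) :=
      ((Commute.one_right B).smul_right (c n)).sub_right (hB.mul_right hB)
    exact h.units_inv_right
  have hGS : ∀ n, Commute G (S n) := hcomm G (Commute.refl G)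
  have hkey : ∀ n y, (-(G * S n)) (G y) = y - c n • S n y := by
    intro n y
    have h1 : S n (G y) = G (S n y) := by
      have := congrArg (fun T : X →L[ℝ] X => T y) (hGS n).eq
      exact this.symm
    have h2 : c n • S n y - G (G (S n y)) = y := congrArg (fun T : X →L[ℝ] X => T y) (hS2 n)
    change -(G (S n (G y))) = _
    rw [h1]
    nth_rewrite 2 [← h2]
    abel
  refine ⟨fun n => -(G * S n), ?_, ?_, ?_, ?_, ?_⟩
  · intro n x y
    change ⟪-(G (S n x)), y⟫_ℝ = -⟪x, -(G (S n y))⟫_ℝ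
    have h1 : G (S n y) = S n (G y) := congrArg (fun T : X →L[ℝ] X => T y) (hGS n).eq
    rw [inner_neg_left, inner_neg_right, hG, hS3, h1]
  · exact fun n => ((Commute.refl G).mul_right (hGS n)).neg_right
  · intro m n
    have h1 : Commute (G * S m) G := ((Commute.refl G).mul_right (hGS m)).symm
    exact ((h1.mul_right (hcomm _ h1 n)).neg_right).neg_left
  · intro n y
    rw [hkey]
    calc _ ≤ ‖y‖ + ‖c n • S n y‖ := norm_sub_le _ _
      _ ≤ _ := by linarith [hS4 n y]
  · intro y
    simp only [hkey]
    suffices h : Tendsto (fun n => c n • S n y) atTop (𝓝 0) by simpa using h.const_sub y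
    have hclim : Tendsto c atTop (𝓝 0) := tendsto_one_div_add_atTop_nhds_zero_nat
    -- on the range of `G²` the convergence is explicit; the rest follows by density
    have h2 : DenseRange (G ∘ G) := hd.comp hd G.continuous
    rw [Metric.tendsto_atTop]
    intro ε hε
    obtain ⟨z, hz⟩ := h2.exists_dist_lt y (half_pos hε)
    have h3 : Tendsto (fun n => c n * (2 * ‖z‖)) atTop (𝓝 0) := by
      simpa using hclim.mul_const (2 * ‖z‖)
    obtain ⟨N, hN⟩ := (h3.eventually (gt_mem_nhds (half_pos hε))).exists_forall_of_atTop
    refine ⟨N, fun n hn => ?_⟩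
    have h4 : S n (G (G z)) = c n • S n z - z := by
      have : S n (c n • z - G (G z)) = z := congrArg (fun T : X →L[ℝ] X => T z) (hS1 n)
      rw [map_sub, map_smul] at this
      exact eq_sub_of_add_eq' (sub_eq_iff_eq_add.1 this).symm
    rw [dist_zero_right]
    have h5 : c n • S n y = c n • S n (y - G (G z)) + c n • (c n • S n z - z) := by
      rw [← h4, map_sub]; module
    have h6 : ‖y - G (G z)‖ < ε / 2 := by rw [← dist_eq_norm]; exact hz
    have h7 : ‖c n • (c n • S n z - z)‖ ≤ c n * (2 * ‖z‖) := by
      rw [norm_smul, Real.norm_eq_abs, abs_of_pos (hc n)]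
      refine mul_le_mul_of_nonneg_left ((norm_sub_le _ _).trans ?_) (hc n).le
      linarith [hS4 n z]
    calc _ ≤ ‖c n • S n (y - G (G z))‖ + ‖c n • (c n • S n z - z)‖ := by
          rw [h5]; exact norm_add_le _ _
      _ < ε := by linarith [hS4 n (y - G (G z)), hN n hn]

/-- `U` is a strongly continuous unitary group with generator `G⁻¹`: the derivative of
`t ↦ U t (G x)` is `U t x`. -/
structure IsUnitaryGroup (G : X →L[ℝ] X) (U : ℝ → X →L[ℝ] X) : Prop where
  zero_apply : ∀ x, U 0 x = x
  add_apply : ∀ s t x, U (s + t) x = U s (U t x)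
  norm_apply : ∀ t x, ‖U t x‖ = ‖x‖
  continuous_apply : ∀ x, Continuous fun t => U t x
  comm : ∀ t x, G (U t x) = U t (G x)
  hasDerivAt : ∀ t x, HasDerivAt (fun s => U s (G x)) (U t x) t

/-- **Stone's theorem** for the inverse of a bounded skew operator `G` with dense range. -/
theorem IsSkew.exists_isUnitaryGroup {G : X →L[ℝ] X} (hG : IsSkew G) (hd : DenseRange G) :
    ∃ U : ℝ → X →L[ℝ] X, IsUnitaryGroup G U := by
  obtain ⟨A, hA, hGA, hAA, hA2, hAlim⟩ := hG.exists_approx_inverse hd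
  let E : ℕ → ℝ → X →L[ℝ] X := fun n t => NormedSpace.exp (t • A n)
  have hE : ∀ n t x, ‖E n t x‖ = ‖x‖ := fun n t x => (hA n).norm_exp_apply t x
  let _ : NormedAlgebra ℚ (X →L[ℝ] X) := NormedAlgebra.restrictScalars ℚ ℝ _
  have hEadd : ∀ n s t x, E n (s + t) x = E n s (E n t x) := by
    intro n s t x
    have : NormedSpace.exp ((s + t) • A n)
        = NormedSpace.exp (s • A n) * NormedSpace.exp (t • A n) := by
      rw [add_smul]
      exact NormedSpace.exp_add_of_commute (((Commute.refl (A n)).smul_left s).smul_right t)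
    exact congrArg (fun T : X →L[ℝ] X => T x) this
  have hEG : ∀ n t x, G (E n t x) = E n t (G x) := by
    intro n t x
    have : Commute G (E n t) := ((hGA n).smul_right t).exp_right
    exact congrArg (fun T : X →L[ℝ] X => T x) this.eq
  have hdiff : ∀ m n t x, ‖E m t x - E n t x‖ ≤ ‖A m x - A n x‖ * |t| := by
    intro m n t x
    have h1 : E m t x = E n t (NormedSpace.exp (t • (A m - A n)) x) := by
      have : NormedSpace.exp (t • A m)
          = NormedSpace.exp (t • A n) * NormedSpace.exp (t • (A m - A n)) := by
        rw [← NormedSpace.exp_add_of_commute]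
        · congr 1; module
        · exact (((hAA n m).sub_right (Commute.refl _)).smul_left t).smul_right t
      exact congrArg (fun T : X →L[ℝ] X => T x) this
    rw [h1, ← map_sub, hE]
    simpa using ((hA m).sub (hA n)).norm_exp_sub_le x 0 t
  have hCauchy : ∀ t x, CauchySeq fun n => E n t x := by
    intro t x
    rw [Metric.cauchySeq_iff']
    intro ε hε
    obtain ⟨y, hy⟩ := hd.exists_dist_lt x (show 0 < ε / 4 by positivity)
    have h1 : CauchySeq fun n => A n (G y) := (hAlim y).cauchySeq
    obtain ⟨N, hN⟩ := Metric.cauchySeq_iff'.1 h1 (ε / (4 * (|t| + 1))) (by positivity)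
    refine ⟨N, fun n hn => ?_⟩
    have h2 := hdiff n N t (G y)
    have h3 : ‖A n (G y) - A N (G y)‖ * |t| ≤ ε / 4 := by
      have h4 := (hN n hn).le
      rw [dist_eq_norm] at h4
      calc _ ≤ ε / (4 * (|t| + 1)) * (|t| + 1) := by gcongr; linarith
        _ = ε / 4 := by field_simp
    have h5 : E n t x - E N t x
        = E n t (x - G y) + (E n t (G y) - E N t (G y)) - E N t (x - G y) := by
      simp only [map_sub]; abel
    rw [dist_eq_norm] at hy ⊢
    rw [h5]
    calc _ ≤ ‖E n t (x - G y)‖ + ‖E n t (G y) - E N t (G y)‖ + ‖E N t (x - G y)‖ :=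
          (norm_sub_le _ _).trans (add_le_add_left (norm_add_le _ _) _)
      _ < ε := by rw [hE, hE]; linarith
  choose u hu using fun t x => cauchySeq_tendsto_of_complete (hCauchy t x)
  have hunorm : ∀ t x, ‖u t x‖ = ‖x‖ := fun t x =>
    tendsto_nhds_unique (hu t x).norm (by simp only [hE]; exact tendsto_const_nhds)
  let U : ℝ → X →L[ℝ] X := fun t => LinearMap.mkContinuous
    { toFun := u t
      map_add' := fun x y => tendsto_nhds_unique (hu t (x + y))
        (by simpa only [map_add] using (hu t x).add (hu t y))
      map_smul' := fun c x => tendsto_nhds_unique (hu t (c • x))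
        (by simpa only [map_smul, RingHom.id_apply] using (hu t x).const_smul c) } 1
    (fun x => by simpa using (hunorm t x).le)
  have hU : ∀ t x, Tendsto (fun n => E n t x) atTop (𝓝 (U t x)) := hu
  have hUnorm : ∀ t x, ‖U t x‖ = ‖x‖ := hunorm
  have hUcomp : ∀ t (y : ℕ → X) x, Tendsto y atTop (𝓝 x) →
      Tendsto (fun n => E n t (y n)) atTop (𝓝 (U t x)) := by
    intro t y x hy
    have h1 : Tendsto (fun n => E n t (y n - x)) atTop (𝓝 0) := by
      rw [tendsto_zero_iff_norm_tendsto_zero]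
      simp only [hE]
      simpa using (hy.sub_const x).norm
    simpa using h1.add (hU t x)
  have hUG : ∀ t x, G (U t x) = U t (G x) := fun t x =>
    tendsto_nhds_unique ((G.continuous.tendsto _).comp (hU t x))
      (by simpa only [Function.comp_def, hEG] using hU t (G x))
  have hcontG : ∀ y, Continuous fun t => U t (G y) := by
    intro y
    refine (LipschitzWith.of_dist_le_mul (K := 2 * ‖y‖₊) fun s t => ?_).continuous
    have h1 := ((hU s (G y)).sub (hU t (G y))).norm
    rw [dist_eq_norm, dist_eq_norm]
    refine le_of_tendsto h1 (Eventually.of_forall fun n => ?_)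
    refine ((hA n).norm_exp_sub_le (G y) t s).trans ?_
    exact mul_le_mul_of_nonneg_right (hA2 n y) (norm_nonneg _)
  have hcont : ∀ x, Continuous fun t => U t x := by
    intro x
    refine continuous_of_uniform_approx_of_continuous fun u hu => ?_
    obtain ⟨ε, hε, hεu⟩ := Metric.mem_uniformity_dist.1 hu
    obtain ⟨y, hy⟩ := hd.exists_dist_lt x hε
    refine ⟨fun t => U t (G y), hcontG y, fun t => hεu ?_⟩
    rw [dist_eq_norm, ← map_sub, hUnorm, ← dist_eq_norm]
    exact hy
  refine ⟨U, ?_, ?_, hUnorm, hcont, hUG, ?_⟩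
  · intro x
    refine tendsto_nhds_unique (hU 0 x) ?_
    simp [E]
  · intro s t x
    refine tendsto_nhds_unique (hU (s + t) x) ?_
    simp only [hEadd]
    exact hUcomp s _ _ (hU t x)
  · intro t x
    have hint : ∀ r, U r (G x) = G x + ∫ s in (0 : ℝ)..r, U s x := by
      intro r
      have h1 : ∀ n, E n r (G x) = G x + ∫ s in (0 : ℝ)..r, E n s (A n (G x)) := by
        intro n
        have hc : Continuous fun s => E n s (A n (G x)) :=
          continuous_iff_continuousAt.2 fun s =>
            (hasDerivAt_exp_smul_apply (A n) (A n (G x)) s).continuousAt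
        rw [intervalIntegral.integral_eq_sub_of_hasDerivAt
          (fun s _ => hasDerivAt_exp_smul_apply (A n) (G x) s) (hc.intervalIntegrable _ _)]
        simp [E]
      refine tendsto_nhds_unique (hU r (G x)) ?_
      simp only [h1]
      refine Tendsto.const_add _ ?_
      refine intervalIntegral.tendsto_integral_filter_of_dominated_convergence
        (fun _ => 2 * ‖x‖) ?_ ?_ (by simp) ?_
      · refine Eventually.of_forall fun n => Continuous.aestronglyMeasurable ?_
        exact continuous_iff_continuousAt.2 fun s =>
            (hasDerivAt_exp_smul_apply (A n) (A n (G x)) s).continuousAt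
      · exact Eventually.of_forall fun n => ae_of_all _ fun s _ => by
          rw [hE]; exact hA2 n x
      · exact ae_of_all _ fun s _ => hUcomp s _ _ (hAlim x)
    have h2 : HasDerivAt (fun r => G x + ∫ s in (0 : ℝ)..r, U s x) (U t x) t :=
      (intervalIntegral.integral_hasDerivAt_right ((hcont x).intervalIntegrable _ _)
        (hcont x).aestronglyMeasurable.stronglyMeasurableAtFilter
        (hcont x).continuousAt).const_add _
    exact h2.congr_of_eventuallyEq (Eventually.of_forall hint)

end UnitaryGroup

/-! ### Bounded perturbations in the interaction picture -/

section Perturbation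

variable {X : Type*} [NormedAddCommGroup X] [InnerProductSpace ℝ X]
  {G : X →L[ℝ] X} {U : ℝ → X →L[ℝ] X}

theorem IsUnitaryGroup.continuous_uncurry (hU : IsUnitaryGroup G U) :
    Continuous fun p : ℝ × X => U p.1 p.2 :=
  continuous_prod_of_continuous_lipschitzWith' _ 1
    (fun t => LipschitzWith.of_dist_le_mul fun x y => by
      rw [dist_eq_norm, ← map_sub, hU.norm_apply, dist_eq_norm]; simp) hU.continuous_apply

theorem IsUnitaryGroup.apply_neg_apply (hU : IsUnitaryGroup G U) (t : ℝ) (x : X) :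
    U t (U (-t) x) = x := by
  rw [← hU.add_apply, add_neg_cancel, hU.zero_apply]

/-- The coefficient of the equation `z' = U(-τσ) P U(τσ) z` that `y(σ) = U(τσ) z(σ)` turns into
`y' = (τ G⁻¹ + P) y`. -/
def interactionCoeff (U : ℝ → X →L[ℝ] X) (P : X →L[ℝ] X) (τ σ : ℝ) : X →L[ℝ] X :=
  (U (-(τ * σ))).comp (P.comp (U (τ * σ)))

/-- `z` solves on `[0, 1]` the equation `y' = (τ G⁻¹ + P) y` in the interaction picture
`y(σ) = U(τσ) z(σ)`. -/
def IsInteractionSol (U : ℝ → X →L[ℝ] X) (P : X →L[ℝ] X) (τ : ℝ) (z : ℝ → X) : Prop :=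
  ∀ σ ∈ Icc (0 : ℝ) 1,
    HasDerivWithinAt z (interactionCoeff U P τ σ (z σ)) (Icc 0 1) σ

theorem IsInteractionSol.continuousOn {P : X →L[ℝ] X} {τ : ℝ} {z : ℝ → X}
    (hz : IsInteractionSol U P τ z) : ContinuousOn z (Icc 0 1) :=
  fun σ hσ => (hz σ hσ).continuousWithinAt

theorem IsUnitaryGroup.norm_interactionCoeff_le (hU : IsUnitaryGroup G U) (P : X →L[ℝ] X)
    (τ σ : ℝ) (x : X) : ‖interactionCoeff U P τ σ x‖ ≤ ‖P‖ * ‖x‖ := by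
  change ‖U _ (P (U _ x))‖ ≤ _
  rw [hU.norm_apply]
  exact (P.le_opNorm _).trans (by rw [hU.norm_apply])

theorem IsUnitaryGroup.lipschitzWith_interactionCoeff (hU : IsUnitaryGroup G U) (P : X →L[ℝ] X)
    (τ σ : ℝ) : LipschitzWith ‖P‖₊ (interactionCoeff U P τ σ) :=
  LipschitzWith.of_dist_le_mul fun x y => by
    rw [dist_eq_norm, ← map_sub, dist_eq_norm]
    exact hU.norm_interactionCoeff_le P τ σ _

theorem IsUnitaryGroup.continuous_interactionCoeff (hU : IsUnitaryGroup G U) (P : X →L[ℝ] X) :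
    Continuous fun p : (ℝ × ℝ) × X => interactionCoeff U P p.1.1 p.1.2 p.2 := by
  have h1 : Continuous fun p : (ℝ × ℝ) × X => U (p.1.1 * p.1.2) p.2 :=
    hU.continuous_uncurry.comp (f := fun p : (ℝ × ℝ) × X => (p.1.1 * p.1.2, p.2)) (by fun_prop)
  exact hU.continuous_uncurry.comp
    (f := fun p : (ℝ × ℝ) × X => (-(p.1.1 * p.1.2), P (U (p.1.1 * p.1.2) p.2)))
    (Continuous.prodMk (by fun_prop) (P.continuous.comp h1))

/-- A solution exists on the whole of `[0, 1]`: the bound on `P` lets a single application of the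
Picard–Lindelöf theorem, on the ball of radius `‖x‖` around `x`, suffice. -/
theorem IsUnitaryGroup.exists_isInteractionSol [CompleteSpace X] (hU : IsUnitaryGroup G U)
    {P : X →L[ℝ] X} (hP : ‖P‖ ≤ 1 / 2) (τ : ℝ) (x : X) :
    ∃ z : ℝ → X, z 0 = x ∧ IsInteractionSol U P τ z := by
  have hpl : IsPicardLindelof (fun σ z => interactionCoeff U P τ σ z) (tmin := 0) (tmax := 1)
      ⟨0, by simp⟩ x ‖x‖₊ 0 ‖x‖₊ ‖P‖₊ := by
    refine ⟨fun t _ => (hU.lipschitzWith_interactionCoeff P τ t).lipschitzOnWith, ?_, ?_, ?_⟩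
    · intro y _
      exact ((hU.continuous_interactionCoeff P).comp
        (f := fun σ : ℝ => ((τ, σ), y)) (by fun_prop)).continuousOn
    · intro t _ y hy
      refine (hU.norm_interactionCoeff_le P τ t y).trans ?_
      have h1 : ‖y‖ ≤ ‖x‖ + ‖x‖ := by
        have h2 := norm_le_norm_add_norm_sub' y x
        have h3 : ‖y - x‖ ≤ ‖x‖ := by simpa [dist_eq_norm] using hy
        linarith
      calc _ ≤ 1 / 2 * (‖x‖ + ‖x‖) := by gcongr
        _ = _ := by rw [coe_nnnorm]; ring
    · simp
  exact hpl.exists_eq_forall_mem_Icc_hasDerivWithinAt₀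

/-- The Grönwall inequality for an approximate solution `w` of the equation in the interaction
picture. -/
theorem IsUnitaryGroup.dist_le_of_isInteractionSol (hU : IsUnitaryGroup G U) {P : X →L[ℝ] X}
    {τ : ℝ} {z w w' : ℝ → X} (hz : IsInteractionSol U P τ z)
    (hw : ∀ σ ∈ Icc (0 : ℝ) 1, HasDerivWithinAt w (w' σ) (Icc 0 1) σ) {ε : ℝ}
    (hε : ∀ σ ∈ Icc (0 : ℝ) 1, dist (w' σ) (interactionCoeff U P τ σ (w σ)) ≤ ε) :
    dist (z 1) (w 1) ≤ (dist (z 0) (w 0) + ε) * Real.exp ‖P‖ := by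
  have hε0 : 0 ≤ ε := dist_nonneg.trans (hε 0 (by simp))
  have hmem : ∀ σ ∈ Ico (0 : ℝ) 1, Icc (0 : ℝ) 1 ∈ 𝓝[Ici σ] σ := fun σ hσ =>
    mem_of_superset (Icc_mem_nhdsGE hσ.2) (Icc_subset_Icc_left hσ.1)
  have h := dist_le_of_approx_trajectories_ODE (v := fun σ z => interactionCoeff U P τ σ z)
    (K := ‖P‖₊) (εf := 0) (εg := ε)
    (fun t => hU.lipschitzWith_interactionCoeff P τ t) hz.continuousOn
    (fun σ hσ => (hz σ (Ico_subset_Icc_self hσ)).mono_of_mem_nhdsWithin (hmem σ hσ))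
    (fun σ _ => (dist_self _).le) (fun σ hσ => (hw σ hσ).continuousWithinAt)
    (fun σ hσ => (hw σ (Ico_subset_Icc_self hσ)).mono_of_mem_nhdsWithin (hmem σ hσ))
    (fun σ hσ => hε σ (Ico_subset_Icc_self hσ)) le_rfl 1 (by simp)
  refine h.trans ?_
  rw [zero_add, sub_zero]
  rcases (norm_nonneg P).eq_or_lt with h0 | h0
  · rw [coe_nnnorm, ← h0, gronwallBound_K0]; simp
  · rw [coe_nnnorm, gronwallBound_of_K_ne_0 h0.ne', add_mul]
    simp only [mul_one]
    refine add_le_add_right ?_ _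
    rw [div_mul_eq_mul_div, div_le_iff₀ h0, mul_assoc]
    refine mul_le_mul_of_nonneg_left ?_ hε0
    -- `e^K - 1 ≤ K e^K`
    have h1 := Real.one_sub_le_exp_neg ‖P‖
    rw [Real.exp_neg] at h1
    have h2 := Real.exp_pos ‖P‖
    have h3 : (1 - ‖P‖) * Real.exp ‖P‖ ≤ 1 := by
      calc _ ≤ (Real.exp ‖P‖)⁻¹ * Real.exp ‖P‖ := by gcongr
        _ = 1 := inv_mul_cancel₀ h2.ne'
    linarith

/-- As `τ → 0` the generator `τ G⁻¹ + P τ` may be replaced by the limit `P₀` of `P τ`. -/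
theorem IsUnitaryGroup.tendsto_of_isInteractionSol (hU : IsUnitaryGroup G U)
    {P : ℝ → X →L[ℝ] X} {P₀ : X →L[ℝ] X} (hP : Tendsto P (𝓝[>] 0) (𝓝 P₀))
    {z : ℝ → ℝ → X} (hz : ∀ᶠ τ in 𝓝[>] (0 : ℝ), IsInteractionSol U (P τ) τ (z τ))
    {γ : ℝ → X} (hγ : ∀ σ, HasDerivAt γ (P₀ (γ σ)) σ) (h0 : ∀ τ, z τ 0 = γ 0) :
    Tendsto (fun τ => U τ (z τ 1)) (𝓝[>] 0) (𝓝 (γ 1)) := by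
  have hγc : Continuous γ := continuous_iff_continuousAt.2 fun σ => (hγ σ).continuousAt
  obtain ⟨M, hM⟩ := isCompact_Icc.exists_bound_of_continuousOn
    (hγc.continuousOn (s := Icc (0 : ℝ) 1))
  have hM0 : 0 ≤ M := (norm_nonneg _).trans (hM 0 (by simp))
  have hmain : Tendsto (fun τ => dist (z τ 1) (γ 1)) (𝓝[>] 0) (𝓝 0) := by
    rw [Metric.tendsto_nhds]
    intro ε hε
    set C : ℝ := Real.exp (‖P₀‖ + 1) with hC
    have hCpos : 0 < C := Real.exp_pos _
    set η : ℝ := ε / (4 * C) with hη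
    have hηpos : 0 < η := by positivity
    have e1 : ∀ᶠ τ in 𝓝[>] (0 : ℝ), ‖P τ - P₀‖ * M < η := by
      have h1 : Tendsto (fun τ => ‖P τ - P₀‖ * M) (𝓝[>] 0) (𝓝 0) := by
        simpa using ((hP.sub_const P₀).norm).mul_const M
      exact h1.eventually (gt_mem_nhds hηpos)
    have e2 : ∀ᶠ τ in 𝓝[>] (0 : ℝ), ‖P τ‖ < ‖P₀‖ + 1 :=
      hP.norm.eventually (gt_mem_nhds (lt_add_one _))
    have e3 : ∀ᶠ τ in 𝓝 (0 : ℝ), ∀ σ ∈ Icc (0 : ℝ) 1,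
        dist (P₀ (γ σ)) (interactionCoeff U P₀ τ σ (γ σ)) < η := by
      refine isCompact_Icc.eventually_forall_of_forall_eventually fun σ _ => ?_
      have hc : Continuous fun p : ℝ × ℝ =>
          dist (P₀ (γ p.2)) (interactionCoeff U P₀ p.1 p.2 (γ p.2)) := by
        refine (P₀.continuous.comp (hγc.comp continuous_snd)).dist
          ((hU.continuous_interactionCoeff P₀).comp
            (f := fun p : ℝ × ℝ => (p, γ p.2)) (by fun_prop))
      refine (hc.tendsto (0, σ)).eventually (gt_mem_nhds ?_)
      have : interactionCoeff U P₀ 0 σ (γ σ) = P₀ (γ σ) := by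
        simp [interactionCoeff, hU.zero_apply]
      simp only [this, dist_self]
      exact hηpos
    filter_upwards [hz, e1, e2, nhdsWithin_le_nhds e3] with τ h1 h2 h3 h4
    have h5 := hU.dist_le_of_isInteractionSol h1 (w := γ) (w' := fun σ => P₀ (γ σ)) (ε := η + η)
      (fun σ _ => (hγ σ).hasDerivWithinAt) (fun σ hσ => by
        refine (dist_triangle _ (interactionCoeff U P₀ τ σ (γ σ)) _).trans
          (add_le_add (h4 σ hσ).le ?_)
        rw [dist_comm, dist_eq_norm]
        have : interactionCoeff U (P τ) τ σ (γ σ) - interactionCoeff U P₀ τ σ (γ σ)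
            = interactionCoeff U (P τ - P₀) τ σ (γ σ) := by
          simp [interactionCoeff]
        rw [this]
        refine (hU.norm_interactionCoeff_le _ _ _ _).trans (le_trans ?_ h2.le)
        exact mul_le_mul_of_nonneg_left (hM σ hσ) (norm_nonneg _))
    rw [h0, dist_self, zero_add] at h5
    rw [Real.dist_0_eq_abs, abs_of_nonneg dist_nonneg]
    calc _ ≤ (η + η) * C := h5.trans (by rw [hC]; gcongr)
      _ = ε / 2 := by rw [hη]; field_simp; norm_num
      _ < ε := half_lt_self hε
  have h2 : Tendsto (fun τ => U τ (γ 1)) (𝓝[>] 0) (𝓝 (γ 1)) := by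
    have := (hU.continuous_apply (γ 1)).tendsto 0
    rw [hU.zero_apply] at this
    exact this.mono_left nhdsWithin_le_nhds
  have h3 : Tendsto (fun τ => U τ (z τ 1 - γ 1)) (𝓝[>] 0) (𝓝 0) := by
    rw [tendsto_zero_iff_norm_tendsto_zero]
    simpa only [hU.norm_apply, ← dist_eq_norm] using hmain
  simpa using h3.add h2

/-- In the variable `y(σ) = U(τσ) z(σ)` the equation is `(G y)' = τ y + G P y`, the form of
`y' = (τ G⁻¹ + P) y` that makes sense for `y` outside the domain of `G⁻¹`. -/
theorem IsUnitaryGroup.hasDerivAt_isInteractionSol (hU : IsUnitaryGroup G U) {P : X →L[ℝ] X}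
    {τ : ℝ} {z : ℝ → X} (hz : IsInteractionSol U P τ z) {σ : ℝ} (hσ : σ ∈ Ioo (0 : ℝ) 1) :
    HasDerivAt (fun s => G (U (τ * s) (z s)))
      (τ • U (τ * σ) (z σ) + G (P (U (τ * σ) (z σ)))) σ := by
  have hz' : HasDerivAt z (interactionCoeff U P τ σ (z σ)) σ :=
    (hz σ (Ioo_subset_Icc_self hσ)).hasDerivAt (Icc_mem_nhds hσ.1 hσ.2)
  set a := interactionCoeff U P τ σ (z σ) with ha
  have hUa : U (τ * σ) a = P (U (τ * σ) (z σ)) := hU.apply_neg_apply _ _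
  -- the remainder `z s - z σ` is small of first order and carried along by the isometries `U`
  have h1 : HasDerivAt (fun s => U (τ * s) (G (z σ))) (τ • U (τ * σ) (z σ)) σ := by
    have h := (hU.hasDerivAt (τ * σ) (z σ)).scomp σ ((hasDerivAt_id σ).const_mul τ)
    simpa [Function.comp_def] using h
  have h2 : HasDerivAt (fun s => U (τ * s) (G (z s - z σ))) (G (P (U (τ * σ) (z σ)))) σ := by
    rw [hasDerivAt_iff_tendsto_slope]
    have h3 : Tendsto (slope z σ) (𝓝[≠] σ) (𝓝 a) := hasDerivAt_iff_tendsto_slope.1 hz'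
    have h4 : Tendsto (fun s => U (τ * s) (G (slope z σ s))) (𝓝[≠] σ)
        (𝓝 (U (τ * σ) (G a))) := by
      have hc : Tendsto (fun s : ℝ => τ * s) (𝓝[≠] σ) (𝓝 (τ * σ)) :=
        ((continuous_const.mul continuous_id).tendsto σ).mono_left nhdsWithin_le_nhds
      exact (hU.continuous_uncurry.tendsto (τ * σ, G a)).comp
        (hc.prodMk_nhds ((G.continuous.tendsto a).comp h3))
    rw [← hU.comm, hUa] at h4
    refine h4.congr fun s => ?_
    simp [slope_def_module]
  have h5 := h1.add h2
  refine h5.congr_of_eventuallyEq (Eventually.of_forall fun s => ?_)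
  simp only [Pi.add_apply, map_sub, hU.comm]
  abel

end Perturbation

/-! ### Smooth functions and trigonometric polynomials on the torus -/

section Trigonometric

variable {d : ℕ}

theorem IsSmooth.const (c : ℝ) : IsSmooth (fun _ : Torus d => c) := contDiff_const

theorem IsSmooth.add {φ ψ : Torus d → ℝ} (hφ : IsSmooth φ) (hψ : IsSmooth ψ) :
    IsSmooth (fun x => φ x + ψ x) := ContDiff.add hφ hψ

theorem IsSmooth.mul {φ ψ : Torus d → ℝ} (hφ : IsSmooth φ) (hψ : IsSmooth ψ) :
    IsSmooth (fun x => φ x * ψ x) := ContDiff.mul hφ hψ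

theorem IsSmooth.const_mul {φ : Torus d → ℝ} (hφ : IsSmooth φ) (c : ℝ) :
    IsSmooth (fun x => c * φ x) := (IsSmooth.const c).mul hφ

theorem Torus.exists_mk (x : Torus d) : ∃ y, Torus.mk y = x :=
  (Torus.isOpenQuotientMap_mk d).surjective x

theorem IsSmooth.hasFDerivAt {φ : Torus d → ℝ} (hφ : IsSmooth φ) (x : Fin d → ℝ) :
    HasFDerivAt (fun y => φ (Torus.mk y)) (fderiv ℝ (fun y => φ (Torus.mk y)) x) x :=
  ((ContDiff.differentiable hφ (by simp)) x).hasFDerivAt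

theorem IsSmooth.pderiv_mul {φ ψ : Torus d → ℝ} (hφ : IsSmooth φ) (hψ : IsSmooth ψ) (i : Fin d)
    (x : Torus d) :
    pderiv i (fun x => φ x * ψ x) x = φ x * pderiv i ψ x + ψ x * pderiv i φ x := by
  obtain ⟨y, rfl⟩ := Torus.exists_mk x
  rw [(hφ.mul hψ).pderiv_mk, hφ.pderiv_mk, hψ.pderiv_mk,
    ((hφ.hasFDerivAt y).fun_mul (hψ.hasFDerivAt y)).fderiv]
  simp

theorem IsSmooth.pderiv_add {φ ψ : Torus d → ℝ} (hφ : IsSmooth φ) (hψ : IsSmooth ψ) (i : Fin d)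
    (x : Torus d) :
    pderiv i (fun x => φ x + ψ x) x = pderiv i φ x + pderiv i ψ x := by
  obtain ⟨y, rfl⟩ := Torus.exists_mk x
  rw [(hφ.add hψ).pderiv_mk, hφ.pderiv_mk, hψ.pderiv_mk,
    ((hφ.hasFDerivAt y).fun_add (hψ.hasFDerivAt y)).fderiv]
  simp

theorem pderiv_const (c : ℝ) (i : Fin d) (x : Torus d) :
    pderiv i (fun _ => c) x = 0 := by
  simp [pderiv]

theorem IsSmooth.pderiv_const_mul {φ : Torus d → ℝ} (hφ : IsSmooth φ) (c : ℝ) (i : Fin d)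
    (x : Torus d) : pderiv i (fun x => c * φ x) x = c * pderiv i φ x := by
  rw [(IsSmooth.const c).pderiv_mul hφ, pderiv_const]
  simp

/-- The partial derivative of a smooth function along the whole line through `x` in the direction
`i`. -/
theorem IsSmooth.hasDerivAt_translate {φ : Torus d → ℝ} (hφ : IsSmooth φ) (i : Fin d)
    (x : Torus d) (t : ℝ) :
    HasDerivAt (fun s : ℝ => φ (x + Torus.mk (Pi.single i s)))
      (pderiv i φ (x + Torus.mk (Pi.single i t))) t := by
  obtain ⟨y, rfl⟩ := Torus.exists_mk x
  rw [← Torus.mk_add, hφ.pderiv_mk]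
  have h2 : HasDerivAt (fun t : ℝ => y + Pi.single i t) (Pi.single i (1 : ℝ)) t :=
    (hasDerivAt_single i t).const_add y
  have h3 := (hφ.hasFDerivAt (y + Pi.single i t)).comp_hasDerivAt t h2
  simpa only [Function.comp_def, Torus.mk_add] using h3

/-- The coordinate `x_i` of a point of the torus, as an angle. -/
def coordAngle (i : Fin d) (x : Torus d) : Real.Angle := x i

/-- The angle `k · x`. -/
def phase (k : Fin d → ℤ) (x : Torus d) : Real.Angle := ∑ i, k i • coordAngle i x

/-- The function `cos (k · x)`. -/
def cosMode (k : Fin d → ℤ) (x : Torus d) : ℝ := (phase k x).cos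

/-- The function `sin (k · x)`. -/
def sinMode (k : Fin d → ℤ) (x : Torus d) : ℝ := (phase k x).sin

theorem phase_mk (k : Fin d → ℤ) (y : Fin d → ℝ) :
    phase k (Torus.mk y) = ((∑ i, k i * y i : ℝ) : Real.Angle) := by
  have h : ((∑ i, k i * y i : ℝ) : Real.Angle) = ∑ i, ((k i * y i : ℝ) : Real.Angle) :=
    map_sum Real.Angle.coeHom _ _
  rw [h]
  refine Finset.sum_congr rfl fun i _ => ?_
  rw [← zsmul_eq_mul, Real.Angle.coe_zsmul]
  rfl

theorem phase_add (k l : Fin d → ℤ) (x : Torus d) : phase (k + l) x = phase k x + phase l x := by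
  simp only [phase, Pi.add_apply, add_zsmul, Finset.sum_add_distrib]

theorem phase_neg (k : Fin d → ℤ) (x : Torus d) : phase (-k) x = -phase k x := by
  simp only [phase, Pi.neg_apply, neg_zsmul, Finset.sum_neg_distrib]

theorem phase_zero (x : Torus d) : phase 0 x = 0 := by simp [phase]

theorem phase_single (i : Fin d) (x : Torus d) : phase (Pi.single i 1) x = coordAngle i x := by
  rw [phase, Finset.sum_eq_single i]
  · rw [Pi.single_eq_same, one_zsmul]
  · intro j _ hj
    rw [Pi.single_eq_of_ne hj, zero_zsmul]
  · simp

theorem cosMode_mk (k : Fin d → ℤ) (y : Fin d → ℝ) :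
    cosMode k (Torus.mk y) = Real.cos (∑ i, k i * y i) := by
  rw [cosMode, phase_mk, Real.Angle.cos_coe]

theorem sinMode_mk (k : Fin d → ℤ) (y : Fin d → ℝ) :
    sinMode k (Torus.mk y) = Real.sin (∑ i, k i * y i) := by
  rw [sinMode, phase_mk, Real.Angle.sin_coe]

theorem isSmooth_cosMode (k : Fin d → ℤ) : IsSmooth (cosMode k) := by
  simp only [IsSmooth, cosMode_mk]
  fun_prop

theorem isSmooth_sinMode (k : Fin d → ℤ) : IsSmooth (sinMode k) := by
  simp only [IsSmooth, sinMode_mk]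
  fun_prop

theorem hasFDerivAt_phase (k : Fin d → ℤ) (y : Fin d → ℝ) :
    HasFDerivAt (fun y : Fin d → ℝ => ∑ i, k i * y i)
      (∑ i, (k i : ℝ) • ContinuousLinearMap.proj (R := ℝ) (φ := fun _ : Fin d => ℝ) i) y :=
  HasFDerivAt.fun_sum fun i _ => (hasFDerivAt_apply i y).const_mul (k i : ℝ)

theorem phase_proj_single (k : Fin d → ℤ) (i : Fin d) :
    (∑ j, (k j : ℝ) • ContinuousLinearMap.proj (R := ℝ) (φ := fun _ : Fin d => ℝ) j)
      (Pi.single i 1) = k i := by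
  simp [Pi.single_apply]

theorem pderiv_cosMode (k : Fin d → ℤ) (i : Fin d) (x : Torus d) :
    pderiv i (cosMode k) x = -k i * sinMode k x := by
  obtain ⟨y, rfl⟩ := Torus.exists_mk x
  rw [(isSmooth_cosMode k).pderiv_mk]
  simp only [cosMode_mk, sinMode_mk]
  rw [(hasFDerivAt_phase k y).cos.fderiv, smul_apply, phase_proj_single]
  simp
  ring

theorem pderiv_sinMode (k : Fin d → ℤ) (i : Fin d) (x : Torus d) :
    pderiv i (sinMode k) x = k i * cosMode k x := by
  obtain ⟨y, rfl⟩ := Torus.exists_mk x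
  rw [(isSmooth_sinMode k).pderiv_mk]
  simp only [cosMode_mk, sinMode_mk]
  rw [(hasFDerivAt_phase k y).sin.fderiv, smul_apply, phase_proj_single]
  simp
  ring

/-- The functions `cos (k · x)` and `sin (k · x)`. -/
def trigModes (d : ℕ) : Set C(Torus d, ℝ) :=
  {f | ∃ k : Fin d → ℤ, (f : Torus d → ℝ) = cosMode k ∨ (f : Torus d → ℝ) = sinMode k}

/-- Products of trigonometric polynomials are trigonometric polynomials, by the product-to-sum
formulas. -/
theorem span_trigModes_mul_le :
    Submodule.span ℝ (trigModes d) * Submodule.span ℝ (trigModes d)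
      ≤ Submodule.span ℝ (trigModes d) := by
  have hc : ∀ k : Fin d → ℤ, (⟨cosMode k, (isSmooth_cosMode k).continuous⟩ : C(Torus d, ℝ)) ∈
      Submodule.span ℝ (trigModes d) := fun k => Submodule.subset_span ⟨k, Or.inl rfl⟩
  have hs : ∀ k : Fin d → ℤ, (⟨sinMode k, (isSmooth_sinMode k).continuous⟩ : C(Torus d, ℝ)) ∈
      Submodule.span ℝ (trigModes d) := fun k => Submodule.subset_span ⟨k, Or.inr rfl⟩
  have key : ∀ (a : ℝ) {f g h : C(Torus d, ℝ)}, g ∈ Submodule.span ℝ (trigModes d) →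
      h ∈ Submodule.span ℝ (trigModes d) → (∀ x, f x = 1 / 2 * g x + a * h x) →
      f ∈ Submodule.span ℝ (trigModes d) := by
    intro a f g h hg hh hf
    have : f = (1 / 2 : ℝ) • g + a • h := by ext x; simp [hf]
    rw [this]
    exact add_mem (Submodule.smul_mem _ _ hg) (Submodule.smul_mem _ _ hh)
  rw [Submodule.span_mul_span]
  refine Submodule.span_le.2 ?_
  rintro _ ⟨f, ⟨k, hf⟩, g, ⟨l, hg⟩, rfl⟩
  rcases hf with hf | hf <;> rcases hg with hg | hg
  · refine key (1 / 2) (hc (k + l)) (hc (k - l)) fun x => ?_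
    simp only [ContinuousMap.mul_apply, hf, hg, ContinuousMap.coe_mk, cosMode, phase_add,
      phase_neg, sub_eq_add_neg, Real.Angle.cos_add, Real.Angle.cos_neg, Real.Angle.sin_neg]
    ring
  · refine key (-1 / 2) (hs (k + l)) (hs (k - l)) fun x => ?_
    simp only [ContinuousMap.mul_apply, hf, hg, ContinuousMap.coe_mk, cosMode, sinMode, phase_add,
      phase_neg, sub_eq_add_neg, Real.Angle.sin_add, Real.Angle.cos_neg, Real.Angle.sin_neg]
    ring
  · refine key (1 / 2) (hs (k + l)) (hs (k - l)) fun x => ?_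
    simp only [ContinuousMap.mul_apply, hf, hg, ContinuousMap.coe_mk, cosMode, sinMode, phase_add,
      phase_neg, sub_eq_add_neg, Real.Angle.sin_add, Real.Angle.cos_neg, Real.Angle.sin_neg]
    ring
  · refine key (-1 / 2) (hc (k - l)) (hc (k + l)) fun x => ?_
    simp only [ContinuousMap.mul_apply, hf, hg, ContinuousMap.coe_mk, cosMode, sinMode, phase_add,
      phase_neg, sub_eq_add_neg, Real.Angle.cos_add, Real.Angle.cos_neg, Real.Angle.sin_neg]
    ring

/-- Trigonometric polynomials are uniformly dense in the continuous functions. -/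
theorem span_trigModes_closure_eq_top :
    (Submodule.span ℝ (trigModes d)).topologicalClosure = ⊤ := by
  let A : Subalgebra ℝ C(Torus d, ℝ) := (Submodule.span ℝ (trigModes d)).toSubalgebra
    (Submodule.subset_span ⟨0, Or.inl (by
      funext x; simp [cosMode, phase_zero])⟩)
    (fun x y hx hy => span_trigModes_mul_le (Submodule.mul_mem_mul hx hy))
  have hA : A.SeparatesPoints := by
    intro x y hxy
    obtain ⟨i, hi⟩ := Function.ne_iff.1 hxy
    have hmem : ∀ f : C(Torus d, ℝ), f ∈ trigModes d → (f : Torus d → ℝ) ∈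
        (fun f : C(Torus d, ℝ) => (f : Torus d → ℝ)) '' (A : Set C(Torus d, ℝ)) :=
      fun f hf => ⟨f, Submodule.subset_span hf, rfl⟩
    by_cases hc : cosMode (Pi.single i 1) x = cosMode (Pi.single i 1) y
    · refine ⟨_, hmem ⟨sinMode (Pi.single i 1), (isSmooth_sinMode _).continuous⟩
        ⟨_, Or.inr rfl⟩, fun hs => hi ?_⟩
      simp only [cosMode, sinMode, phase_single, ContinuousMap.coe_mk] at hc hs
      change coordAngle i x = coordAngle i y
      induction hx : coordAngle i x using Real.Angle.induction_on with | _ a => ?_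
      induction hy : coordAngle i y using Real.Angle.induction_on with | _ b => ?_
      rw [hx, hy] at hc hs
      exact Real.Angle.cos_sin_inj hc hs
    · exact ⟨_, hmem ⟨cosMode (Pi.single i 1), (isSmooth_cosMode _).continuous⟩
        ⟨_, Or.inl rfl⟩, hc⟩
  have h := ContinuousMap.subalgebra_topologicalClosure_eq_top_of_separatesPoints A hA
  refine SetLike.ext' ?_
  have h' := congrArg (fun B : Subalgebra ℝ C(Torus d, ℝ) => (B : Set C(Torus d, ℝ))) h
  exact h'

/-- An integrable function is determined by its Fourier coefficients. -/
theorem ae_eq_zero_of_integral_trigModes {h : Torus d → ℝ} (hh : Integrable h)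
    (hc : ∀ k, ∫ x, h x * cosMode k x = 0) (hs : ∀ k, ∫ x, h x * sinMode k x = 0) :
    h =ᵐ[volume] 0 := by
  have hint : ∀ f : C(Torus d, ℝ), Integrable (fun x => h x * f x) := fun f =>
    hh.mul_bdd (c := ‖f‖) f.continuous.aestronglyMeasurable
      (ae_of_all _ fun x => f.norm_coe_le_norm x)
  let I : C(Torus d, ℝ) →L[ℝ] ℝ := LinearMap.mkContinuous
    { toFun := fun f => ∫ x, h x * f x
      map_add' := fun f g => by
        simp only [ContinuousMap.add_apply, mul_add]
        exact integral_add (hint f) (hint g)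
      map_smul' := fun c f => by
        simp only [ContinuousMap.smul_apply, smul_eq_mul, RingHom.id_apply]
        rw [← integral_const_mul]
        congr 1; funext x; ring } (∫ x, ‖h x‖)
    (fun f => by
      rw [← integral_mul_const]
      refine norm_integral_le_of_norm_le (hh.norm.mul_const _) (ae_of_all _ fun x => ?_)
      rw [norm_mul]
      exact mul_le_mul_of_nonneg_left (f.norm_coe_le_norm x) (norm_nonneg _))
  have hI : ∀ f : C(Torus d, ℝ), I f = 0 := by
    intro f
    have h1 : (Submodule.span ℝ (trigModes d)).topologicalClosure ≤ I.ker := by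
      refine Submodule.topologicalClosure_minimal _ (Submodule.span_le.2 ?_) I.isClosed_ker
      rintro f ⟨k, hf | hf⟩
      · change ∫ x, h x * f x = 0
        rw [hf]; exact hc k
      · change ∫ x, h x * f x = 0
        rw [hf]; exact hs k
    rw [span_trigModes_closure_eq_top] at h1
    exact h1 trivial
  -- compare the finite measures with densities the positive and the negative part of `h`
  let μ : Measure (Torus d) := volume.withDensity fun x => ENNReal.ofReal (h x)
  let ν : Measure (Torus d) := volume.withDensity fun x => ENNReal.ofReal (-h x)
  have hm1 : AEMeasurable (fun x => ENNReal.ofReal (h x)) := hh.aemeasurable.ennreal_ofReal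
  have hm2 : AEMeasurable (fun x => ENNReal.ofReal (-h x)) := hh.neg.aemeasurable.ennreal_ofReal
  have hμ : IsFiniteMeasure μ := isFiniteMeasure_withDensity_ofReal hh.2
  have hν : IsFiniteMeasure ν := isFiniteMeasure_withDensity_ofReal hh.neg.2
  have hμν : μ = ν := by
    refine ext_of_forall_integral_eq_of_IsFiniteMeasure fun f => ?_
    rw [integral_withDensity_eq_integral_toReal_smul₀ hm1
        (ae_of_all _ fun x => ENNReal.ofReal_lt_top),
      integral_withDensity_eq_integral_toReal_smul₀ hm2
        (ae_of_all _ fun x => ENNReal.ofReal_lt_top)]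
    simp only [ENNReal.toReal_ofReal', smul_eq_mul]
    have h1 : ∫ x, h x * f x = 0 := hI ⟨f, f.continuous⟩
    have hb : ∀ {g : Torus d → ℝ}, Integrable g → Integrable fun x => g x * f x := fun {g} hg =>
      hg.mul_bdd (c := ‖f‖) f.continuous.aestronglyMeasurable
        (ae_of_all _ fun x => f.norm_coe_le_norm x)
    rw [← sub_eq_zero, ← integral_sub (hb hh.pos_part) (hb hh.neg_part)]
    refine Eq.trans ?_ h1
    refine integral_congr_ae (ae_of_all _ fun x => ?_)
    beta_reduce
    rw [← sub_mul]
    congr 1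
    rcases le_total (h x) 0 with h0 | h0
    · rw [max_eq_right h0, max_eq_left (by linarith)]; ring
    · rw [max_eq_left h0, max_eq_right (by linarith)]; ring
  have h2 := (withDensity_eq_iff hm1 hm2 (by
    rw [← lt_top_iff_ne_top]
    simpa [μ, withDensity_apply _ MeasurableSet.univ] using measure_lt_top μ univ)).1 hμν
  filter_upwards [h2] with x hx
  rcases le_total (h x) 0 with h0 | h0
  · rw [ENNReal.ofReal_of_nonpos h0] at hx
    have := ENNReal.ofReal_eq_zero.1 hx.symm
    exact le_antisymm h0 (neg_nonpos.1 this)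
  · rw [ENNReal.ofReal_of_nonpos (p := -h x) (by linarith)] at hx
    exact le_antisymm (ENNReal.ofReal_eq_zero.1 hx) h0

end Trigonometric

/-! ### The Hilbert spaces `L²` and `H¹` -/

section HilbertSpaces

/-- Bounded operators between real Hilbert spaces. For the concrete spaces of the problem this fixes
the algebraic and topological instances to be those derived from the inner product. -/
abbrev HOp (E F : Type*) [NormedAddCommGroup E] [InnerProductSpace ℝ E] [NormedAddCommGroup F]
    [InnerProductSpace ℝ F] : Type _ := E →L[ℝ] F

/-- Subspaces of a real Hilbert space, with the instances derived from the inner product. -/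
abbrev HSub (E : Type*) [NormedAddCommGroup E] [InnerProductSpace ℝ E] : Type _ := Submodule ℝ E

theorem HSub.dense_of_orthogonal {E : Type*} [NormedAddCommGroup E] [InnerProductSpace ℝ E]
    [CompleteSpace E] (K : HSub E) (h : ∀ w, (∀ v ∈ K, ⟪v, w⟫_ℝ = 0) → w = 0) :
    Dense (K : Set E) :=
  Submodule.dense_iff_topologicalClosure_eq_top.2
    (Submodule.topologicalClosure_eq_top_iff.2 ((Submodule.eq_bot_iff _).2 h))

end HilbertSpaces

section FunctionSpaces

variable {d : ℕ}

theorem exists_bound_of_continuous {g : Torus d → ℝ} (hg : Continuous g) :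
    ∃ C : ℝ, 0 ≤ C ∧ ∀ x, ‖g x‖ ≤ C := by
  obtain ⟨C, hC⟩ := isCompact_univ.exists_bound_of_continuousOn hg.continuousOn
  exact ⟨C, (norm_nonneg _).trans (hC 0 (mem_univ _)), fun x => hC x (mem_univ x)⟩

theorem memLp_of_continuous {g : Torus d → ℝ} (hg : Continuous g) (p : ℝ≥0∞) :
    MemLp g p := by
  obtain ⟨C, -, hC⟩ := exists_bound_of_continuous hg
  exact MemLp.of_bound hg.aestronglyMeasurable C (ae_of_all _ hC)

/-- The class in `L²` of a continuous function. -/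
def ofContinuous {g : Torus d → ℝ} (hg : Continuous g) : L2 d := (memLp_of_continuous hg 2).toLp g

theorem coeFn_ofContinuous {g : Torus d → ℝ} (hg : Continuous g) :
    ofContinuous hg =ᵐ[volume] g := MemLp.coeFn_toLp _

theorem inner_ofContinuous {g : Torus d → ℝ} (hg : Continuous g) (f : L2 d) :
    ⟪ofContinuous hg, f⟫_ℝ = ∫ x, f x * g x := by
  rw [L2.inner_def]
  refine integral_congr_ae ?_
  filter_upwards [coeFn_ofContinuous hg] with x hx
  simp [hx]

theorem ofContinuous_congr {g h : Torus d → ℝ} (hg : Continuous g) (hh : Continuous h)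
    (e : ∀ x, g x = h x) : ofContinuous hg = ofContinuous hh := by
  obtain rfl : g = h := funext e
  rfl

theorem L2.eq_zero_of_trigModes {f : L2 d} (hc : ∀ k, ∫ x, f x * cosMode k x = 0)
    (hs : ∀ k, ∫ x, f x * sinMode k x = 0) : f = 0 := by
  have hf : Integrable f := (Lp.memLp f).integrable (by norm_num)
  exact (Lp.eq_zero_iff_ae_eq_zero).2 (ae_eq_zero_of_integral_trigModes hf hc hs)

/-- Membership in `H¹` is a family of linear conditions, each continuous for the `L²` norms. -/
theorem isWeakGradient_iff {p : WithLp 2 (L2 d × PiLp 2 (fun _ : Fin d => L2 d))} :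
    p ∈ H1 d ↔ ∀ (φ : Torus d → ℝ) (hφ : IsSmooth φ) (i : Fin d),
      ⟪ofContinuous (hφ.continuous_pderiv i), p.fst⟫_ℝ
        + ⟪ofContinuous hφ.continuous, p.snd i⟫_ℝ = 0 := by
  simp only [inner_ofContinuous, add_eq_zero_iff_eq_neg]
  exact Iff.rfl

theorem isClosed_H1 : IsClosed (H1 d : Set (WithLp 2 (L2 d × PiLp 2 (fun _ : Fin d => L2 d)))) := by
  have : (H1 d : Set (WithLp 2 (L2 d × PiLp 2 (fun _ : Fin d => L2 d))))
      = ⋂ (φ : Torus d → ℝ) (hφ : IsSmooth φ) (i : Fin d),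
        {p | ⟪ofContinuous (hφ.continuous_pderiv i), p.fst⟫_ℝ
          + ⟪ofContinuous hφ.continuous, p.snd i⟫_ℝ = 0} := by
    ext p
    simp only [mem_iInter, mem_ofPred_eq]
    exact isWeakGradient_iff
  rw [this]
  refine isClosed_iInter fun φ => isClosed_iInter fun hφ => isClosed_iInter fun i => ?_
  refine isClosed_eq ?_ continuous_const
  have h1 : Continuous fun p : WithLp 2 (L2 d × PiLp 2 (fun _ : Fin d => L2 d)) => p.fst :=
    (WithLp.fstL 2 ℝ (L2 d) (PiLp 2 (fun _ : Fin d => L2 d))).continuous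
  have h2 : Continuous fun p : WithLp 2 (L2 d × PiLp 2 (fun _ : Fin d => L2 d)) => p.snd i :=
    ((PiLp.proj 2 (𝕜 := ℝ) (fun _ : Fin d => L2 d) i).comp
      (WithLp.sndL 2 ℝ (L2 d) (PiLp 2 (fun _ : Fin d => L2 d)))).continuous
  exact (continuous_const.inner h1).add (continuous_const.inner h2)

instance : CompleteSpace (H1 d) := isClosed_H1.completeSpace_coe

/-- The `i`-th weak partial derivative. -/
def H1.grad (w : H1 d) (i : Fin d) : L2 d := w.1.snd i

theorem H1.inner_weakGradient (w : H1 d) {φ : Torus d → ℝ} (hφ : IsSmooth φ) (i : Fin d) :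
    ⟪ofContinuous (hφ.continuous_pderiv i), H1.toL2 w⟫_ℝ
      = -⟪ofContinuous hφ.continuous, H1.grad w i⟫_ℝ :=
  eq_neg_of_add_eq_zero_left (isWeakGradient_iff.1 w.2 φ hφ i)

theorem H1.inner_eq (v w : H1 d) :
    ⟪v, w⟫_ℝ = ⟪H1.toL2 v, H1.toL2 w⟫_ℝ + ∑ i, ⟪H1.grad v i, H1.grad w i⟫_ℝ := by
  rw [Submodule.coe_inner, WithLp.prod_inner_apply, PiLp.inner_apply]
  rfl

theorem H1.norm_sq_eq (w : H1 d) :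
    ‖w‖ ^ 2 = ‖H1.toL2 w‖ ^ 2 + ∑ i, ‖H1.grad w i‖ ^ 2 := by
  simp only [← real_inner_self_eq_norm_sq, H1.inner_eq]

theorem H1.ext_iff' {v w : H1 d} :
    v = w ↔ H1.toL2 v = H1.toL2 w ∧ ∀ i, H1.grad v i = H1.grad w i := by
  refine ⟨fun h => by subst h; simp, fun ⟨h1, h2⟩ => ?_⟩
  refine Subtype.ext (WithLp.ofLp_injective 2 (Prod.ext h1 ?_))
  exact PiLp.ext h2

/-- The weak gradient is determined by the function, since test functions separate `L²`. -/
theorem H1.toL2_injective : Function.Injective (H1.toL2 (d := d)) := by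
  refine (injective_iff_map_eq_zero _).2 fun w hw => H1.ext_iff'.2 ⟨by simpa using hw, fun i => ?_⟩
  have key : ∀ φ : Torus d → ℝ, IsSmooth φ → ∫ x, H1.grad w i x * φ x = 0 := by
    intro φ hφ
    have := H1.inner_weakGradient w hφ i
    rw [hw, inner_zero_right, inner_ofContinuous] at this
    linarith
  exact L2.eq_zero_of_trigModes (fun k => key _ (isSmooth_cosMode k))
    (fun k => key _ (isSmooth_sinMode k))

/-- The integral over the torus of a partial derivative vanishes, by translation invariance. -/
theorem IsSmooth.integral_pderiv {φ : Torus d → ℝ} (hφ : IsSmooth φ) (i : Fin d) :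
    ∫ x, pderiv i φ x = 0 := by
  obtain ⟨C, -, hC⟩ := exists_bound_of_continuous (hφ.continuous_pderiv i)
  have hint : ∀ t : ℝ, Continuous fun x : Torus d => φ (x + Torus.mk (Pi.single i t)) := fun t =>
    hφ.continuous.comp (continuous_add_const _)
  have h := (hasDerivAt_integral_of_dominated_loc_of_deriv_le (μ := (volume : Measure (Torus d)))
    (F := fun (t : ℝ) x => φ (x + Torus.mk (Pi.single i t)))
    (F' := fun (t : ℝ) x => pderiv i φ (x + Torus.mk (Pi.single i t))) (x₀ := 0)
    (bound := fun _ => C) (s := univ) univ_mem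
    (Eventually.of_forall fun t => (hint t).aestronglyMeasurable)
    ((memLp_of_continuous (hint 0) 1).integrable le_rfl)
    (((hφ.continuous_pderiv i).comp (continuous_add_const _)).aestronglyMeasurable)
    (ae_of_all _ fun x t _ => hC _) (integrable_const _)
    (ae_of_all _ fun x t _ => hφ.hasDerivAt_translate i x t)).2
  have h0 : Torus.mk (Pi.single i (0 : ℝ)) = (0 : Torus d) := by
    funext j; simp [Torus.mk]
  simp only [h0, add_zero, integral_add_right_eq_self] at h
  exact h.unique (hasDerivAt_const _ _)

/-- A smooth function, as an element of `H¹`. -/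
def ofSmooth {φ : Torus d → ℝ} (hφ : IsSmooth φ) : H1 d :=
  ⟨WithLp.toLp 2 (ofContinuous hφ.continuous,
    WithLp.toLp 2 fun i => ofContinuous (hφ.continuous_pderiv i)), by
    rw [isWeakGradient_iff]
    intro ψ hψ i
    change ⟪_, ofContinuous hφ.continuous⟫_ℝ + ⟪_, ofContinuous (hφ.continuous_pderiv i)⟫_ℝ = 0
    rw [real_inner_comm, real_inner_comm (ofContinuous (hφ.continuous_pderiv i)),
      inner_ofContinuous, inner_ofContinuous]
    have h := (hφ.mul hψ).integral_pderiv i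
    simp only [hφ.pderiv_mul hψ] at h
    rw [integral_add] at h
    · rw [← h]
      congr 1
      · refine integral_congr_ae ?_
        filter_upwards [coeFn_ofContinuous (hψ.continuous_pderiv i)] with x hx
        rw [hx, mul_comm]
      · refine integral_congr_ae ?_
        filter_upwards [coeFn_ofContinuous hψ.continuous] with x hx
        rw [hx]
    · exact (memLp_of_continuous (hφ.continuous.mul (hψ.continuous_pderiv i)) 1).integrable le_rfl
    · exact (memLp_of_continuous (hψ.continuous.mul (hφ.continuous_pderiv i)) 1).integrable le_rfl⟩

theorem toL2_ofSmooth {φ : Torus d → ℝ} (hφ : IsSmooth φ) :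
    H1.toL2 (ofSmooth hφ) = ofContinuous hφ.continuous := rfl

theorem grad_ofSmooth {φ : Torus d → ℝ} (hφ : IsSmooth φ) (i : Fin d) :
    H1.grad (ofSmooth hφ) i = ofContinuous (hφ.continuous_pderiv i) := rfl

theorem ofContinuous_add {g h : Torus d → ℝ} (hg : Continuous g) (hh : Continuous h) :
    ofContinuous (hg.add hh) = ofContinuous hg + ofContinuous hh := rfl

theorem ofContinuous_const_mul {g : Torus d → ℝ} (hg : Continuous g) (c : ℝ) :
    ofContinuous (hg.const_mul c) = c • ofContinuous hg := rfl

/-- The inclusion `H¹ → L²`, with the instances derived from the inner products. -/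
def H1.incl (d : ℕ) : HOp (H1 d) (L2 d) := H1.toL2

/-- The smooth functions, as a subspace of `H¹`. -/
def smoothH1 (d : ℕ) : HSub (H1 d) where
  carrier := {w | ∃ (φ : Torus d → ℝ) (hφ : IsSmooth φ), w = ofSmooth hφ}
  zero_mem' := ⟨fun _ => 0, IsSmooth.const 0, by
    refine H1.ext_iff'.2 ⟨rfl, fun i => ?_⟩
    rw [grad_ofSmooth, ofContinuous_congr _ (h := fun _ => 0) continuous_const (pderiv_const 0 i)]
    rfl⟩
  add_mem' := by
    rintro _ _ ⟨φ, hφ, rfl⟩ ⟨ψ, hψ, rfl⟩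
    refine ⟨_, hφ.add hψ, H1.ext_iff'.2 ⟨rfl, fun i => ?_⟩⟩
    rw [grad_ofSmooth, ofContinuous_congr _ ((hφ.continuous_pderiv i).add (hψ.continuous_pderiv i))
      (hφ.pderiv_add hψ i)]
    rfl
  smul_mem' := by
    rintro c _ ⟨φ, hφ, rfl⟩
    refine ⟨_, hφ.const_mul c, H1.ext_iff'.2 ⟨rfl, fun i => ?_⟩⟩
    rw [grad_ofSmooth, ofContinuous_congr _ ((hφ.continuous_pderiv i).const_mul c)
      (hφ.pderiv_const_mul c i)]
    rfl

/-- A smooth function with `∂_i² φ = -κ_i² φ` is an eigenfunction of the Laplacian. -/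
theorem H1.inner_ofSmooth_eq (w : H1 d) {φ : Torus d → ℝ} (hφ : IsSmooth φ)
    (hφ' : ∀ i, IsSmooth (pderiv i φ)) {κ : Fin d → ℝ}
    (hκ : ∀ i x, pderiv i (pderiv i φ) x = -(κ i) ^ 2 * φ x) :
    ⟪ofSmooth hφ, w⟫_ℝ = (1 + ∑ i, κ i ^ 2) * ∫ x, H1.toL2 w x * φ x := by
  rw [H1.inner_eq, toL2_ofSmooth, ← inner_ofContinuous hφ.continuous, add_mul, one_mul,
    Finset.sum_mul]
  congr 1
  refine Finset.sum_congr rfl fun i _ => ?_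
  rw [grad_ofSmooth]
  have h := H1.inner_weakGradient w (hφ' i) i
  rw [ofContinuous_congr _ (hφ.continuous.const_mul (-(κ i) ^ 2)) (hκ i),
    ofContinuous_const_mul hφ.continuous, real_inner_smul_left, neg_mul] at h
  exact (neg_injective h).symm

/-- Smooth functions are dense in `H¹`: what is orthogonal to all trigonometric functions has no
Fourier coefficients. -/
theorem dense_smoothH1 : Dense (smoothH1 d : Set (H1 d)) := by
  refine HSub.dense_of_orthogonal _ fun w hw => ?_
  refine H1.toL2_injective ?_
  rw [map_zero]
  have key : ∀ (k : Fin d → ℤ) {φ : Torus d → ℝ} (hφ : IsSmooth φ)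
    (_ : ∀ i, IsSmooth (pderiv i φ))
    (_ : ∀ i x, pderiv i (pderiv i φ) x = -(k i : ℝ) ^ 2 * φ x),
      ∫ x, H1.toL2 w x * φ x = 0 := by
    intro k φ hφ hφ' hκ
    have h1 : ⟪ofSmooth hφ, w⟫_ℝ = 0 := hw _ ⟨φ, hφ, rfl⟩
    rw [H1.inner_ofSmooth_eq w hφ hφ' hκ] at h1
    have h2 : (0 : ℝ) < 1 + ∑ i, (k i : ℝ) ^ 2 := by positivity
    exact (mul_eq_zero.1 h1).resolve_left h2.ne'
  have ec : ∀ (k : Fin d → ℤ) i, pderiv i (cosMode k) = fun x => -(k i : ℝ) * sinMode k x :=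
    fun k i => funext (pderiv_cosMode k i)
  have es : ∀ (k : Fin d → ℤ) i, pderiv i (sinMode k) = fun x => (k i : ℝ) * cosMode k x :=
    fun k i => funext (pderiv_sinMode k i)
  refine L2.eq_zero_of_trigModes (fun k => key k (isSmooth_cosMode k) (fun i => ?_) fun i x => ?_)
    (fun k => key k (isSmooth_sinMode k) (fun i => ?_) fun i x => ?_)
  · rw [ec]; exact (isSmooth_sinMode k).const_mul _
  · rw [ec, (isSmooth_sinMode k).pderiv_const_mul, pderiv_sinMode]; ring
  · rw [es]; exact (isSmooth_cosMode k).const_mul _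
  · rw [es, (isSmooth_cosMode k).pderiv_const_mul, pderiv_cosMode]; ring

/-- The range of the inclusion `H¹ → L²` is dense. -/
theorem L2.eq_zero_of_inner_toL2 {p : L2 d} (hp : ∀ w : H1 d, ⟪H1.toL2 w, p⟫_ℝ = 0) : p = 0 := by
  have key : ∀ φ : Torus d → ℝ, IsSmooth φ → ∫ x, p x * φ x = 0 := by
    intro φ hφ
    rw [← inner_ofContinuous hφ.continuous, ← toL2_ofSmooth hφ, hp]
  exact L2.eq_zero_of_trigModes (fun k => key _ (isSmooth_cosMode k))
    (fun k => key _ (isSmooth_sinMode k))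

end FunctionSpaces

/-! ### Multiplication operators -/

section Multiplication

variable {d : ℕ}

/-- The multiplication operator on `L²` by a continuous function. -/
def mulL2 {g : Torus d → ℝ} (hg : Continuous g) : HOp (L2 d) (L2 d) :=
  have hm : ∀ f : L2 d, MemLp (fun x => g x * f x) 2 := fun f =>
    (Lp.memLp f).mul' (memLp_of_continuous hg ∞)
  LinearMap.mkContinuousOfExistsBound
    { toFun := fun f => (hm f).toLp
      map_add' := fun f₁ f₂ => by
        rw [← MemLp.toLp_add]
        refine MemLp.toLp_congr _ _ ?_
        filter_upwards [Lp.coeFn_add f₁ f₂] with x hx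
        simp only [hx, Pi.add_apply]
        ring
      map_smul' := fun c f => by
        rw [RingHom.id_apply, ← MemLp.toLp_const_smul]
        refine MemLp.toLp_congr _ _ ?_
        filter_upwards [Lp.coeFn_smul c f] with x hx
        simp only [hx, Pi.smul_apply, smul_eq_mul]
        ring }
    (by
      obtain ⟨C, -, hC⟩ := exists_bound_of_continuous hg
      refine ⟨C, fun f => Lp.norm_le_mul_norm_of_ae_le_mul ?_⟩
      filter_upwards [(hm f).coeFn_toLp] with x hx
      change ‖(hm f).toLp (fun x => g x * f x) x‖ ≤ _
      rw [hx, norm_mul]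
      exact mul_le_mul_of_nonneg_right (hC x) (norm_nonneg _))

theorem coeFn_mulL2 {g : Torus d → ℝ} (hg : Continuous g) (f : L2 d) :
    mulL2 hg f =ᵐ[volume] fun x => g x * f x :=
  MemLp.coeFn_toLp ((Lp.memLp f).mul' (memLp_of_continuous hg ∞))

theorem inner_ofContinuous_mulL2 {g h : Torus d → ℝ} (hg : Continuous g) (hh : Continuous h)
    (f : L2 d) : ⟪ofContinuous hh, mulL2 hg f⟫_ℝ = ⟪ofContinuous (hg.mul hh), f⟫_ℝ := by
  rw [inner_ofContinuous, inner_ofContinuous]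
  refine integral_congr_ae ?_
  filter_upwards [coeFn_mulL2 hg f] with x hx
  simp only [hx, Pi.mul_apply]; ring

/-- The multiplication operator on `H¹` by a smooth function, `∂_i(φw) = φ ∂_i w + w ∂_i φ`. -/
def mulH1 {φ : Torus d → ℝ} (hφ : IsSmooth φ) : HOp (H1 d) (H1 d) :=
  ContinuousLinearMap.codRestrict
    ((WithLp.prodContinuousLinearEquiv 2 ℝ (L2 d)
        (PiLp 2 (fun _ : Fin d => L2 d))).symm.toContinuousLinearMap.comp
      (ContinuousLinearMap.prod ((mulL2 hφ.continuous).comp H1.toL2)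
        ((PiLp.continuousLinearEquiv 2 ℝ (fun _ : Fin d => L2 d)).symm.toContinuousLinearMap.comp
          (ContinuousLinearMap.pi fun i =>
            (mulL2 hφ.continuous).comp ((PiLp.proj 2 (𝕜 := ℝ) (fun _ : Fin d => L2 d) i).comp
              ((WithLp.sndL 2 ℝ (L2 d) (PiLp 2 (fun _ : Fin d => L2 d))).comp (H1 d).subtypeL))
            + (mulL2 (hφ.continuous_pderiv i)).comp H1.toL2))))
    (H1 d) (fun w => by
      rw [isWeakGradient_iff]
      intro ψ hψ i
      change ⟪_, mulL2 hφ.continuous (H1.toL2 w)⟫_ℝ + ⟪_, mulL2 hφ.continuous (H1.grad w i)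
        + mulL2 (hφ.continuous_pderiv i) (H1.toL2 w)⟫_ℝ = 0
      rw [inner_add_right, inner_ofContinuous_mulL2, inner_ofContinuous_mulL2,
        inner_ofContinuous_mulL2]
      have h := H1.inner_weakGradient w (hφ.mul hψ) i
      have e : ofContinuous ((hφ.mul hψ).continuous_pderiv i)
          = ofContinuous (hφ.continuous.mul (hψ.continuous_pderiv i))
            + ofContinuous ((hφ.continuous_pderiv i).mul hψ.continuous) := by
        rw [← ofContinuous_add]
        exact ofContinuous_congr _ _ fun x => by
          rw [hφ.pderiv_mul hψ, Pi.add_apply, Pi.mul_apply, Pi.mul_apply]; ring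
      rw [e, inner_add_left] at h
      linarith)

theorem toL2_mulH1 {φ : Torus d → ℝ} (hφ : IsSmooth φ) (w : H1 d) :
    H1.toL2 (mulH1 hφ w) = mulL2 hφ.continuous (H1.toL2 w) := rfl

end Multiplication

/-! ### Sobolev inequalities on the torus -/

section Sobolev

variable {d : ℕ}

theorem H1.norm_toL2_le (w : H1 d) : ‖H1.toL2 w‖ ≤ ‖w‖ := by
  have h := H1.norm_sq_eq w
  refine (sq_le_sq₀ (norm_nonneg _) (norm_nonneg _)).1 ?_
  rw [h]
  exact le_add_of_nonneg_right (by positivity)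

theorem H1.norm_grad_le (w : H1 d) (i : Fin d) : ‖H1.grad w i‖ ≤ ‖w‖ := by
  have h := H1.norm_sq_eq w
  refine (sq_le_sq₀ (norm_nonneg _) (norm_nonneg _)).1 ?_
  rw [h]
  have := Finset.single_le_sum (f := fun i => ‖H1.grad w i‖ ^ 2) (fun i _ => by positivity)
    (Finset.mem_univ i)
  linarith [sq_nonneg ‖H1.toL2 w‖]

theorem enorm_ofContinuous {g : Torus d → ℝ} (hg : Continuous g) :
    ‖ofContinuous hg‖ₑ = eLpNorm g 2 := Lp.enorm_toLp _

/-- The projection maps each periodicity cell onto the torus, preserving the measure. -/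
theorem Torus.measurePreserving_mk (a : Fin d → ℝ) :
    MeasurePreserving (Torus.mk (d := d))
      (volume.restrict (univ.pi fun i => Ioc (a i) (a i + 2 * π))) volume := by
  have h := measurePreserving_pi (fun i => (volume : Measure ℝ).restrict (Ioc (a i) (a i + 2 * π)))
    (fun _ => (volume : Measure (AddCircle (2 * π)))) (fun i =>
      AddCircle.measurePreserving_mk (2 * π) (a i))
  rw [← Measure.restrict_pi_pi] at h
  exact h

/-- A ball of radius `3π` is covered by finitely many periodicity cells. -/
theorem Torus.exists_map_restrict_ball_le (d : ℕ) :
    ∃ K : ℝ≥0, Measure.map (Torus.mk (d := d))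
      (volume.restrict (Metric.ball (fun _ => π) (3 * π))) ≤ (K : ℝ≥0∞) • volume := by
  let a : (Fin d → Fin 3) → Fin d → ℝ := fun n i => -2 * π + (n i : ℝ) * (2 * π)
  let s : (Fin d → Fin 3) → Set (Fin d → ℝ) := fun n =>
    univ.pi fun i => Ioc (a n i) (a n i + 2 * π)
  have hpi := Real.pi_pos
  have hcover : Metric.ball (fun _ : Fin d => π) (3 * π) ⊆ ⋃ n, s n := by
    intro x hx
    have hx' : ∀ i, |x i - π| < 3 * π := fun i =>
      (dist_le_pi_dist x (fun _ => π) i).trans_lt hx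
    have h1 : ∀ i, ∃ m : Fin 3, x i ∈ Ioc (-2 * π + (m : ℝ) * (2 * π))
        (-2 * π + (m : ℝ) * (2 * π) + 2 * π) := by
      intro i
      obtain ⟨h2, h3⟩ := abs_lt.1 (hx' i)
      rcases le_or_gt (x i) 0 with h4 | h4
      · exact ⟨0, by simp; linarith, by simp; linarith⟩
      · rcases le_or_gt (x i) (2 * π) with h5 | h5
        · exact ⟨1, by simp; linarith, by simp; linarith⟩
        · exact ⟨2, by simp; linarith, by simp; linarith⟩
    choose m hm using h1
    exact mem_iUnion.2 ⟨m, fun i _ => hm i⟩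
  refine ⟨Fintype.card (Fin d → Fin 3), ?_⟩
  have hmeas : Measurable (Torus.mk (d := d)) :=
    (Torus.isOpenQuotientMap_mk d).continuous.measurable
  calc _ ≤ Measure.map Torus.mk (Measure.sum fun n => volume.restrict (s n)) :=
        Measure.map_mono ((Measure.restrict_mono hcover le_rfl).trans Measure.restrict_iUnion_le)
          hmeas
    _ = ∑ n, Measure.map Torus.mk (volume.restrict (s n)) := by
        rw [Measure.map_sum hmeas.aemeasurable, Measure.sum_fintype]
    _ = ∑ _n : Fin d → Fin 3, volume :=
        Finset.sum_congr rfl fun n _ => (Torus.measurePreserving_mk (a n)).map_eq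
    _ = _ := by
        rw [Finset.sum_const, Finset.card_univ]
        ext t _
        simp [nsmul_eq_mul]
    _ ≤ _ := le_rfl

theorem Torus.exists_eLpNorm_comp_mk_le (d : ℕ) :
    ∃ K : ℝ≥0, ∀ F : Torus d → ℝ, Continuous F →
      eLpNorm (F ∘ Torus.mk) 2 (volume.restrict (Metric.ball (fun _ => π) (3 * π)))
        ≤ K * eLpNorm F 2 := by
  obtain ⟨K, hK⟩ := Torus.exists_map_restrict_ball_le d
  refine ⟨K ^ (1 / 2 : ℝ), fun F hF => ?_⟩
  have hmeas : Measurable (Torus.mk (d := d)) :=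
    (Torus.isOpenQuotientMap_mk d).continuous.measurable
  rw [← eLpNorm_map_measure hF.aestronglyMeasurable hmeas.aemeasurable]
  refine (eLpNorm_mono_measure _ hK).trans (le_of_eq ?_)
  rw [eLpNorm_smul_measure_of_ne_top (by norm_num), ENNReal.coe_rpow_of_nonneg _ (by norm_num)]
  simp

theorem IsSmooth.norm_fderiv_mk_le {φ : Torus d → ℝ} (hφ : IsSmooth φ) (x : Fin d → ℝ) :
    ‖fderiv ℝ (fun y => φ (Torus.mk y)) x‖ ≤ ∑ i, ‖pderiv i φ (Torus.mk x)‖ := by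
  refine ContinuousLinearMap.opNorm_le_bound _ (by positivity) fun v => ?_
  rw [Finset.sum_mul]
  have e3 : fderiv ℝ (fun y => φ (Torus.mk y)) x v = ∑ i, v i * pderiv i φ (Torus.mk x) := by
    conv_lhs => rw [← Finset.univ_sum_single v, map_sum]
    refine Finset.sum_congr rfl fun i _ => ?_
    rw [hφ.pderiv_mk, ← smul_eq_mul, ← map_smul, ← Pi.single_smul, smul_eq_mul, mul_one]
  rw [e3]
  refine norm_sum_le_of_le _ fun i _ => ?_
  rw [norm_mul, mul_comm]
  exact mul_le_mul_of_nonneg_left (norm_le_pi_norm v i) (norm_nonneg _)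

theorem IsSmooth.eLpNorm_add_sum_pderiv_le {φ : Torus d → ℝ} (hφ : IsSmooth φ) {M : ℝ}
    (hM0 : 0 ≤ M) :
    eLpNorm (fun x => M * ‖φ x‖ + ∑ i, ‖pderiv i φ x‖) 2
      ≤ (M.toNNReal + d : ℝ≥0) * ‖ofSmooth hφ‖ₑ := by
  have e1 : eLpNorm φ 2 ≤ ‖ofSmooth hφ‖ₑ := by
    rw [← enorm_ofContinuous hφ.continuous]
    exact enorm_le_iff_norm_le.2 (H1.norm_toL2_le (ofSmooth hφ))
  have e2 : ∀ i, eLpNorm (pderiv i φ) 2 ≤ ‖ofSmooth hφ‖ₑ := fun i => by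
    rw [← enorm_ofContinuous (hφ.continuous_pderiv i)]
    exact enorm_le_iff_norm_le.2 (H1.norm_grad_le (ofSmooth hφ) i)
  have e3 : eLpNorm (fun x => M * ‖φ x‖) 2 ≤ M.toNNReal * ‖ofSmooth hφ‖ₑ := by
    have : eLpNorm (fun x => M * ‖φ x‖) 2 = ‖M‖ₑ * eLpNorm (fun x => ‖φ x‖) 2 :=
      eLpNorm_const_smul M (fun x => ‖φ x‖) 2 volume
    rw [this, eLpNorm_norm, Real.enorm_of_nonneg hM0]
    exact mul_le_mul_right e1 _
  have e4 : eLpNorm (fun x => ∑ i, ‖pderiv i φ x‖) 2 ≤ d * ‖ofSmooth hφ‖ₑ := by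
    have h := eLpNorm_sum_le (p := 2) (μ := (volume : Measure (Torus d)))
      (f := fun (i : Fin d) x => ‖pderiv i φ x‖) (s := Finset.univ)
      (fun i _ => (hφ.continuous_pderiv i).norm.aestronglyMeasurable) (by norm_num)
    have h' : (∑ i, fun x => ‖pderiv i φ x‖) = fun x => ∑ i, ‖pderiv i φ x‖ := by
      funext x; simp
    rw [h'] at h
    refine h.trans ?_
    simp only [eLpNorm_norm]
    calc _ ≤ ∑ _i : Fin d, ‖ofSmooth hφ‖ₑ := Finset.sum_le_sum fun i _ => e2 i
      _ = _ := by simp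
  have e5 := eLpNorm_add_le (p := 2) (μ := (volume : Measure (Torus d)))
    (f := fun x => M * ‖φ x‖) (g := fun x => ∑ i, ‖pderiv i φ x‖)
    (continuous_const.mul hφ.continuous.norm).aestronglyMeasurable
    (continuous_finsetSum _ fun i _ => (hφ.continuous_pderiv i).norm).aestronglyMeasurable
    (by norm_num)
  refine e5.trans ((add_le_add e3 e4).trans (le_of_eq ?_))
  push_cast
  ring

/-- A cutoff that is `1` on the periodicity cell `(0, 2π]^d`, which lies in the closed ball of
radius `π` (for the sup norm) around `(π, …, π)`. -/
theorem exists_cutoff (d : ℕ) : ∃ (χ : (Fin d → ℝ) → ℝ) (M : ℝ), ContDiff ℝ 1 χ ∧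
    (∀ x, ‖χ x‖ ≤ 1) ∧ (∀ x ∈ univ.pi fun _ => Ioc 0 (0 + 2 * π), χ x = 1) ∧
    tsupport χ ⊆ Metric.ball (fun _ => π) (3 * π) ∧ ∀ x, ‖fderiv ℝ χ x‖ ≤ M := by
  have hpi := Real.pi_pos
  let χ : ContDiffBump (fun _ : Fin d => π) := ⟨π, 2 * π, hpi, by linarith⟩
  have hχ : ContDiff ℝ 1 χ := χ.contDiff
  obtain ⟨M, hM⟩ := ((hχ.continuous_fderiv (by simp)).bounded_above_of_compact_support
    (χ.hasCompactSupport.fderiv (𝕜 := ℝ)))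
  refine ⟨χ, M, hχ, fun x => ?_, fun x hx => ?_, ?_, hM⟩
  · rw [Real.norm_eq_abs, abs_of_nonneg χ.nonneg]
    exact χ.le_one
  · refine χ.one_of_mem_closedBall ?_
    rw [Metric.mem_closedBall, dist_pi_le_iff hpi.le]
    intro i
    have := hx i (mem_univ i)
    simp only [zero_add, mem_Ioc] at this
    rw [Real.dist_eq, abs_le]
    change -π ≤ _ ∧ _ ≤ π
    constructor <;> linarith
  · refine χ.tsupport_eq.subset.trans (Metric.closedBall_subset_ball ?_)
    change 2 * π < 3 * π
    linarith

/-- A Sobolev inequality for compactly supported functions on `ℝ^d` gives one on the torus, by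
applying it to the periodic function multiplied by a cutoff that is `1` on a periodicity cell. -/
theorem exists_sobolev_of_ball {q : ℝ≥0∞} {C : ℝ≥0}
    (hC : ∀ g : (Fin d → ℝ) → ℝ, ContDiff ℝ 1 g →
      tsupport g ⊆ Metric.ball (fun _ => π) (3 * π) →
      eLpNorm g q ≤ C * eLpNorm (fderiv ℝ g) 2) :
    ∃ C' : ℝ≥0, ∀ (φ : Torus d → ℝ) (hφ : IsSmooth φ),
      eLpNorm φ q ≤ C' * ‖ofSmooth hφ‖ₑ := by
  obtain ⟨K, hK⟩ := Torus.exists_eLpNorm_comp_mk_le d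
  obtain ⟨χ, M, hχ, hχ1, hχcell, hχsupp, hM⟩ := exists_cutoff d
  have hM0 : 0 ≤ M := (norm_nonneg _).trans (hM 0)
  refine ⟨C * (K * (M.toNNReal + d)), fun φ hφ => ?_⟩
  have hu1 : ContDiff ℝ 1 (fun x => φ (Torus.mk x)) := ContDiff.of_le hφ (by exact_mod_cast le_top)
  obtain ⟨g, hg⟩ : ∃ g : (Fin d → ℝ) → ℝ, g = fun x => χ x * φ (Torus.mk x) := ⟨_, rfl⟩
  have hg1 : ContDiff ℝ 1 g := hg ▸ hχ.mul hu1
  have hts : tsupport g ⊆ Metric.ball (fun _ => π) (3 * π) := by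
    rw [hg]
    exact (closure_mono (Function.support_mul_subset_left _ _)).trans hχsupp
  have h1 := hC g hg1 hts
  have h2 : eLpNorm φ q ≤ eLpNorm g q := by
    have hmp := Torus.measurePreserving_mk (d := d) fun _ => 0
    rw [← eLpNorm_comp_measurePreserving hφ.continuous.aestronglyMeasurable hmp]
    refine le_trans (le_of_eq (eLpNorm_congr_ae ?_))
      (eLpNorm_mono_measure g Measure.restrict_le_self)
    refine ae_restrict_of_forall_mem (MeasurableSet.univ_pi fun i => measurableSet_Ioc)
      fun x hx => ?_
    simp only [hg, hχcell x hx, one_mul, Function.comp_apply]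
  have h3 : ∀ x, ‖fderiv ℝ g x‖ ≤ M * ‖φ (Torus.mk x)‖ + ∑ i, ‖pderiv i φ (Torus.mk x)‖ := by
    intro x
    have e := ((hχ.differentiable (by simp) x).hasFDerivAt.fun_mul
        (hφ.hasFDerivAt x)).fderiv
    rw [hg, e]
    refine (norm_add_le _ _).trans ?_
    rw [norm_smul, norm_smul, add_comm, mul_comm]
    refine add_le_add (mul_le_mul_of_nonneg_right (hM x) (norm_nonneg _)) ?_
    exact (mul_le_of_le_one_left (norm_nonneg _) (hχ1 x)).trans (hφ.norm_fderiv_mk_le x)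
  have h4 : eLpNorm (fderiv ℝ g) 2
      ≤ K * eLpNorm (fun x => M * ‖φ x‖ + ∑ i, ‖pderiv i φ x‖) 2 := by
    have hs : Function.support (fun x => ‖fderiv ℝ g x‖) ⊆ Metric.ball (fun _ => π) (3 * π) :=
      fun x hx => hts (tsupport_fderiv_subset ℝ (subset_tsupport _ (norm_ne_zero_iff.1 hx)))
    have hF : Continuous fun x => M * ‖φ x‖ + ∑ i, ‖pderiv i φ x‖ :=
      (continuous_const.mul hφ.continuous.norm).add
        (continuous_finsetSum _ fun i _ => (hφ.continuous_pderiv i).norm)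
    rw [← eLpNorm_norm, ← eLpNorm_restrict_eq_of_support_subset (μ := volume) (p := 2) hs]
    refine le_trans (eLpNorm_mono_real fun x => ?_) (hK _ hF)
    rw [norm_norm]
    exact h3 x
  have h5 := hφ.eLpNorm_add_sum_pderiv_le hM0
  generalize ‖ofSmooth hφ‖ₑ = N at h5 ⊢
  refine (h2.trans (h1.trans (mul_le_mul_right (h4.trans (mul_le_mul_right h5 _)) _))).trans ?_
  rw [← mul_assoc, ← mul_assoc, ← ENNReal.coe_mul, ← ENNReal.coe_mul, mul_assoc]

end Sobolev

/-! ### Multiplication by an admissible potential -/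

section Potential

variable {d : ℕ}

/-- The exponent of the gradient may be raised to `2`, the support being bounded. -/
theorem exists_eLpNorm_fderiv_le_two (d : ℕ) {p : ℝ≥0∞} (hp : p ≤ 2) :
    ∃ C : ℝ≥0, ∀ g : (Fin d → ℝ) → ℝ, ContDiff ℝ 1 g →
      tsupport g ⊆ Metric.ball (fun _ => π) (3 * π) →
      eLpNorm (fderiv ℝ g) p ≤ C * eLpNorm (fderiv ℝ g) 2 := by
  have hfin : (volume (Metric.ball (fun _ : Fin d => π) (3 * π)))
      ^ (1 / p.toReal - 1 / (2 : ℝ≥0∞).toReal) < ⊤ ∨ p = 0 := by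
    rcases eq_or_ne p 0 with h | h
    · exact Or.inr h
    · refine Or.inl (ENNReal.rpow_lt_top_of_nonneg ?_ measure_ball_lt_top.ne)
      rw [sub_nonneg]
      have h1 : p ≠ ⊤ := (hp.trans_lt (by simp)).ne
      exact one_div_le_one_div_of_le (ENNReal.toReal_pos h h1) (ENNReal.toReal_mono (by simp) hp)
  rcases hfin with hfin | hfin
  · obtain ⟨C, hC⟩ := ENNReal.lt_iff_exists_coe.1 hfin
    refine ⟨C, fun g hg hs => ?_⟩
    have hs : Function.support (fun x => ‖fderiv ℝ g x‖) ⊆ Metric.ball (fun _ => π) (3 * π) :=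
      fun x hx => hs (tsupport_fderiv_subset ℝ (subset_tsupport _ (norm_ne_zero_iff.1 hx)))
    rw [← eLpNorm_norm, ← eLpNorm_restrict_eq_of_support_subset (μ := volume) (p := p) hs,
      ← eLpNorm_norm (p := 2), ← eLpNorm_restrict_eq_of_support_subset (μ := volume) (p := 2) hs]
    refine (eLpNorm_le_eLpNorm_mul_rpow_measure_univ hp
      (hg.continuous_fderiv (by simp)).norm.aestronglyMeasurable).trans ?_
    rw [Measure.restrict_apply_univ, hC.1, mul_comm]
  · exact ⟨0, fun g _ _ => by simp [hfin]⟩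

/-- The Gagliardo–Nirenberg–Sobolev inequality, with the exponent `2` for the gradient. -/
theorem exists_sobolev_ball_of_lt {q p : ℝ≥0} (hp : 1 ≤ p) (hp2 : p ≤ 2) (hpd : p < d)
    (hpq : (p : ℝ)⁻¹ - (d : ℝ)⁻¹ ≤ (q : ℝ)⁻¹) :
    ∃ C : ℝ≥0, ∀ g : (Fin d → ℝ) → ℝ, ContDiff ℝ 1 g →
      tsupport g ⊆ Metric.ball (fun _ => π) (3 * π) →
      eLpNorm g q ≤ C * eLpNorm (fderiv ℝ g) 2 := by
  obtain ⟨C, hC⟩ := exists_eLpNorm_fderiv_le_two d (p := p) (by exact_mod_cast hp2)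
  refine ⟨eLpNormLESNormFDerivOfLeConst ℝ (volume : Measure (Fin d → ℝ))
    (Metric.ball (fun _ => π) (3 * π)) p q * C, fun g hg hs => ?_⟩
  have h := eLpNorm_le_eLpNorm_fderiv_of_le (volume : Measure (Fin d → ℝ)) hg
    ((subset_tsupport g).trans hs) hp (by simpa using hpd) (q := q) (by simpa using hpq)
    Metric.isBounded_ball
  refine h.trans ?_
  rw [ENNReal.coe_mul, mul_assoc]
  exact mul_le_mul_right (hC g hg hs) _

/-- In dimension one the sup norm is bounded by the `L¹` norm of the derivative. -/
theorem exists_sobolev_ball_one :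
    ∃ C : ℝ≥0, ∀ g : (Fin 1 → ℝ) → ℝ, ContDiff ℝ 1 g →
      tsupport g ⊆ Metric.ball (fun _ => π) (3 * π) →
      eLpNorm g ⊤ ≤ C * eLpNorm (fderiv ℝ g) 2 := by
  obtain ⟨C, hC⟩ := exists_eLpNorm_fderiv_le_two 1 (p := 1) (by norm_num)
  refine ⟨C, fun g hg hs => le_trans ?_ (hC g hg hs)⟩
  rw [eLpNorm_exponent_top, eLpNorm_one_eq_lintegral_enorm]
  refine eLpNormEssSup_le_of_ae_enorm_bound (ae_of_all _ fun x => ?_)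
  have hgs : HasCompactSupport g :=
    (isCompact_closedBall (fun _ : Fin 1 => π) (3 * π)).of_isClosed_subset (isClosed_tsupport g)
      (hs.trans Metric.ball_subset_closedBall)
  let e : ℝ ≃L[ℝ] (Fin 1 → ℝ) := (ContinuousLinearEquiv.funUnique (Fin 1) ℝ ℝ).symm
  have he : ∀ t, e t = fun _ => t := fun t => rfl
  have h1 : ContDiff ℝ 1 (g ∘ e) := hg.comp e.contDiff
  have h2 : HasCompactSupport (g ∘ e) := hgs.comp_homeomorph e.toHomeomorph
  have h3 := (h2.enorm_le_lintegral_Ici_deriv h1 (x 0)).trans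
    (setLIntegral_le_lintegral _ _)
  have hx : e (x 0) = x := by
    rw [he]; funext i; rw [Subsingleton.elim i 0]
  rw [Function.comp_apply, hx] at h3
  refine h3.trans ?_
  have h4 : ∫⁻ y : Fin 1 → ℝ, ‖fderiv ℝ g y‖ₑ = ∫⁻ t : ℝ, ‖fderiv ℝ g (e t)‖ₑ := by
    have hmp := (volume_preserving_funUnique (Fin 1) ℝ).symm
    exact (hmp.lintegral_comp_emb (MeasurableEquiv.measurableEmbedding _)
      fun y => ‖fderiv ℝ g y‖ₑ).symm
  rw [h4]
  refine lintegral_mono fun t => ?_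
  have h5 : HasDerivAt (g ∘ e) (fderiv ℝ g (e t) (e 1)) t :=
    ((hg.differentiable (by simp)) (e t)).hasFDerivAt.comp_hasDerivAt t
      (by simpa using e.hasFDerivAt.hasDerivAt (x := t))
  rw [h5.deriv]
  refine enorm_le_iff_norm_le.2 ((ContinuousLinearMap.le_opNorm _ _).trans ?_)
  have : ‖e 1‖ ≤ 1 := by rw [he, pi_norm_const]; simp
  exact mul_le_of_le_one_right (norm_nonneg _) this

/-- The Sobolev embedding of `H¹(𝕋^d)` in `L^q`, with the exponent `q` for which the multiplication
by an admissible potential maps `L^q` to `L²`. -/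
theorem AdmissiblePotential.exists_sobolev (hd : 1 ≤ d) {V : Torus d → ℝ}
    (hV : AdmissiblePotential V) :
    ∃ r q : ℝ≥0∞, r⁻¹ + q⁻¹ = 2⁻¹ ∧ MemLp V r ∧
      ∃ C : ℝ≥0, ∀ (φ : Torus d → ℝ) (hφ : IsSmooth φ), eLpNorm φ q ≤ C * ‖ofSmooth hφ‖ₑ := by
  obtain ⟨h1, h2, h3⟩ := hV
  rcases (by omega : d = 1 ∨ d = 2 ∨ 3 ≤ d) with rfl | rfl | hd3
  · obtain ⟨C, hC⟩ := exists_sobolev_ball_one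
    exact ⟨2, ⊤, by simp, h1 rfl, exists_sobolev_of_ball hC⟩
  · obtain ⟨p, hp, hVp⟩ := h2 rfl
    -- lower the exponent to a finite `r > 2`
    obtain ⟨r, hr2, hr4, hVr⟩ : ∃ r : ℝ≥0, 2 < r ∧ r ≤ 4 ∧ MemLp V r := by
      rcases le_total p 4 with h | h
      · lift p to ℝ≥0 using (h.trans_lt (by simp)).ne
        exact ⟨p, by exact_mod_cast hp, by exact_mod_cast h, hVp⟩
      · exact ⟨4, by norm_num, le_rfl, hVp.mono_exponent (by simpa using h)⟩
    have hr2' : (2 : ℝ) < r := by exact_mod_cast hr2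
    have hr0 : (0 : ℝ) < r := by linarith
    -- `q = 2r/(r-2)`, the Hölder exponent, and `p₀ = r/(r-1) < 2`, from which one embeds
    obtain ⟨q, hq⟩ : ∃ q : ℝ≥0, (q : ℝ) = 2 * r / (r - 2) :=
      ⟨⟨_, div_nonneg (by linarith) (by linarith)⟩, rfl⟩
    obtain ⟨p₀, hp₀⟩ : ∃ p₀ : ℝ≥0, (p₀ : ℝ) = r / (r - 1) :=
      ⟨⟨_, div_nonneg (by linarith) (by linarith)⟩, rfl⟩
    have hp₀1 : (1 : ℝ) ≤ p₀ := by
      rw [hp₀, le_div_iff₀ (by linarith)]; linarith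
    have hp₀2 : (p₀ : ℝ) < 2 := by
      rw [hp₀, div_lt_iff₀ (by linarith)]; linarith
    have hp₀2' : p₀ < 2 := by exact_mod_cast hp₀2
    obtain ⟨C, hC⟩ := exists_sobolev_ball_of_lt (d := 2) (q := q) (p := p₀)
      (by exact_mod_cast hp₀1) hp₀2'.le (by exact_mod_cast hp₀2') (by
        rw [hq, hp₀, inv_div, inv_div]
        refine le_of_eq ?_
        push_cast
        field_simp
        ring)
    refine ⟨r, q, ?_, hVr, exists_sobolev_of_ball hC⟩
    have hr0' : r ≠ 0 := by rintro rfl; simp at hr0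
    have hq0 : q ≠ 0 := by
      rintro rfl
      have : (0 : ℝ) < 2 * r / (r - 2) := div_pos (by linarith) (by linarith)
      rw [← hq] at this
      simp at this
    have h22 : (2 : ℝ≥0∞)⁻¹ = ((2⁻¹ : ℝ≥0) : ℝ≥0∞) := by simp
    rw [← ENNReal.coe_inv hr0', ← ENNReal.coe_inv hq0, h22, ← ENNReal.coe_add, ENNReal.coe_inj]
    apply NNReal.coe_injective
    push_cast
    rw [hq, inv_div]
    field_simp
    ring
  · have hd3' : (3 : ℝ) ≤ d := by exact_mod_cast hd3
    obtain ⟨q, hq⟩ : ∃ q : ℝ≥0, (q : ℝ) = 2 * d / (d - 2) :=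
      ⟨⟨_, div_nonneg (by linarith) (by linarith)⟩, rfl⟩
    obtain ⟨C, hC⟩ := exists_sobolev_ball_of_lt (d := d) (q := q) (p := 2) (by norm_num) le_rfl
      (by
        have : (2 : ℝ) < d := by linarith
        exact_mod_cast this) (by
        rw [hq, inv_div]
        refine le_of_eq ?_
        push_cast
        field_simp)
    refine ⟨d, q, ?_, h3 hd3, exists_sobolev_of_ball hC⟩
    have hq0 : q ≠ 0 := by
      rintro rfl
      have : (0 : ℝ) < 2 * d / (d - 2) := div_pos (by linarith) (by linarith)
      rw [← hq] at this
      simp at this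
    have hd0 : (d : ℝ≥0) ≠ 0 := by
      rw [Nat.cast_ne_zero]; omega
    have h22 : (2 : ℝ≥0∞)⁻¹ = ((2⁻¹ : ℝ≥0) : ℝ≥0∞) := by simp
    have hdd : (d : ℝ≥0∞) = ((d : ℝ≥0) : ℝ≥0∞) := by simp
    rw [hdd, ← ENNReal.coe_inv hd0, ← ENNReal.coe_inv hq0, h22, ← ENNReal.coe_add, ENNReal.coe_inj]
    apply NNReal.coe_injective
    push_cast
    rw [hq, inv_div]
    field_simp
    ring

theorem exists_seq_ofSmooth (w : H1 d) :
    ∃ (φ : ℕ → Torus d → ℝ) (hφ : ∀ n, IsSmooth (φ n)),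
      Tendsto (fun n => ofSmooth (hφ n)) atTop (𝓝 w) ∧
      ∀ᵐ x, Tendsto (fun n => φ n x) atTop (𝓝 (H1.toL2 w x)) := by
  obtain ⟨v, hv, hlim⟩ := mem_closure_iff_seq_limit.1 (dense_smoothH1 w)
  choose φ hφ hvφ using hv
  have h1 : Tendsto (fun n => H1.toL2 (v n)) atTop (𝓝 (H1.toL2 w)) :=
    (H1.toL2.continuous.tendsto w).comp hlim
  obtain ⟨ns, hns, hae⟩ := (tendstoInMeasure_of_tendsto_Lp h1).exists_seq_tendsto_ae
  refine ⟨fun n => φ (ns n), fun n => hφ (ns n), ?_, ?_⟩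
  · have := hlim.comp hns.tendsto_atTop
    refine this.congr fun n => ?_
    exact hvφ _
  · have h2 : ∀ᵐ x, ∀ n, H1.toL2 (v (ns n)) x = φ (ns n) x := by
      rw [ae_all_iff]
      intro n
      rw [hvφ (ns n), toL2_ofSmooth]
      exact coeFn_ofContinuous _
    filter_upwards [hae, h2] with x hx hx2
    simpa only [hx2] using hx

/-- Hölder's inequality and the Sobolev inequality bound `V w` for smooth `w`; Fatou's lemma extends
the bound to `H¹`. -/
theorem eLpNorm_mul_toL2_le {V : Torus d → ℝ} {r q : ℝ≥0∞} (hrq : r⁻¹ + q⁻¹ = 2⁻¹)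
    (hVr : MemLp V r) {C : ℝ≥0}
    (hC : ∀ (φ : Torus d → ℝ) (hφ : IsSmooth φ), eLpNorm φ q ≤ C * ‖ofSmooth hφ‖ₑ)
    (w : H1 d) : eLpNorm (fun x => V x * H1.toL2 w x) 2 ≤ eLpNorm V r * C * ‖w‖ₑ := by
  have hVm : AEStronglyMeasurable V := hVr.aestronglyMeasurable
  obtain ⟨φ, hφ, hlim, hae⟩ := exists_seq_ofSmooth w
  have h1 : ∀ n, eLpNorm (fun x => V x * φ n x) 2 ≤ eLpNorm V r * C * ‖ofSmooth (hφ n)‖ₑ := by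
    intro n
    have : ENNReal.HolderTriple r q 2 := ⟨hrq⟩
    refine (eLpNorm_smul_le_mul_eLpNorm (r := 2) (p := r) (q := q)
      (hφ n).continuous.aestronglyMeasurable hVm).trans ?_
    rw [mul_assoc]
    exact mul_le_mul_right (hC _ (hφ n)) _
  have h2 := Lp.eLpNorm_lim_le_liminf_eLpNorm (p := 2) (f := fun n x => V x * φ n x)
    (fun n => hVm.mul (hφ n).continuous.aestronglyMeasurable) (fun x => V x * H1.toL2 w x)
    (by filter_upwards [hae] with x hx using hx.const_mul _)
  refine h2.trans ?_
  have h3 : Tendsto (fun n => eLpNorm V r * C * ‖ofSmooth (hφ n)‖ₑ) atTop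
      (𝓝 (eLpNorm V r * C * ‖w‖ₑ)) :=
    ENNReal.Tendsto.const_mul ((continuous_enorm.tendsto w).comp hlim)
      (Or.inr (ENNReal.mul_ne_top hVr.eLpNorm_ne_top ENNReal.coe_ne_top))
  rw [← h3.liminf_eq]
  exact liminf_le_liminf (Eventually.of_forall h1)

/-- A multiplication that satisfies a bound from `E` to `L²` is a bounded operator. -/
theorem exists_clm_of_eLpNorm_mul_le {α E : Type*} [MeasurableSpace α] {μ : Measure α}
    [NormedAddCommGroup E] [InnerProductSpace ℝ E] (ι : HOp E (Lp ℝ 2 μ)) {V : α → ℝ}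
    (hVm : AEStronglyMeasurable V μ) (K : ℝ≥0)
    (hbound : ∀ w : E, eLpNorm (fun x => V x * ι w x) 2 μ ≤ K * ‖w‖ₑ) :
    ∃ T : HOp E (Lp ℝ 2 μ), ∀ w, T w =ᵐ[μ] fun x => V x * ι w x := by
  have hm : ∀ w : E, MemLp (fun x => V x * ι w x) 2 μ := fun w =>
    ⟨hVm.mul (Lp.aestronglyMeasurable _), (hbound w).trans_lt
      (ENNReal.mul_lt_top ENNReal.coe_lt_top enorm_lt_top)⟩
  have hnorm : ∀ w : E, ‖(hm w).toLp‖ ≤ K * ‖w‖ := fun w => by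
    have h := hbound w
    rw [← Lp.enorm_toLp (hm w)] at h
    have h2 := ENNReal.toReal_mono (ENNReal.mul_ne_top ENNReal.coe_ne_top enorm_ne_top) h
    simpa using h2
  refine ⟨LinearMap.mkContinuous
    { toFun := fun w => (hm w).toLp
      map_add' := fun v w => by
        rw [← MemLp.toLp_add]
        refine MemLp.toLp_congr _ _ ?_
        rw [map_add]
        filter_upwards [Lp.coeFn_add (ι v) (ι w)] with x hx
        simp only [hx, Pi.add_apply]
        ring
      map_smul' := fun c w => by
        rw [RingHom.id_apply, ← MemLp.toLp_const_smul]
        refine MemLp.toLp_congr _ _ ?_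
        rw [map_smul]
        filter_upwards [Lp.coeFn_smul c (ι w)] with x hx
        simp only [hx, Pi.smul_apply, smul_eq_mul]
        ring } K hnorm, fun w => (hm w).coeFn_toLp⟩

theorem exists_mul_of_bound {V : Torus d → ℝ} (hVm : AEStronglyMeasurable V) (K : ℝ≥0)
    (hbound : ∀ w : H1 d, eLpNorm (fun x => V x * H1.toL2 w x) 2 ≤ K * ‖w‖ₑ) :
    ∃ T : HOp (H1 d) (L2 d), ∀ w, T w =ᵐ[volume] fun x => V x * H1.toL2 w x := by
  obtain ⟨T, hT⟩ := exists_clm_of_eLpNorm_mul_le (E := H1 d) (H1.incl d) hVm K hbound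
  exact ⟨T, hT⟩

theorem AdmissiblePotential.exists_eLpNorm_mul_toL2_le (hd : 1 ≤ d) {V : Torus d → ℝ}
    (hV : AdmissiblePotential V) : AEStronglyMeasurable V ∧ ∃ K : ℝ≥0,
      ∀ w : H1 d, eLpNorm (fun x => V x * H1.toL2 w x) 2 ≤ K * ‖w‖ₑ := by
  obtain ⟨r, q, hrq, hVr, C, hC⟩ := hV.exists_sobolev hd
  have hK : eLpNorm V r * C ≠ ⊤ := ENNReal.mul_ne_top hVr.2.ne ENNReal.coe_ne_top
  refine ⟨hVr.aestronglyMeasurable, (eLpNorm V r * C).toNNReal, fun w => ?_⟩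
  rw [ENNReal.coe_toNNReal hK]
  exact eLpNorm_mul_toL2_le hrq hVr hC w

/-- The multiplication by an admissible potential is a bounded operator `H¹ → L²`. -/
theorem AdmissiblePotential.exists_mul (hd : 1 ≤ d) {V : Torus d → ℝ}
    (hV : AdmissiblePotential V) :
    ∃ T : HOp (H1 d) (L2 d), ∀ w, T w =ᵐ[volume] fun x => V x * H1.toL2 w x := by
  obtain ⟨hVm, K, hK⟩ := hV.exists_eLpNorm_mul_toL2_le hd
  exact exists_mul_of_bound hVm K hK

end Potential

/-! ### The wave equation as an evolution on `H × L` -/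

section Flow

theorem IsUnitaryGroup.norm_apply_sub_le {X : Type*} [NormedAddCommGroup X] [InnerProductSpace ℝ X]
    {G : X →L[ℝ] X} {U : ℝ → X →L[ℝ] X} (hU : IsUnitaryGroup G U) (t : ℝ) (x : X) :
    ‖U t (G x) - G x‖ ≤ ‖x‖ * |t| := by
  have h := Convex.norm_image_sub_le_of_norm_hasDerivWithin_le (f := fun s => U s (G x))
    (f' := fun s => U s x) (s := univ) (C := ‖x‖) (x := 0) (y := t)
    (fun s _ => (hU.hasDerivAt s x).hasDerivWithinAt) (fun s _ => (hU.norm_apply s x).le)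
    convex_univ (mem_univ _) (mem_univ _)
  simpa [hU.zero_apply] using h

/-- The solutions in the interaction picture depend continuously on the initial state. -/
theorem IsUnitaryGroup.exists_flow {X : Type*} [NormedAddCommGroup X] [InnerProductSpace ℝ X]
    [CompleteSpace X] {G : X →L[ℝ] X} {U : ℝ → X →L[ℝ] X} (hU : IsUnitaryGroup G U)
    {P : X →L[ℝ] X} (hP : ‖P‖ ≤ 1 / 2) (τ : ℝ) :
    ∃ Z : X → ℝ → X, (∀ x, Z x 0 = x ∧ IsInteractionSol U P τ (Z x)) ∧
      Continuous fun x => Z x 1 := by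
  choose Z hZ0 hZ using fun x => hU.exists_isInteractionSol hP τ x
  refine ⟨Z, fun x => ⟨hZ0 x, hZ x⟩, ?_⟩
  refine (LipschitzWith.of_dist_le_mul (K := (Real.exp ‖P‖).toNNReal) fun x y => ?_).continuous
  have h := hU.dist_le_of_isInteractionSol (hZ x) (hZ y) (ε := 0) (fun σ _ => by rw [dist_self])
  rw [hZ0, hZ0, add_zero, mul_comm] at h
  rwa [Real.coe_toNNReal _ (Real.exp_pos _).le]

end Flow

section Blocks

theorem norm_fst_le {H L : Type*} [NormedAddCommGroup H] [NormedAddCommGroup L]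
    (x : WithLp 2 (H × L)) : ‖x.fst‖ ≤ ‖x‖ := by
  rw [WithLp.prod_norm_eq_of_L2]
  exact Real.le_sqrt_of_sq_le (by nlinarith [sq_nonneg ‖x.snd‖])
variable {H L : Type*} [NormedAddCommGroup H] [InnerProductSpace ℝ H]
  [NormedAddCommGroup L] [InnerProductSpace ℝ L]

theorem norm_snd_le {H L : Type*} [NormedAddCommGroup H] [NormedAddCommGroup L]
    (x : WithLp 2 (H × L)) : ‖x.snd‖ ≤ ‖x‖ := by
  rw [WithLp.prod_norm_eq_of_L2]
  exact Real.le_sqrt_of_sq_le (by nlinarith [sq_nonneg ‖x.fst‖])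
variable {H L : Type*} [NormedAddCommGroup H] [InnerProductSpace ℝ H]
  [NormedAddCommGroup L] [InnerProductSpace ℝ L]

/-- The operator on `H × L` with the components `a` and `b`. -/
def pairOp (a : HOp (WithLp 2 (H × L)) H) (b : HOp (WithLp 2 (H × L)) L) :
    HOp (WithLp 2 (H × L)) (WithLp 2 (H × L)) :=
  ((WithLp.prodContinuousLinearEquiv 2 ℝ H L).symm : (H × L) →L[ℝ] WithLp 2 (H × L)).comp (a.prod b)

/-- The first component of an element of `H × L`. -/
def fstOp (H L : Type*) [NormedAddCommGroup H] [InnerProductSpace ℝ H]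
    [NormedAddCommGroup L] [InnerProductSpace ℝ L] : HOp (WithLp 2 (H × L)) H :=
  WithLp.fstL 2 ℝ H L

/-- The second component of an element of `H × L`. -/
def sndOp (H L : Type*) [NormedAddCommGroup H] [InnerProductSpace ℝ H]
    [NormedAddCommGroup L] [InnerProductSpace ℝ L] : HOp (WithLp 2 (H × L)) L :=
  WithLp.sndL 2 ℝ H L

/-- The operator `(w, p) ↦ (0, T w)`. -/
def potOp (T : HOp H L) : HOp (WithLp 2 (H × L)) (WithLp 2 (H × L)) :=
  pairOp 0 (T.comp (fstOp H L))

/-- The operator `(w, p) ↦ (a w, b p)`. -/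
def diagOp (a : HOp H H) (b : HOp L L) : HOp (WithLp 2 (H × L)) (WithLp 2 (H × L)) :=
  pairOp (a.comp (fstOp H L)) (b.comp (sndOp H L))

theorem potOp_apply (T : HOp H L) (x : WithLp 2 (H × L)) :
    potOp T x = WithLp.toLp 2 (0, T x.fst) := rfl

theorem diagOp_apply (a : HOp H H) (b : HOp L L) (x : WithLp 2 (H × L)) :
    diagOp a b x = WithLp.toLp 2 (a x.fst, b x.snd) := rfl

theorem potOp_add (S T : HOp H L) : potOp (S + T) = potOp S + potOp T := by
  ext1 x
  refine WithLp.ofLp_injective 2 (Prod.ext ?_ rfl)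
  exact (add_zero (0 : H)).symm

theorem potOp_potOp (S T : HOp H L) (x : WithLp 2 (H × L)) : potOp S (potOp T x) = 0 := by
  rw [potOp_apply, potOp_apply, WithLp.toLp_fst, map_zero]
  rfl

theorem add_potOp (T : HOp H L) (x : WithLp 2 (H × L)) :
    x + potOp T x = WithLp.toLp 2 (x.fst, x.snd + T x.fst) := by
  refine WithLp.ofLp_injective 2 (Prod.ext ?_ rfl)
  exact add_zero x.fst

theorem potOp_smul (r : ℝ) (T : HOp H L) : potOp (r • T) = r • potOp T := by
  ext1 x
  refine WithLp.ofLp_injective 2 (Prod.ext ?_ rfl)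
  exact (smul_zero r).symm

theorem diagOp_smul (r : ℝ) (a : HOp H H) (b : HOp L L) :
    diagOp (r • a) (r • b) = r • diagOp a b := rfl

theorem norm_potOp_apply (T : HOp H L) (x : WithLp 2 (H × L)) :
    ‖potOp T x‖ = ‖T x.fst‖ := by
  rw [potOp_apply, WithLp.prod_norm_eq_of_L2]
  simp

variable [CompleteSpace H] [CompleteSpace L]

/-- The operator `(w, p) ↦ (-J* p, J w)`. For the inclusion `J : H¹ → L²`, where `J* = (1 - Δ)⁻¹`,
it is the inverse of `A = (0, 1; Δ - 1, 0)`. -/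
def waveInv (J : HOp H L) : HOp (WithLp 2 (H × L)) (WithLp 2 (H × L)) :=
  pairOp (-((ContinuousLinearMap.adjoint J).comp (sndOp H L))) (J.comp (fstOp H L))

theorem waveInv_apply (J : HOp H L) (x : WithLp 2 (H × L)) :
    waveInv J x = WithLp.toLp 2 (-(ContinuousLinearMap.adjoint J x.snd), J x.fst) := rfl

theorem isSkew_waveInv (J : HOp H L) : IsSkew (waveInv J) := by
  intro x y
  rw [waveInv_apply, waveInv_apply, WithLp.prod_inner_apply, WithLp.prod_inner_apply]
  simp only [inner_neg_left, inner_neg_right, ContinuousLinearMap.adjoint_inner_left,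
    ContinuousLinearMap.adjoint_inner_right]
  simp only [WithLp.ofLp_fst, WithLp.ofLp_snd]
  ring

/-- Being skew, `waveInv J` has a dense range as soon as it is injective. -/
theorem denseRange_waveInv {J : HOp H L} (hJ : Function.Injective J)
    (hJ' : ∀ p, (∀ w, ⟪J w, p⟫_ℝ = 0) → p = 0) : DenseRange (waveInv J) := by
  have h := HSub.dense_of_orthogonal (LinearMap.range (waveInv J).toLinearMap) (fun w hw => by
    have h0 : waveInv J w = 0 := by
      have := hw _ ⟨waveInv J w, rfl⟩
      have h1 := isSkew_waveInv J (waveInv J w) w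
      rw [ContinuousLinearMap.coe_coe] at this
      rw [this] at h1
      exact inner_self_eq_zero.1 (neg_eq_zero.1 h1.symm)
    rw [waveInv_apply] at h0
    have h1 : ContinuousLinearMap.adjoint J w.snd = 0 := by
      have := congrArg WithLp.fst h0
      simpa using this
    have h2 : J w.fst = 0 := by
      have := congrArg WithLp.snd h0
      simpa using this
    have h3 : w.snd = 0 := hJ' _ fun v => by
      rw [← ContinuousLinearMap.adjoint_inner_right, h1, inner_zero_right]
    have h4 : w.fst = 0 := hJ (by rw [h2, map_zero])
    exact WithLp.ofLp_injective 2 (Prod.ext h4 h3))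
  exact h

/-- Conjugation by a kick: if `(w, p)` follows the generator `(φ, 1; Δ - 1 + T - φ², -φ)`, then
`(w, q)` with `q = p + φ w` follows the generator `(0, 1; Δ - 1 + T, 0)`. Here the operator `a` is
the multiplication by `φ` on `H`, and `b` that on `L`. -/
theorem IsUnitaryGroup.hasDerivAt_kick {J : HOp H L}
    {U : ℝ → HOp (WithLp 2 (H × L)) (WithLp 2 (H × L))}
    (hU : IsUnitaryGroup (waveInv J) U) {a : HOp H H} {b : HOp L L}
    (hab : ∀ w, J (a w) = b (J w)) {T T' : HOp H L} (hT : ∀ w, T' w = T w + b (b (J w)))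
    {τ : ℝ} {z : ℝ → WithLp 2 (H × L)}
    (hz : IsInteractionSol U (τ • (potOp T + diagOp a (-b))) τ z) {σ : ℝ}
    (hσ : σ ∈ Ioo (0 : ℝ) 1) {y : ℝ → WithLp 2 (H × L)} (hy : ∀ s, y s = U (τ * s) (z s)) :
    HasDerivAt (fun s => J (y s).fst) (τ • ((y σ).snd + b (J (y σ).fst))) σ ∧
    HasDerivAt (fun s => ContinuousLinearMap.adjoint J ((y s).snd + b (J (y s).fst)))
      (τ • (-(y σ).fst + ContinuousLinearMap.adjoint J (T' (y σ).fst))) σ := by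
  have h := hU.hasDerivAt_isInteractionSol hz hσ
  simp only [← hy] at h
  have h1 : HasDerivAt (fun s => J (y s).fst) (τ • ((y σ).snd + b (J (y σ).fst))) σ := by
    have h1 := (sndOp H L).hasFDerivAt.comp_hasDerivAt σ h
    refine h1.congr_deriv ?_
    have : sndOp H L (τ • y σ + waveInv J ((τ • (potOp T + diagOp a (-b))) (y σ)))
      = τ • (y σ).snd + J (τ • (0 + a (y σ).fst)) := rfl
    rw [this, map_smul, zero_add, hab, ← smul_add]
  refine ⟨h1, ?_⟩
  have h2 := (fstOp H L).hasFDerivAt.comp_hasDerivAt σ h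
  have e1 : fstOp H L (τ • y σ + waveInv J ((τ • (potOp T + diagOp a (-b))) (y σ)))
      = τ • (y σ).fst + -(ContinuousLinearMap.adjoint J
        (τ • (T (y σ).fst + (-b) (y σ).snd))) := rfl
  rw [e1] at h2
  have h3 := ((ContinuousLinearMap.adjoint J).comp b).hasFDerivAt.comp_hasDerivAt σ h1
  have h4 := h3.sub h2
  refine (h4.congr_deriv ?_).congr_of_eventuallyEq (Eventually.of_forall fun s => ?_)
  · simp only [ContinuousLinearMap.comp_apply, map_smul, map_add, neg_apply, map_neg, hT, smul_add,
      smul_neg]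
    abel
  · change _ = ContinuousLinearMap.adjoint J (b (J (y s).fst))
      - (-(ContinuousLinearMap.adjoint J (y s).snd))
    beta_reduce
    rw [map_add]
    abel

/-- The functional `⟪q, J ·⟫` corresponds to `J* q` under the Riesz isomorphism of `H`; this is how
the equation in `H⁻¹` reduces to one in `H`. -/
theorem innerSL_comp_eq (J : HOp H L) (q : L) :
    (innerSL ℝ q).comp J = innerSL ℝ (ContinuousLinearMap.adjoint J q) := by
  ext v
  exact (ContinuousLinearMap.adjoint_inner_left J v q).symm

/-- The equation of `hasDerivAt_kick` in `L² × H⁻¹` and with the time `t = τ σ`. -/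
theorem IsUnitaryGroup.hasDerivAt_kick_dual {J : HOp H L}
    {U : ℝ → HOp (WithLp 2 (H × L)) (WithLp 2 (H × L))}
    (hU : IsUnitaryGroup (waveInv J) U) {a : HOp H H} {b : HOp L L}
    (hab : ∀ w, J (a w) = b (J w)) {T T' : HOp H L} (hT : ∀ w, T' w = T w + b (b (J w)))
    {τ : ℝ} (hτ : 0 < τ) {z : ℝ → WithLp 2 (H × L)}
    (hz : IsInteractionSol U (τ • (potOp T + diagOp a (-b))) τ z) {t : ℝ}
    (ht : t ∈ Ioo (0 : ℝ) τ) {y : ℝ → WithLp 2 (H × L)} (hy : ∀ s, y s = U s (z (s / τ))) :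
    HasDerivAt (fun s => (J (y s).fst, (innerSL ℝ ((y s).snd + b (J (y s).fst))).comp J))
      ((y t).snd + b (J (y t).fst), -(innerSL ℝ (y t).fst) + (innerSL ℝ (T' (y t).fst)).comp J)
      t := by
  have hσ : t / τ ∈ Ioo (0 : ℝ) 1 := ⟨div_pos ht.1 hτ, (div_lt_one hτ).2 ht.2⟩
  have hy' : ∀ σ, y (τ * σ) = U (τ * σ) (z σ) := fun σ => by
    rw [hy, mul_div_cancel_left₀ _ hτ.ne']
  obtain ⟨h1, h2⟩ := hU.hasDerivAt_kick hab hT hz hσ hy'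
  have hs : HasDerivAt (fun s => s / τ) τ⁻¹ t := by
    simpa using (hasDerivAt_id t).div_const τ
  have e : ∀ s, τ * (s / τ) = s := fun s => mul_div_cancel₀ s hτ.ne'
  have h1' := HasDerivAt.scomp t h1 hs
  have h2' := (innerSL ℝ (E := H)).hasFDerivAt.comp_hasDerivAt t (HasDerivAt.scomp t h2 hs)
  simp only [Function.comp_def, e, smul_smul, inv_mul_cancel₀ hτ.ne', one_smul] at h1' h2'
  refine h1'.prodMk ?_
  simp only [innerSL_comp_eq]
  refine h2'.congr_deriv ?_
  rw [map_add, map_neg]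

end Blocks

/-! ### Realizable solution maps and approximate reachability -/

section Derivatives

variable {E F : Type*} [NormedAddCommGroup E] [NormedSpace ℝ E] [NormedAddCommGroup F]
  [NormedSpace ℝ F]

/-- Stated for products of normed spaces, so that it applies to curves in `L² × H⁻¹`. -/
theorem hasDerivAt_prod_congr {f g : ℝ → E × F} {Z : E × F} {t : ℝ} (h : HasDerivAt f Z t)
    (hfg : g =ᶠ[𝓝 t] f) : HasDerivAt g Z t := HasDerivAt.congr_of_eventuallyEq h hfg

theorem hasDerivAt_prod_comp_sub_const {f : ℝ → E × F} {Z : E × F} {t a : ℝ}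
    (h : HasDerivAt f Z (t - a)) : HasDerivAt (fun s => f (s - a)) Z t := h.comp_sub_const t a

end Derivatives

section Reachability

variable {d : ℕ} {V : Torus d → ℝ}

/-- `F` is the solution map from time `0` to time `T` of the system with some piecewise constant
control, and is continuous. -/
def Realizes (V : Torus d → ℝ) (T : ℝ) (F : State d → State d) : Prop :=
  0 ≤ T ∧ Continuous F ∧ ∃ u : ℝ → Fin (2 * d + 1) → ℝ, IsPiecewiseConstant T u ∧
    ∀ x, ∃ W : ℝ → State d, IsSolution V T u x W ∧ W T = F x

theorem Realizes.id (V : Torus d → ℝ) : Realizes V 0 (fun x => x) :=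
  ⟨le_rfl, continuous_id, fun _ _ => 0, ⟨∅, fun _ _ _ _ _ _ => rfl⟩, fun x =>
    ⟨fun _ => x, ⟨continuousOn_const, rfl, ∅,
      fun _ ht => absurd (ht.1.trans ht.2) (lt_irrefl _)⟩, rfl⟩⟩

theorem IsPiecewiseConstant.append {T₁ T₂ : ℝ} {u₁ u₂ : ℝ → Fin (2 * d + 1) → ℝ}
    (h₁ : IsPiecewiseConstant T₁ u₁) (h₂ : IsPiecewiseConstant T₂ u₂) :
    IsPiecewiseConstant (T₁ + T₂) (fun t => if t ≤ T₁ then u₁ t else u₂ (t - T₁)) := by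
  obtain ⟨S₁, hS₁⟩ := h₁
  obtain ⟨S₂, hS₂⟩ := h₂
  refine ⟨insert T₁ (S₁ ∪ S₂.image (· + T₁)), fun s hs t ht hst hd => ?_⟩
  rw [Set.disjoint_left] at hd
  have hT₁ : T₁ ∉ Icc s t := hd (by simp)
  have hd1 : ∀ r ∈ S₁, r ∉ Icc s t := fun r hr => hd (by simp [hr])
  have hd2 : ∀ r ∈ S₂, r + T₁ ∉ Icc s t := fun r hr => hd (by simp [hr])
  by_cases hs1 : s ≤ T₁
  · have ht1 : t < T₁ := not_le.1 fun h => hT₁ ⟨hs1, h⟩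
    simp only [hs1, ht1.le, if_true]
    exact hS₁ s ⟨hs.1, hs1⟩ t ⟨ht.1, ht1.le⟩ hst (Set.disjoint_left.2 fun r hr => hd1 r hr)
  · have ht1 : ¬ t ≤ T₁ := fun h => hs1 (hst.trans h)
    simp only [hs1, ht1, if_false]
    push Not at hs1 ht1
    refine hS₂ _ ⟨by linarith, by linarith [hs.2]⟩ _ ⟨by linarith, by linarith [ht.2]⟩ (by linarith)
      (Set.disjoint_left.2 fun r hr hr' => hd2 r hr ⟨by linarith [hr'.1], by linarith [hr'.2]⟩)

theorem IsSolution.append {T₁ T₂ : ℝ} (hT₁ : 0 ≤ T₁) (hT₂ : 0 ≤ T₂)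
    {u₁ u₂ : ℝ → Fin (2 * d + 1) → ℝ} {x : State d} {W₁ W₂ : ℝ → State d}
    (h₁ : IsSolution V T₁ u₁ x W₁) (h₂ : IsSolution V T₂ u₂ (W₁ T₁) W₂) :
    IsSolution V (T₁ + T₂) (fun t => if t ≤ T₁ then u₁ t else u₂ (t - T₁)) x
      (fun t => if t ≤ T₁ then W₁ t else W₂ (t - T₁)) := by
  obtain ⟨hc₁, h0₁, S₁, hS₁⟩ := h₁
  obtain ⟨hc₂, h0₂, S₂, hS₂⟩ := h₂
  refine ⟨?_, by simp [hT₁, h0₁], insert T₁ (S₁ ∪ S₂.image (· + T₁)), fun t ht hts => ?_⟩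
  · rw [← Icc_union_Icc_eq_Icc hT₁ (by linarith : T₁ ≤ T₁ + T₂)]
    refine ContinuousOn.union_of_isClosed ?_ ?_ isClosed_Icc isClosed_Icc
    · exact hc₁.congr fun t ht => if_pos ht.2
    · have hc : ContinuousOn (fun t => W₂ (t - T₁)) (Icc T₁ (T₁ + T₂)) :=
        hc₂.comp (by fun_prop) fun t ht => ⟨by linarith [ht.1], by linarith [ht.2]⟩
      refine hc.congr fun t ht => ?_
      rcases eq_or_lt_of_le ht.1 with rfl | h
      · simp [h0₂]
      · exact if_neg (not_le.2 h)
  · simp only [Finset.mem_insert, Finset.mem_union, Finset.mem_image, not_or, not_exists,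
      not_and] at hts
    obtain ⟨ht0, ht1, ht2⟩ := hts
    rcases lt_or_gt_of_ne ht0 with h | h
    · obtain ⟨Z, hZ, hZ'⟩ := hS₁ t ⟨ht.1, h⟩ ht1
      refine ⟨Z, by simpa only [if_pos h.le] using hZ,
        hasDerivAt_prod_congr (E := L2 d) (F := HNeg1 d) hZ' ?_⟩
      filter_upwards [Iio_mem_nhds h] with s hs
      rw [if_pos (le_of_lt hs)]
    · obtain ⟨Z, hZ, hZ'⟩ := hS₂ (t - T₁) ⟨by linarith, by linarith [ht.2]⟩
        fun hmem => ht2 _ hmem (by ring)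
      refine ⟨Z, by simpa only [if_neg (not_le.2 h)] using hZ,
        hasDerivAt_prod_congr (E := L2 d) (F := HNeg1 d)
          (hasDerivAt_prod_comp_sub_const (E := L2 d) (F := HNeg1 d) hZ') ?_⟩
      filter_upwards [Ioi_mem_nhds h] with s hs
      rw [if_neg (not_le.2 hs)]

theorem Realizes.comp {T₁ T₂ : ℝ} {F₁ F₂ : State d → State d} (h₂ : Realizes V T₂ F₂)
    (h₁ : Realizes V T₁ F₁) : Realizes V (T₁ + T₂) (fun x => F₂ (F₁ x)) := by
  obtain ⟨hT₁, hF₁, u₁, hu₁, hW₁⟩ := h₁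
  obtain ⟨hT₂, hF₂, u₂, hu₂, hW₂⟩ := h₂
  refine ⟨add_nonneg hT₁ hT₂, hF₂.comp hF₁, _, hu₁.append hu₂, fun x => ?_⟩
  obtain ⟨W₁, hs₁, he₁⟩ := hW₁ x
  obtain ⟨W₂, hs₂, he₂⟩ := hW₂ (F₁ x)
  refine ⟨_, hs₁.append hT₁ hT₂ (he₁ ▸ hs₂), ?_⟩
  rcases eq_or_lt_of_le hT₂ with rfl | h
  · simp only [add_zero, le_refl, if_true]
    rw [he₁, ← he₂, hs₂.2.1]
  · simp [h, he₂]

/-- The state `y` is approximately reached from `x` in time `δ⁺`, in the strong sense that the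
approximate target depends continuously on the initial state. -/
def Reach (V : Torus d → ℝ) (δ : ℝ) (x y : State d) : Prop :=
  ∀ ε : ℝ, 0 < ε → ∃ T ≤ δ + ε, ∃ F, Realizes V T F ∧ dist (F x) y < ε

theorem Reach.refl (V : Torus d → ℝ) (x : State d) : Reach V 0 x x := fun ε hε =>
  ⟨0, by linarith, _, Realizes.id V, by simpa using hε⟩

theorem Realizes.reach {T : ℝ} {F : State d → State d} (h : Realizes V T F) (x : State d) :
    Reach V T x (F x) := fun ε hε => ⟨T, by linarith, F, h, by simpa using hε⟩

theorem Reach.trans {δ δ' : ℝ} {x y z : State d} (h : Reach V δ x y) (h' : Reach V δ' y z) :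
    Reach V (δ + δ') x z := by
  intro ε hε
  obtain ⟨T', hT', F', hF', hF'z⟩ := h' (ε / 2) (by linarith)
  obtain ⟨r, hr, hr'⟩ := Metric.continuousAt_iff.1 (hF'.2.1.continuousAt (x := y)) (ε / 2)
    (by linarith)
  obtain ⟨T, hT, F, hF, hFy⟩ := h (min (ε / 2) r) (lt_min (by linarith) hr)
  refine ⟨T + T', by linarith [min_le_left (ε / 2) r], _, hF'.comp hF, ?_⟩
  calc dist (F' (F x)) z ≤ dist (F' (F x)) (F' y) + dist (F' y) z := dist_triangle _ _ _
    _ < ε := by linarith [hr' (hFy.trans_le (min_le_right _ _))]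

theorem Reach.trans_zero {x y z : State d} (h : Reach V 0 x y) (h' : Reach V 0 y z) :
    Reach V 0 x z := by simpa using h.trans h'

/-- Limits of states reached in times that tend to `0` are reached in time `0⁺`. -/
theorem Reach.of_forall_dist {x z : State d}
    (h : ∀ ε : ℝ, 0 < ε → ∃ y, dist y z < ε ∧ Reach V ε x y) : Reach V 0 x z := by
  intro ε hε
  obtain ⟨y, hyz, hy⟩ := h (ε / 2) (by linarith)
  obtain ⟨T, hT, F, hF, hFy⟩ := hy (ε / 2) (by linarith)
  exact ⟨T, by linarith, F, hF, by linarith [dist_triangle (F x) y z]⟩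

theorem Reach.of_tendsto {x z : State d} {y : ℝ → State d}
    (hy : ∀ᶠ τ in 𝓝[>] (0 : ℝ), Reach V τ x (y τ)) (hz : Tendsto y (𝓝[>] 0) (𝓝 z)) :
    Reach V 0 x z := by
  refine Reach.of_forall_dist fun ε hε => ?_
  have h1 : ∀ᶠ τ in 𝓝[>] (0 : ℝ), dist (y τ) z < ε := hz (Metric.ball_mem_nhds z hε)
  have h2 : ∀ᶠ τ in 𝓝[>] (0 : ℝ), τ < ε := nhdsWithin_le_nhds (Iio_mem_nhds hε)
  obtain ⟨τ, hτ, hτz, hτε⟩ := (hy.and (h1.and h2)).exists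
  refine ⟨y τ, hτz, fun ε' hε' => ?_⟩
  obtain ⟨T, hT, h⟩ := hτ ε' hε'
  exact ⟨T, by linarith, h⟩

theorem minimalTime_eq_zero {x : State d} (h : ∀ y, Reach V 0 x y) : minimalTime V x = 0 := by
  refine le_antisymm (sInf_le ⟨0, rfl, fun y ε hε => ?_⟩) bot_le
  obtain ⟨T, hT, F, ⟨hT0, -, u, hu, hW⟩, hF⟩ := h y ε hε
  obtain ⟨W, hsol, hWT⟩ := hW x
  exact ⟨T, ⟨hT0, by simpa using hT⟩, u, hu, W, hsol, by rw [hWT, ← dist_eq_norm]; exact hF⟩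

end Reachability

/-! ### Conjugation of the wave flow by kicks -/

section WaveFlow

variable {d : ℕ} {V : Torus d → ℝ}

/-- The inverse of the generator `A` of the free wave equation on `H¹ × L²`. -/
def freeInv (d : ℕ) : HOp (State d) (State d) := waveInv (H := H1 d) (L := L2 d) (H1.incl d)

/-- The group of the free wave equation. -/
theorem exists_isUnitaryGroup_freeInv (d : ℕ) :
    ∃ U : ℝ → HOp (State d) (State d), IsUnitaryGroup (X := State d) (freeInv d) U :=
  IsSkew.exists_isUnitaryGroup (X := State d) (isSkew_waveInv (H := H1 d) (L := L2 d) (H1.incl d))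
    (denseRange_waveInv (H := H1 d) (L := L2 d) H1.toL2_injective
      (fun _ hp => L2.eq_zero_of_inner_toL2 hp))

/-- The kick `(w, p) ↦ (w, p + φ w)`. -/
def kick {φ : Torus d → ℝ} (hφ : Continuous φ) (x : State d) : State d :=
  WithLp.toLp 2 (x.fst, x.snd + mulL2 hφ (H1.toL2 x.fst))

theorem kick_kick {φ ψ χ : Torus d → ℝ} (hφ : Continuous φ) (hψ : Continuous ψ) (hχ : Continuous χ)
    (h : ∀ x, χ x = φ x + ψ x) (x : State d) : kick hψ (kick hφ x) = kick hχ x := by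
  refine WithLp.ofLp_injective 2 (Prod.ext rfl ?_)
  change x.snd + mulL2 hφ (H1.toL2 x.fst) + mulL2 hψ (H1.toL2 x.fst)
    = x.snd + mulL2 hχ (H1.toL2 x.fst)
  rw [add_assoc]
  congr 1
  refine Lp.ext ?_
  filter_upwards [coeFn_mulL2 hφ (H1.toL2 x.fst), coeFn_mulL2 hψ (H1.toL2 x.fst),
    coeFn_mulL2 hχ (H1.toL2 x.fst), Lp.coeFn_add (mulL2 hφ (H1.toL2 x.fst))
      (mulL2 hψ (H1.toL2 x.fst))] with y h1 h2 h3 h4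
  rw [h4, Pi.add_apply, h1, h2, h3, h]
  ring

theorem kick_zero {φ : Torus d → ℝ} (hφ : Continuous φ) (h : ∀ x, φ x = 0) (x : State d) :
    kick hφ x = x := by
  refine WithLp.ofLp_injective 2 (Prod.ext rfl ?_)
  change x.snd + mulL2 hφ (H1.toL2 x.fst) = x.snd
  rw [add_eq_left]
  refine Lp.ext ?_
  filter_upwards [coeFn_mulL2 hφ (H1.toL2 x.fst), Lp.coeFn_zero ℝ 2 (volume : Measure (Torus d))]
    with y h1 h2
  rw [h1, h2, h, zero_mul, Pi.zero_apply]

theorem continuous_kick {φ : Torus d → ℝ} (hφ : Continuous φ) : Continuous (kick hφ) := by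
  have h1 : Continuous fun x : State d => x.fst := (fstOp (H1 d) (L2 d)).continuous
  have h2 : Continuous fun x : State d => x.snd := (sndOp (H1 d) (L2 d)).continuous
  exact (WithLp.prod_continuous_toLp 2 (H1 d) (L2 d)).comp
    (h1.prodMk (h2.add ((mulL2 hφ).continuous.comp (H1.toL2.continuous.comp h1))))

/-- The potential `(w, p) ↦ (0, ψ w)`. -/
def multOp {ψ : Torus d → ℝ} (hψ : Continuous ψ) : HOp (State d) (State d) :=
  potOp (H := H1 d) (L := L2 d) ((mulL2 hψ).comp (H1.incl d))

/-- The operator `(w, p) ↦ (φ w, -φ p)`. -/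
def dampOp {φ : Torus d → ℝ} (hφ : IsSmooth φ) : HOp (State d) (State d) :=
  diagOp (H := H1 d) (L := L2 d) (mulH1 hφ) (-mulL2 hφ.continuous)

/-- Conjugating by a kick the flow with the generator `A + (T_V + ψ) B + (φ, 0; 0, -φ)` gives a flow
of the control system: the controls `c` cancel the term `-φ²` that the conjugation generates. -/
theorem realizes_kick_flow_kick {U : ℝ → HOp (State d) (State d)}
    (hU : IsUnitaryGroup (X := State d) (freeInv d) U) {TV : HOp (H1 d) (L2 d)}
    (hTV : ∀ w, TV w =ᵐ[volume] fun x => V x * H1.toL2 w x) {φ ψ : Torus d → ℝ}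
    (hφ : IsSmooth φ) (hψ : Continuous ψ) {c : Fin (2 * d + 1) → ℝ}
    (hc : ∀ x, ψ x = ∑ j, c j * controlPotential j x - φ x ^ 2) (hφ' : Continuous fun x => -φ x)
    {τ : ℝ} (hτ : 0 < τ)
    {Z : State d → ℝ → State d} (hZ0 : ∀ x, Z x 0 = x)
    (hZ : ∀ x, IsInteractionSol (X := State d) U
      (τ • (potOp (H := H1 d) (L := L2 d) TV + multOp hψ + dampOp hφ)) τ (Z x))
    (hZc : Continuous fun x => Z x 1) :
    Realizes V τ (fun x => kick hφ.continuous (U τ (Z (kick hφ' x) 1))) := by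
  let b : HOp (L2 d) (L2 d) := mulL2 hφ.continuous
  let T : HOp (H1 d) (L2 d) := TV + (mulL2 hψ).comp (H1.incl d)
  let T' : HOp (H1 d) (L2 d) := T + (b.comp b).comp (H1.incl d)
  have hT' : ∀ w : H1 d, T' w = T w + b (b (H1.incl d w)) := fun w => rfl
  have hT'e : ∀ w : H1 d, T' w = TV w + mulL2 hψ (H1.toL2 w) + b (b (H1.toL2 w)) := fun w => rfl
  have hgen : ∀ w : H1 d,
      ∀ᵐ x, T' w x = (V x + ∑ j, c j * controlPotential j x) * H1.toL2 w x := by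
    intro w
    rw [hT'e]
    filter_upwards [hTV w, coeFn_mulL2 hψ (H1.toL2 w), coeFn_mulL2 hφ.continuous (H1.toL2 w),
      coeFn_mulL2 hφ.continuous (mulL2 hφ.continuous (H1.toL2 w)),
      Lp.coeFn_add (TV w + mulL2 hψ (H1.toL2 w)) (b (b (H1.toL2 w))),
      Lp.coeFn_add (TV w) (mulL2 hψ (H1.toL2 w))] with x h1 h2 h3 h4 h5 h6
    have h4' : b (b (H1.toL2 w)) x = φ x * mulL2 hφ.continuous (H1.toL2 w) x := h4
    rw [h5, Pi.add_apply, h6, Pi.add_apply, h1, h2, h4', h3, hc]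
    ring
  have hP : ∀ x, IsInteractionSol (X := State d) U
      (τ • (potOp (H := H1 d) (L := L2 d) T + diagOp (H := H1 d) (L := L2 d) (mulH1 hφ) (-b)))
      τ (Z x) := by
    intro x
    have e : potOp (H := H1 d) (L := L2 d) T
        = potOp (H := H1 d) (L := L2 d) TV + multOp hψ :=
      potOp_add (H := H1 d) (L := L2 d) _ _
    rw [e]
    exact hZ x
  refine ⟨hτ.le, ?_, fun _ => c, ⟨∅, fun _ _ _ _ _ _ => rfl⟩, fun x => ?_⟩
  · exact (continuous_kick _).comp ((U τ).continuous.comp (hZc.comp (continuous_kick _)))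
  · let z : ℝ → State d := Z (kick hφ' x)
    let y : ℝ → State d := fun t => U t (z (t / τ))
    refine ⟨fun t => kick hφ.continuous (y t), ⟨?_, ?_, ∅, fun t ht _ => ?_⟩, ?_⟩
    · refine (continuous_kick _).comp_continuousOn ?_
      refine (IsUnitaryGroup.continuous_uncurry (X := State d) hU).comp_continuousOn
        (continuousOn_id.prodMk ?_)
      refine (IsInteractionSol.continuousOn (X := State d) (hP _)).comp
        (continuousOn_id.div_const τ) fun t ht => ?_
      exact ⟨div_nonneg ht.1 hτ.le, (div_le_one hτ).2 ht.2⟩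
    · change kick _ (U 0 (z (0 / τ))) = x
      rw [zero_div, hU.zero_apply]
      change kick _ (Z _ 0) = x
      rw [hZ0, kick_kick hφ' hφ.continuous (continuous_const (y := (0 : ℝ))) (fun x => by ring),
        kick_zero _ fun _ => rfl]
    · have h := IsUnitaryGroup.hasDerivAt_kick_dual (H := H1 d) (L := L2 d) (J := H1.incl d) hU
        (a := mulH1 hφ) (b := b) (fun w => rfl) hT' hτ (hP (kick hφ' x)) ht (y := y) (fun s => rfl)
      exact ⟨_, ⟨rfl, T' (y t).fst, hgen _, rfl⟩, h⟩
    · change kick _ (U τ (z (τ / τ))) = _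
      rw [div_self hτ.ne']

theorem mulL2_eq_smul {φ ψ : Torus d → ℝ} (hφ : Continuous φ) (hψ : Continuous ψ) {r : ℝ}
    (h : ∀ x, ψ x = r * φ x) : mulL2 hψ = r • mulL2 hφ := by
  ext1 f
  refine Lp.ext ?_
  have e : (r • mulL2 hφ) f = r • mulL2 hφ f := rfl
  rw [e]
  filter_upwards [coeFn_mulL2 hφ f, coeFn_mulL2 hψ f, Lp.coeFn_smul r (mulL2 hφ f)]
    with x h1 h2 h3
  rw [h2, h3, Pi.smul_apply, h1, h, smul_eq_mul, mul_assoc]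

theorem mulH1_eq_smul {φ ψ : Torus d → ℝ} (hφ : IsSmooth φ) (hψ : IsSmooth ψ) {r : ℝ}
    (h : ∀ x, ψ x = r * φ x) : mulH1 hψ = r • mulH1 hφ := by
  ext1 w
  refine H1.toL2_injective ?_
  have e : H1.toL2 ((r • mulH1 hφ) w) = (r • mulL2 hφ.continuous) (H1.toL2 w) := rfl
  rw [e, toL2_mulH1, mulL2_eq_smul hφ.continuous hψ.continuous h]

theorem multOp_eq_smul {φ ψ : Torus d → ℝ} (hφ : Continuous φ) (hψ : Continuous ψ) {r : ℝ}
    (h : ∀ x, ψ x = r * φ x) : multOp hψ = r • multOp hφ := by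
  rw [multOp, mulL2_eq_smul hφ hψ h]
  exact potOp_smul (H := H1 d) (L := L2 d) r ((mulL2 hφ).comp (H1.incl d))

theorem dampOp_eq_smul {φ ψ : Torus d → ℝ} (hφ : IsSmooth φ) (hψ : IsSmooth ψ) {r : ℝ}
    (h : ∀ x, ψ x = r * φ x) : dampOp hψ = r • dampOp hφ := by
  rw [dampOp, mulH1_eq_smul hφ hψ h, mulL2_eq_smul hφ.continuous hψ.continuous h, ← smul_neg]
  exact diagOp_smul (H := H1 d) (L := L2 d) r _ _

/-- `φ` is smooth, and every state can be kicked by `φ` in arbitrarily small time. -/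
def IsKick (V : Torus d → ℝ) (φ : Torus d → ℝ) : Prop :=
  ∃ hφ : IsSmooth φ, ∀ x, Reach V 0 x (kick hφ.continuous x)

/-- A flow of the perturbed equation; without the bound on `P` nothing but the initial value is
claimed. -/
theorem exists_wave_flow (d : ℕ) {U : ℝ → HOp (State d) (State d)}
    (hU : IsUnitaryGroup (X := State d) (freeInv d) U) (P : HOp (State d) (State d)) (τ : ℝ) :
    ∃ Z : State d → ℝ → State d, (∀ x, Z x 0 = x) ∧ (‖P‖ ≤ 1 / 2 →
      (∀ x, IsInteractionSol (X := State d) U P τ (Z x)) ∧ Continuous fun x => Z x 1) := by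
  by_cases h : ‖P‖ ≤ 1 / 2
  · obtain ⟨Z, hZ, hZc⟩ := IsUnitaryGroup.exists_flow (X := State d) hU h τ
    exact ⟨Z, fun x => (hZ x).1, fun _ => ⟨fun x => (hZ x).2, hZc⟩⟩
  · exact ⟨fun x _ => x, fun _ => rfl, fun h' => absurd h' h⟩

theorem smul_rescaled_generator {X : Type*} [NormedAddCommGroup X] [InnerProductSpace ℝ X]
    (A M D : HOp X X) {τ r : ℝ} (hτ : 0 < τ) : τ • (A + τ⁻¹ • M + r • D) = τ • A + M + (τ * r) • D := by
  rw [smul_add, smul_add, smul_smul, smul_smul, mul_inv_cancel₀ hτ.ne', one_smul]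

theorem tendsto_rescaled_generator {X : Type*} [NormedAddCommGroup X] [InnerProductSpace ℝ X]
    (A M D : HOp X X) {s : ℝ → ℝ} {s₀ : ℝ} (hs : Tendsto (fun τ => τ * s τ) (𝓝[>] 0) (𝓝 s₀)) :
    Tendsto (fun τ => τ • A + M + (τ * s τ) • D) (𝓝[>] (0 : ℝ)) (𝓝 (M + s₀ • D)) := by
  have h0 : Tendsto (fun τ : ℝ => τ) (𝓝[>] 0) (𝓝 0) := nhdsWithin_le_nhds
  simpa using ((h0.smul_const A).add_const M).add (hs.smul_const D)

theorem eventually_norm_le {X : Type*} [NormedAddCommGroup X] [InnerProductSpace ℝ X]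
    {P : ℝ → HOp X X} {P₀ : HOp X X} {l : Filter ℝ} (hP : Tendsto P l (𝓝 P₀)) {r : ℝ}
    (hr : ‖P₀‖ < r) : ∀ᶠ τ in l, ‖P τ‖ ≤ r :=
  (hP.norm.eventually_lt_const hr).mono fun _ h => h.le

/-- The limit as `τ → 0` of the flow over the time `τ` conjugated by the kicks by `± s(τ) φ`, with
the controls `c(τ)` chosen so that the potential is `V + τ⁻¹ ψ` after the conjugation: the rescaled
generator converges to `(w, p) ↦ (s₀ φ w, ψ w - s₀ φ p)`. -/
theorem reach_limit (hd : 1 ≤ d) (hV : AdmissiblePotential V) {φ ψ : Torus d → ℝ}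
    (hφ : IsSmooth φ) (hψ : Continuous ψ) {s : ℝ → ℝ} {c : ℝ → Fin (2 * d + 1) → ℝ} {s₀ : ℝ}
    (hs : Tendsto (fun τ => τ * s τ) (𝓝[>] 0) (𝓝 s₀))
    (hc : ∀ τ, 0 < τ → ∀ x,
      τ⁻¹ * ψ x = ∑ j, c τ j * controlPotential j x - (s τ * φ x) ^ 2)
    (hk : ∀ r : ℝ, IsKick V (fun x => r * φ x))
    (hnorm : ‖multOp hψ + s₀ • dampOp hφ‖ < 1 / 2) {γ : ℝ → State d}
    (hγ : ∀ σ, HasDerivAt γ ((multOp hψ + s₀ • dampOp hφ) (γ σ)) σ) :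
    Reach V 0 (γ 0) (γ 1) := by
  obtain ⟨TV, hTV⟩ := hV.exists_mul hd
  obtain ⟨U, hU⟩ := exists_isUnitaryGroup_freeInv d
  let A : HOp (State d) (State d) := potOp (H := H1 d) (L := L2 d) TV
  let P : ℝ → HOp (State d) (State d) := fun τ => τ • A + multOp hψ + (τ * s τ) • dampOp hφ
  have hP : Tendsto P (𝓝[>] (0 : ℝ)) (𝓝 (multOp hψ + s₀ • dampOp hφ)) :=
    tendsto_rescaled_generator (X := State d) A (multOp hψ) (dampOp hφ) hs
  have hPs : ∀ᶠ τ in 𝓝[>] (0 : ℝ), ‖P τ‖ ≤ 1 / 2 :=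
    eventually_norm_le (X := State d) hP hnorm
  choose Z hZ0 hZ using fun τ => exists_wave_flow d hU (P τ) τ
  refine Reach.of_tendsto (y := fun τ => U τ (Z τ (γ 0) 1)) ?_
    (IsUnitaryGroup.tendsto_of_isInteractionSol (X := State d) hU hP
      (hPs.mono fun τ hτ => (hZ τ hτ).1 (γ 0)) hγ fun τ => hZ0 τ (γ 0))
  filter_upwards [hPs, self_mem_nhdsWithin] with τ hτ (hτ0 : 0 < τ)
  obtain ⟨hφ', h1⟩ := hk (s τ)
  obtain ⟨hφn, h2⟩ := hk (-s τ)
  have hψ' : Continuous fun x => τ⁻¹ * ψ x := continuous_const.mul hψ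
  have hneg : Continuous fun x => -(s τ * φ x) := hφ'.continuous.neg
  have hPe : P τ = τ • (A + multOp hψ' + dampOp hφ') := by
    rw [multOp_eq_smul hψ hψ' (fun x => rfl), dampOp_eq_smul hφ hφ' (fun x => rfl)]
    exact (smul_rescaled_generator (X := State d) A (multOp hψ) (dampOp hφ) hτ0).symm
  have hsol := (hZ τ hτ).1
  rw [hPe] at hsol
  have h3 := realizes_kick_flow_kick hU hTV hφ' hψ' (hc τ hτ0) hneg hτ0 (hZ0 τ) hsol (hZ τ hτ).2
  -- kick by `s φ`, flow, kick by `-s φ`; the flow is itself conjugated by kicks, which cancel these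
  have h4 := ((h1 (γ 0)).trans (h3.reach _)).trans (h2 _)
  have h0 : Continuous fun _ : Torus d => (0 : ℝ) := continuous_const
  rw [kick_kick hφ'.continuous hneg h0 (fun x => by ring), kick_zero h0 (fun _ => rfl),
    kick_kick hφ'.continuous hφn.continuous h0 (fun x => by ring),
    kick_zero h0 (fun _ => rfl)] at h4
  simpa using h4

end WaveFlow

/-! ### The available kicks -/

section SmallOperators

variable {X : Type*} [NormedAddCommGroup X] [InnerProductSpace ℝ X]

theorem exists_norm_smul_lt (M D : HOp X X) :
    ∃ r₀ : ℝ, 0 < r₀ ∧ ∀ r, 0 < r → r < r₀ → ‖r • M + (0 : ℝ) • D‖ < 1 / 2 := by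
  have h : Tendsto (fun r : ℝ => ‖r • M + (0 : ℝ) • D‖) (𝓝 0) (𝓝 0) := by
    have h2 : Continuous fun r : ℝ => ‖r • M + (0 : ℝ) • D‖ := by fun_prop
    simpa using h2.tendsto 0
  obtain ⟨r₀, hr₀, h'⟩ := Metric.eventually_nhds_iff.1 (h.eventually_lt_const one_half_pos)
  refine ⟨r₀, hr₀, fun r hr hr' => h' ?_⟩
  rwa [Real.dist_eq, sub_zero, abs_of_pos hr]

theorem hasDerivAt_line {N D : HOp X X} {x : X} (hN : N (N x) = 0) (σ : ℝ) :
    HasDerivAt (fun σ : ℝ => x + σ • N x) ((N + (0 : ℝ) • D) (x + σ • N x)) σ := by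
  have e : (N + (0 : ℝ) • D) (x + σ • N x) = (1 : ℝ) • N x := by
    simp [hN]
  rw [e]
  exact ((hasDerivAt_id σ).smul_const (N x)).const_add x

end SmallOperators

section Kicks

variable {d : ℕ} {V : Torus d → ℝ}

theorem IsSmooth.congr {φ ψ : Torus d → ℝ} (hφ : IsSmooth φ) (h : ∀ x, ψ x = φ x) :
    IsSmooth ψ := by
  obtain rfl : ψ = φ := funext h
  exact hφ

theorem IsKick.congr {φ ψ : Torus d → ℝ} (hφ : IsKick V φ) (h : ∀ x, ψ x = φ x) : IsKick V ψ := by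
  obtain rfl : ψ = φ := funext h
  exact hφ

theorem isKick_zero (V : Torus d → ℝ) : IsKick V fun _ => 0 :=
  ⟨IsSmooth.const 0, fun x => by
    rw [kick_zero _ fun _ => rfl]
    exact Reach.refl V x⟩

theorem IsKick.add {φ ψ : Torus d → ℝ} (hφ : IsKick V φ) (hψ : IsKick V ψ) :
    IsKick V fun x => φ x + ψ x := by
  obtain ⟨hφ, h1⟩ := hφ
  obtain ⟨hψ, h2⟩ := hψ
  refine ⟨hφ.add hψ, fun x => ?_⟩
  have h := (h1 x).trans_zero (h2 _)
  rwa [kick_kick hφ.continuous hψ.continuous (hφ.add hψ).continuous fun _ => rfl] at h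

theorem IsKick.natCast_mul {φ : Torus d → ℝ} (hφ : IsKick V φ) (n : ℕ) :
    IsKick V fun x => n * φ x := by
  induction n with
  | zero => exact (isKick_zero V).congr fun x => by simp
  | succ n ih => exact (ih.add hφ).congr fun x => by push_cast; ring

/-- Since kicks may be iterated, it is enough to obtain small multiples of a kick. -/
theorem isKick_of_small {ψ : Torus d → ℝ} {r₀ : ℝ} (hr₀ : 0 < r₀)
    (h : ∀ r, 0 < r → r < r₀ → IsKick V fun x => r * ψ x) : IsKick V ψ := by
  obtain ⟨n, hn⟩ := exists_nat_gt r₀⁻¹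
  have hn0 : (0 : ℝ) < n := (inv_pos.2 hr₀).trans hn
  refine ((h (n : ℝ)⁻¹ (inv_pos.2 hn0) (inv_lt_of_inv_lt₀ hr₀ hn)).natCast_mul n).congr
    fun x => ?_
  field_simp

/-- The case of `reach_limit` in which the limit generator is the nilpotent operator
`(w, p) ↦ (0, ψ w)`. -/
theorem isKick_of_generator (hd : 1 ≤ d) (hV : AdmissiblePotential V) {φ ψ : Torus d → ℝ}
    (hφ : IsSmooth φ) (hψ : IsSmooth ψ) (hk : ∀ r : ℝ, IsKick V fun x => r * φ x)
    {s : ℝ → ℝ → ℝ} {c : ℝ → ℝ → Fin (2 * d + 1) → ℝ}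
    (hs : ∀ r, 0 < r → Tendsto (fun τ => τ * s r τ) (𝓝[>] 0) (𝓝 0))
    (hc : ∀ r, 0 < r → ∀ τ, 0 < τ → ∀ x,
      τ⁻¹ * (r * ψ x) = ∑ j, c r τ j * controlPotential j x - (s r τ * φ x) ^ 2) :
    IsKick V ψ := by
  obtain ⟨r₀, hr₀, h⟩ := exists_norm_smul_lt (X := State d) (multOp hψ.continuous) (dampOp hφ)
  refine isKick_of_small hr₀ fun r hr hr' => ⟨hψ.const_mul r, fun x => ?_⟩
  have hrψ := (hψ.const_mul r).continuous
  have hN := h r hr hr'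
  rw [← multOp_eq_smul hψ.continuous hrψ fun _ => rfl] at hN
  have hNN : multOp hrψ (multOp hrψ x) = 0 := potOp_potOp (H := H1 d) (L := L2 d) _ _ x
  have h1 := reach_limit hd hV hφ hrψ (hs r hr) (hc r hr) hk hN
    (hasDerivAt_line (X := State d) (D := dampOp hφ) hNN)
  have e0 : x + (0 : ℝ) • multOp hrψ x = x := by rw [zero_smul, add_zero]
  have e1 : x + (1 : ℝ) • multOp hrψ x = kick hrψ x := by
    rw [one_smul]
    exact add_potOp (H := H1 d) (L := L2 d) _ x
  rwa [e0, e1] at h1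

/-- A control of size `b / τ` during the time `τ` kicks by `∑ b_j V_j` in the limit. -/
theorem isKick_of_control (hd : 1 ≤ d) (hV : AdmissiblePotential V) {ψ : Torus d → ℝ}
    (hψ : IsSmooth ψ) {b : Fin (2 * d + 1) → ℝ}
    (hb : ∀ x, ψ x = ∑ j, b j * controlPotential j x) : IsKick V ψ := by
  refine isKick_of_generator hd hV (IsSmooth.const 0) hψ
    (fun r => (isKick_zero V).congr fun x => by simp) (s := fun _ _ => 0)
    (c := fun r τ j => τ⁻¹ * r * b j) (fun r _ => by simp) fun r _ τ _ x => ?_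
  rw [hb, ← mul_assoc, Finset.mul_sum]
  simp [mul_assoc]

/-- The second order effect of large kicks: conjugating the free flow over the short time `τ` by the
kicks by `± φ / √τ` gives in the limit the kick by `-φ²`. -/
theorem isKick_neg_sq (hd : 1 ≤ d) (hV : AdmissiblePotential V) {φ : Torus d → ℝ}
    (hφ : IsSmooth φ) (hk : ∀ r : ℝ, IsKick V fun x => r * φ x) :
    IsKick V fun x => -φ x ^ 2 := by
  have hsm : IsSmooth fun x => -φ x ^ 2 := by
    have h := (hφ.mul hφ).const_mul (-1)
    exact h.congr fun x => by ring
  refine isKick_of_generator hd hV hφ hsm hk (s := fun r τ => √(r / τ))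
    (c := fun _ _ _ => 0) (fun r hr => ?_) fun r hr τ hτ x => ?_
  · have h : Tendsto (fun τ : ℝ => √(r * τ)) (𝓝[>] 0) (𝓝 0) := by
      have h2 : Continuous fun τ : ℝ => √(r * τ) := by fun_prop
      simpa using (h2.tendsto 0).mono_left nhdsWithin_le_nhds
    refine h.congr' ?_
    filter_upwards [self_mem_nhdsWithin] with τ (hτ : 0 < τ)
    rw [show r * τ = τ ^ 2 * (r / τ) by field_simp, Real.sqrt_mul (by positivity),
      Real.sqrt_sq hτ.le]
  · rw [mul_pow, Real.sq_sqrt (by positivity)]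
    simp only [zero_mul, Finset.sum_const_zero]
    field_simp
    ring

/-- All multiples of `φ` are kicks. -/
def IsKickLine (V : Torus d → ℝ) (φ : Torus d → ℝ) : Prop := ∀ r : ℝ, IsKick V fun x => r * φ x

theorem IsKickLine.isSmooth {φ : Torus d → ℝ} (h : IsKickLine V φ) : IsSmooth φ := by
  obtain ⟨h1, -⟩ := h 1
  exact h1.congr fun x => (one_mul (φ x)).symm

theorem IsKickLine.congr {φ ψ : Torus d → ℝ} (hφ : IsKickLine V φ) (h : ∀ x, ψ x = φ x) :
    IsKickLine V ψ := by
  obtain rfl : ψ = φ := funext h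
  exact hφ

theorem IsKickLine.add {φ ψ : Torus d → ℝ} (hφ : IsKickLine V φ) (hψ : IsKickLine V ψ) :
    IsKickLine V fun x => φ x + ψ x := fun r =>
  ((hφ r).add (hψ r)).congr fun x => by ring

theorem IsKickLine.const_mul {φ : Torus d → ℝ} (hφ : IsKickLine V φ) (c : ℝ) :
    IsKickLine V fun x => c * φ x := fun r => (hφ (r * c)).congr fun x => by ring

theorem isKickLine_of_control (hd : 1 ≤ d) (hV : AdmissiblePotential V) {ψ : Torus d → ℝ}
    (hψ : IsSmooth ψ) {j : Fin (2 * d + 1)} (hj : ∀ x, ψ x = controlPotential j x) :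
    IsKickLine V ψ := fun r =>
  isKick_of_control hd hV (hψ.const_mul r) (b := Pi.single j r) fun x => by
    rw [Finset.sum_eq_single j (fun i _ hi => by rw [Pi.single_eq_of_ne hi, zero_mul])
      (fun h => absurd (Finset.mem_univ j) h), Pi.single_eq_same, hj]

theorem isKickLine_const (hd : 1 ≤ d) (hV : AdmissiblePotential V) (c : ℝ) :
    IsKickLine V fun _ => c := by
  have h : IsKickLine V fun _ => 1 := isKickLine_of_control hd hV (IsSmooth.const 1)
    (j := ⟨0, by omega⟩) fun x => by simp [controlPotential]
  exact (h.const_mul c).congr fun x => by simp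

theorem isKickLine_sinMode_single (hd : 1 ≤ d) (hV : AdmissiblePotential V) (i : Fin d) :
    IsKickLine V (sinMode (Pi.single i 1)) :=
  isKickLine_of_control hd hV (isSmooth_sinMode _) (j := ⟨2 * i.val + 1, by omega⟩) fun x => by
    have h1 : (2 * i.val + 1) % 2 = 1 := by omega
    have h2 : (2 * i.val + 1 - 1) / 2 = i.val := by omega
    simp only [controlPotential, sinMode, phase_single, h1, h2, Nat.succ_ne_zero, dif_neg,
      not_false_eq_true, if_true]
    rfl

theorem isKickLine_cosMode_single (hd : 1 ≤ d) (hV : AdmissiblePotential V) (i : Fin d) :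
    IsKickLine V (cosMode (Pi.single i 1)) :=
  isKickLine_of_control hd hV (isSmooth_cosMode _) (j := ⟨2 * i.val + 2, by omega⟩) fun x => by
    have h1 : (2 * i.val + 2) % 2 ≠ 1 := by omega
    have h2 : (2 * i.val + 2 - 1) / 2 = i.val := by omega
    simp only [controlPotential, cosMode, phase_single, h1, h2, Nat.succ_ne_zero, dif_neg,
      not_false_eq_true, if_false]
    rfl

/-- If `α² + β² = 2 + f` and `α'² + β'² = 2 - f`, then the kicks by `± f` come from squares and
constants. -/
theorem IsKickLine.of_sq_add_sq (hd : 1 ≤ d) (hV : AdmissiblePotential V)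
    {α β α' β' f : Torus d → ℝ} (hα : IsKickLine V α) (hβ : IsKickLine V β)
    (hα' : IsKickLine V α') (hβ' : IsKickLine V β') (h : ∀ x, α x ^ 2 + β x ^ 2 = 2 + f x)
    (h' : ∀ x, α' x ^ 2 + β' x ^ 2 = 2 - f x) : IsKickLine V f := by
  have key : ∀ {a b g : Torus d → ℝ}, IsKickLine V a → IsKickLine V b →
      (∀ x, a x ^ 2 + b x ^ 2 = 2 + g x) → ∀ r : ℝ, 0 ≤ r → IsKick V fun x => -r * g x := by
    intro a b g ha hb hg r hr
    have h1 := isKick_neg_sq hd hV (ha.const_mul √r).isSmooth (ha.const_mul √r)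
    have h2 := isKick_neg_sq hd hV (hb.const_mul √r).isSmooth (hb.const_mul √r)
    refine ((h1.add h2).add (isKickLine_const hd hV 2 r)).congr fun x => ?_
    rw [mul_pow, mul_pow, Real.sq_sqrt hr]
    linear_combination r * hg x
  intro r
  rcases le_total r 0 with hr | hr
  · exact (key hα hβ h (-r) (by linarith)).congr fun x => by ring
  · exact (key (g := fun x => -f x) hα' hβ' (fun x => by rw [h', sub_eq_add_neg]) r hr).congr
      fun x => by ring

/-- The frequencies `k` such that the kicks by the multiples of `cos (k · x)` and `sin (k · x)` are
available form a subgroup. -/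
def kickFrequencies (hd : 1 ≤ d) (hV : AdmissiblePotential V) : AddSubgroup (Fin d → ℤ) where
  carrier := {k | IsKickLine V (cosMode k) ∧ IsKickLine V (sinMode k)}
  zero_mem' :=
    ⟨(isKickLine_const hd hV 1).congr fun x => by simp [cosMode, phase_zero],
      (isKickLine_const hd hV 0).congr fun x => by simp [sinMode, phase_zero]⟩
  neg_mem' := fun {k} hk =>
    ⟨hk.1.congr fun x => by simp [cosMode, phase_neg],
      (hk.2.const_mul (-1)).congr fun x => by simp [sinMode, phase_neg]⟩
  add_mem' := fun {k l} hk hl => by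
    have sub : ∀ {f g : Torus d → ℝ}, IsKickLine V f → IsKickLine V g →
        IsKickLine V fun x => f x - g x := fun hf hg =>
      (hf.add (hg.const_mul (-1))).congr fun x => by ring
    have e1 : ∀ x, sinMode k x ^ 2 + cosMode k x ^ 2 = 1 := fun x => by
      rw [add_comm]; exact Real.Angle.cos_sq_add_sin_sq _
    have e2 : ∀ x, sinMode l x ^ 2 + cosMode l x ^ 2 = 1 := fun x => by
      rw [add_comm]; exact Real.Angle.cos_sq_add_sin_sq _
    have ec : ∀ x, cosMode (k + l) x = cosMode k x * cosMode l x - sinMode k x * sinMode l x :=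
      fun x => by simp only [cosMode, sinMode, phase_add, Real.Angle.cos_add]
    have es : ∀ x, sinMode (k + l) x = sinMode k x * cosMode l x + cosMode k x * sinMode l x :=
      fun x => by simp only [cosMode, sinMode, phase_add, Real.Angle.sin_add]
    -- `(cos k + cos l)² + (sin k - sin l)² = 2 + 2 cos (k + l)` and its variants
    constructor
    · have h := IsKickLine.of_sq_add_sq (f := fun x => 2 * cosMode (k + l) x) hd hV
        (hk.1.add hl.1) (sub hk.2 hl.2) (sub hk.1 hl.1) (hk.2.add hl.2)
        (fun x => by linear_combination e1 x + e2 x - 2 * ec x)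
        (fun x => by linear_combination e1 x + e2 x + 2 * ec x)
      exact (h.const_mul 2⁻¹).congr fun x => by ring
    · have h := IsKickLine.of_sq_add_sq (f := fun x => 2 * sinMode (k + l) x) hd hV
        (hk.2.add hl.1) (hk.1.add hl.2) (sub hk.2 hl.1) (sub hk.1 hl.2)
        (fun x => by linear_combination e1 x + e2 x - 2 * es x)
        (fun x => by linear_combination e1 x + e2 x + 2 * es x)
      exact (h.const_mul 2⁻¹).congr fun x => by ring

theorem mem_kickFrequencies (hd : 1 ≤ d) (hV : AdmissiblePotential V) (k : Fin d → ℤ) :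
    k ∈ kickFrequencies hd hV := by
  -- the subgroup contains the unit vectors, whose sines and cosines are control potentials
  have e : k = ∑ i, k i • Pi.single i (1 : ℤ) := by
    rw [← Finset.univ_sum_single k]
    refine Finset.sum_congr rfl fun i _ => ?_
    rw [Finset.univ_sum_single, ← Pi.single_smul]
    simp
  rw [e]
  exact sum_mem fun i _ => zsmul_mem
    (show Pi.single i 1 ∈ kickFrequencies hd hV from
      ⟨isKickLine_cosMode_single hd hV i, isKickLine_sinMode_single hd hV i⟩) _

/-- The velocities `φ w`, for the kicks `φ`. -/
def kickVelocities (hd : 1 ≤ d) (hV : AdmissiblePotential V) (w : L2 d) : HSub (L2 d) where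
  carrier := {q | ∃ φ : Torus d → ℝ, IsKickLine V φ ∧ q =ᵐ[volume] fun x => φ x * w x}
  zero_mem' := ⟨fun _ => 0, isKickLine_const hd hV 0, by
    filter_upwards [Lp.coeFn_zero ℝ 2 (volume : Measure (Torus d))] with x hx
    rw [hx, Pi.zero_apply, zero_mul]⟩
  add_mem' := by
    rintro p q ⟨φ, hφ, hp⟩ ⟨ψ, hψ, hq⟩
    refine ⟨_, hφ.add hψ, ?_⟩
    filter_upwards [Lp.coeFn_add p q, hp, hq] with x h1 h2 h3
    rw [h1, Pi.add_apply, h2, h3]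
    ring
  smul_mem' := by
    rintro c p ⟨φ, hφ, hp⟩
    refine ⟨_, hφ.const_mul c, ?_⟩
    filter_upwards [Lp.coeFn_smul c p, hp] with x h1 h2
    rw [h1, Pi.smul_apply, h2, smul_eq_mul, mul_assoc]

/-- If `w` has almost no zeros, a function `g` orthogonal to all `φ w` vanishes: all the Fourier
coefficients of `w g` are zero. -/
theorem dense_kickVelocities (hd : 1 ≤ d) (hV : AdmissiblePotential V) {w : L2 d}
    (hw : volume (zeroSet w) = 0) : Dense (kickVelocities hd hV w : Set (L2 d)) := by
  refine HSub.dense_of_orthogonal _ fun g hg => ?_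
  have key : ∀ φ : Torus d → ℝ, IsKickLine V φ → ∫ x, (w x * g x) * φ x = 0 := by
    intro φ hφ
    have h := hg (mulL2 hφ.isSmooth.continuous w) ⟨φ, hφ, coeFn_mulL2 _ w⟩
    rw [← h, L2.inner_def]
    refine integral_congr_ae ?_
    filter_upwards [coeFn_mulL2 hφ.isSmooth.continuous w] with x hx
    rw [hx]
    simp only [RCLike.inner_apply, conj_trivial]
    ring
  have h := ae_eq_zero_of_integral_trigModes ((Lp.memLp w).integrable_mul (Lp.memLp g))
    (fun k => key _ (mem_kickFrequencies hd hV k).1)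
    (fun k => key _ (mem_kickFrequencies hd hV k).2)
  refine (Lp.eq_zero_iff_ae_eq_zero).2 ?_
  have hw' : ∀ᵐ x, w x ≠ 0 := by
    rw [ae_iff]
    simpa [zeroSet, preimage] using hw
  filter_upwards [h, hw'] with x h1 h2
  exact (mul_eq_zero.1 h1).resolve_left h2

/-- If `w` vanishes only on a null set, the velocity can be changed arbitrarily. -/
theorem reach_velocity (hd : 1 ≤ d) (hV : AdmissiblePotential V) {w : H1 d}
    (hw : volume (zeroSet (H1.toL2 w)) = 0) (p q : L2 d) :
    Reach V 0 (WithLp.toLp 2 (w, p)) (WithLp.toLp 2 (w, q)) := by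
  have hcont : Continuous fun r : L2 d => (WithLp.toLp 2 (w, p + r) : State d) :=
    (WithLp.prod_continuous_toLp 2 (H1 d) (L2 d)).comp
      (continuous_const.prodMk (continuous_const.add continuous_id))
  refine Reach.of_forall_dist fun ε hε => ?_
  obtain ⟨δ, hδ, h⟩ := Metric.continuousAt_iff.1 (hcont.continuousAt (x := q - p)) ε hε
  obtain ⟨r, hr, hrq⟩ := Metric.mem_closure_iff.1 (dense_kickVelocities hd hV hw (q - p)) δ hδ
  obtain ⟨φ, hφ, hrφ⟩ := hr
  refine ⟨WithLp.toLp 2 (w, p + r), ?_, ?_⟩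
  · have h1 := h (by rwa [dist_comm] at hrq)
    simpa only [add_sub_cancel] using h1
  · obtain ⟨hs, hk⟩ := (hφ 1).congr (ψ := φ) fun x => (one_mul _).symm
    have h2 := hk (WithLp.toLp 2 (w, p))
    have e : kick hs.continuous (WithLp.toLp 2 (w, p)) = WithLp.toLp 2 (w, p + r) := by
      have : mulL2 hs.continuous (H1.toL2 w) = r := by
        refine Lp.ext ?_
        filter_upwards [coeFn_mulL2 hs.continuous (H1.toL2 w), hrφ] with x h3 h4
        rw [h3, h4]
      rw [← this]
      rfl
    rw [e] at h2
    intro ε' hε'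
    obtain ⟨T, hT, h5⟩ := h2 ε' hε'
    exact ⟨T, by linarith, h5⟩

end Kicks

/-! ### Dilations and the drift -/

section DilationOperators

variable {H L : Type*} [NormedAddCommGroup H] [InnerProductSpace ℝ H]
  [NormedAddCommGroup L] [InnerProductSpace ℝ L]

theorem hasDerivAt_dilation {X : Type*} [NormedAddCommGroup X] [InnerProductSpace ℝ X]
    {M D : HOp X X} (hM : ∀ y, M y = 0) {x y : X} (hx : D x = x) (hy : D y = -y) (c σ : ℝ) :
    HasDerivAt (fun σ : ℝ => Real.exp (c * σ) • x + Real.exp (-(c * σ)) • y)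
      ((M + c • D) (Real.exp (c * σ) • x + Real.exp (-(c * σ)) • y)) σ := by
  have e : (M + c • D) (Real.exp (c * σ) • x + Real.exp (-(c * σ)) • y)
      = (Real.exp (c * σ) * (c * 1)) • x + (Real.exp (-(c * σ)) * -(c * 1)) • y := by
    rw [add_apply, hM, zero_add, smul_apply, map_add, map_smul, map_smul, hx, hy]
    module
  rw [e]
  have h := (hasDerivAt_id σ).const_mul c
  exact (h.exp.smul_const x).add (h.neg.exp.smul_const y)

theorem exists_norm_dilation_lt {X : Type*} [NormedAddCommGroup X] [InnerProductSpace ℝ X]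
    {M : HOp X X} (hM : ∀ y, M y = 0) (D : HOp X X) :
    ∃ c₀ : ℝ, 0 < c₀ ∧ ∀ c, |c| < c₀ → ‖M + c • D‖ < 1 / 2 := by
  obtain rfl : M = 0 := ContinuousLinearMap.ext hM
  have h : Tendsto (fun r : ℝ => ‖(0 : HOp X X) + r • D‖) (𝓝 0) (𝓝 0) := by
    have h2 : Continuous fun r : ℝ => ‖(0 : HOp X X) + r • D‖ := by fun_prop
    simpa using h2.tendsto 0
  obtain ⟨r₀, hr₀, h'⟩ := Metric.eventually_nhds_iff.1 (h.eventually_lt_const one_half_pos)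
  refine ⟨r₀, hr₀, fun r hr => h' ?_⟩
  rwa [Real.dist_eq, sub_zero]

theorem smul_add_add_eq_smul {X : Type*} [NormedAddCommGroup X] [InnerProductSpace ℝ X]
    {M D : HOp X X} (hM : ∀ y, M y = 0) (hD : ∀ y, D y = 0) (A : HOp X X) (τ : ℝ) :
    τ • (A + M + D) = τ • A := by
  obtain rfl : M = 0 := ContinuousLinearMap.ext hM
  obtain rfl : D = 0 := ContinuousLinearMap.ext hD
  rw [add_zero, add_zero]

theorem toLp_eq_add (a b : ℝ) (w : H) (p : L) :
    (WithLp.toLp 2 (a • w, b • p) : WithLp 2 (H × L))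
      = a • WithLp.toLp 2 (w, 0) + b • WithLp.toLp 2 (0, p) := by
  refine WithLp.ofLp_injective 2 (Prod.ext ?_ ?_)
  · change a • w = a • w + b • (0 : H)
    rw [smul_zero, add_zero]
  · change b • p = a • (0 : L) + b • p
    rw [smul_zero, zero_add]

theorem potOp_eq_zero {T : HOp H L} (hT : ∀ w, T w = 0) (x : WithLp 2 (H × L)) :
    potOp T x = 0 := by
  rw [potOp_apply, hT]
  rfl

theorem diagOp_eq_zero {a : HOp H H} {b : HOp L L} (ha : ∀ w, a w = 0) (hb : ∀ p, b p = 0)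
    (x : WithLp 2 (H × L)) : diagOp a b x = 0 := by
  rw [diagOp_apply, ha, hb]
  rfl

theorem diagOp_toLp_fst {a : HOp H H} {b : HOp L L} {w : H} (ha : a w = w) :
    diagOp a b (WithLp.toLp 2 (w, 0)) = WithLp.toLp 2 (w, 0) := by
  rw [diagOp_apply, WithLp.toLp_fst, WithLp.toLp_snd, ha, map_zero]

theorem diagOp_toLp_snd {a : HOp H H} {b : HOp L L} {p : L} (hb : b p = -p) :
    diagOp a b (WithLp.toLp 2 (0, p)) = -WithLp.toLp 2 (0, p) := by
  rw [diagOp_apply, WithLp.toLp_fst, WithLp.toLp_snd, hb, map_zero]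
  refine WithLp.ofLp_injective 2 (Prod.ext ?_ rfl)
  exact neg_zero.symm

theorem eventually_norm_smul_le {X : Type*} [NormedAddCommGroup X] [InnerProductSpace ℝ X]
    (A : HOp X X) {r : ℝ} (hr : 0 < r) : ∀ᶠ τ : ℝ in 𝓝[>] 0, ‖τ • A‖ ≤ r := by
  have h0 : Tendsto (fun τ : ℝ => τ) (𝓝[>] 0) (𝓝 0) := nhdsWithin_le_nhds
  exact eventually_norm_le (h0.smul_const A) (by simpa using hr)

end DilationOperators

section AbstractDrift

variable {H L : Type*} [NormedAddCommGroup H] [InnerProductSpace ℝ H] [CompleteSpace H]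
  [NormedAddCommGroup L] [InnerProductSpace ℝ L] [CompleteSpace L]

theorem waveInv_toLp_zero (J : HOp H L) (p : H) :
    waveInv J (WithLp.toLp 2 (p, 0)) = WithLp.toLp 2 (0, J p) := by
  refine WithLp.ofLp_injective 2 (Prod.ext ?_ rfl)
  change -(ContinuousLinearMap.adjoint J (0 : L)) = 0
  rw [map_zero, neg_zero]

/-- The first component of the solution from `(0, J p)` is of order `t`, as `(0, J p)` lies in the
domain of the generator. -/
theorem IsUnitaryGroup.norm_fst_apply_le {J : HOp H L}
    {U : ℝ → HOp (WithLp 2 (H × L)) (WithLp 2 (H × L))} (hU : IsUnitaryGroup (waveInv J) U)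
    (t : ℝ) (p : H) : ‖(U t (WithLp.toLp 2 (0, J p))).fst‖ ≤ ‖p‖ * |t| := by
  have h := hU.norm_apply_sub_le t (WithLp.toLp 2 (p, 0))
  rw [waveInv_toLp_zero, WithLp.norm_toLp_fst] at h
  refine le_trans (le_of_eq ?_) ((norm_fst_le _).trans h)
  change _ = ‖(U t (WithLp.toLp 2 (0, J p))).fst - (0 : H)‖
  rw [sub_zero]

/-- A perturbation `(w, p) ↦ (0, τ T w)` acts only on the first component, which is of order `a` for
the initial state `(a w, a⁻¹ J p)` with `a² = τ / s`. -/
theorem IsUnitaryGroup.dist_le_of_scaled {J : HOp H L}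
    {U : ℝ → HOp (WithLp 2 (H × L)) (WithLp 2 (H × L))} (hU : IsUnitaryGroup (waveInv J) U)
    (T : HOp H L) (w p : H) {s τ a : ℝ} (hτ : 0 < τ) (ha : 0 < a)
    (has : a ^ 2 * s = τ) {z : ℝ → WithLp 2 (H × L)}
    (hz : IsInteractionSol U (τ • potOp T) τ z)
    (h0 : z 0 = a • WithLp.toLp 2 (w, 0) + a⁻¹ • WithLp.toLp 2 (0, J p)) :
    dist (z 1) (z 0) ≤ τ * a * (‖T‖ * (‖w‖ + s * ‖p‖)) * Real.exp ‖τ • potOp T‖ := by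
  have h := hU.dist_le_of_isInteractionSol hz (w := fun _ => z 0) (w' := fun _ => 0)
    (fun σ _ => hasDerivWithinAt_const σ _ (z 0))
    (ε := τ * a * (‖T‖ * (‖w‖ + s * ‖p‖))) (fun σ hσ => ?_)
  · simpa using h
  rw [dist_zero_left]
  change ‖U _ (τ • potOp T (U (τ * σ) (z 0)))‖ ≤ _
  rw [hU.norm_apply, norm_smul, norm_potOp_apply, Real.norm_of_nonneg hτ.le]
  have h1 : ‖(U (τ * σ) (z 0)).fst‖ ≤ a * (‖w‖ + s * ‖p‖) := by
    have e : (U (τ * σ) (z 0)).fst = a • (U (τ * σ) (WithLp.toLp 2 (w, 0))).fst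
        + a⁻¹ • (U (τ * σ) (WithLp.toLp 2 (0, J p))).fst := by
      rw [h0, map_add, map_smul, map_smul]
      rfl
    have h2 : ‖(U (τ * σ) (WithLp.toLp 2 (w, 0))).fst‖ ≤ ‖w‖ := by
      refine (norm_fst_le _).trans ?_
      rw [hU.norm_apply, WithLp.norm_toLp_fst]
    have h3 : ‖(U (τ * σ) (WithLp.toLp 2 (0, J p))).fst‖ ≤ ‖p‖ * τ := by
      refine (hU.norm_fst_apply_le _ p).trans ?_
      rw [abs_of_nonneg (mul_nonneg hτ.le hσ.1)]
      gcongr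
      exact mul_le_of_le_one_right hτ.le hσ.2
    rw [e]
    calc _ ≤ a * ‖w‖ + a⁻¹ * (‖p‖ * τ) := by
          refine (norm_add_le _ _).trans ?_
          rw [norm_smul, norm_smul, Real.norm_of_nonneg ha.le,
            Real.norm_of_nonneg (inv_pos.2 ha).le]
          gcongr
      _ = _ := by
          rw [← has]
          field_simp
  calc τ * ‖T (U (τ * σ) (z 0)).fst‖ ≤ τ * (‖T‖ * (a * (‖w‖ + s * ‖p‖))) := by
        gcongr
        exact (T.le_opNorm _).trans (by gcongr)
    _ = _ := by ring

/-- The flow over the time `τ`, conjugated by the dilation `(w, p) ↦ (a w, a⁻¹ p)` with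
`a² = τ / s`, converges to the drift `(w, J p) ↦ (w + s p, J p)` as `τ → 0`. -/
theorem IsUnitaryGroup.tendsto_drift {J : HOp H L}
    {U : ℝ → HOp (WithLp 2 (H × L)) (WithLp 2 (H × L))} (hU : IsUnitaryGroup (waveInv J) U)
    (T : HOp H L) (w p : H) {s : ℝ} (hs : 0 < s) {a : ℝ → ℝ} (ha : ∀ τ, 0 < τ → 0 < a τ)
    (has : ∀ τ, 0 < τ → a τ ^ 2 * s = τ) {z : ℝ → ℝ → WithLp 2 (H × L)}
    (hz : ∀ᶠ τ in 𝓝[>] (0 : ℝ), IsInteractionSol U (τ • potOp T) τ (z τ))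
    (h0 : ∀ τ, z τ 0 = WithLp.toLp 2 (a τ • w, (a τ)⁻¹ • J p)) :
    Tendsto (fun τ => (WithLp.toLp 2 ((a τ)⁻¹ • (U τ (z τ 1)).fst, a τ • (U τ (z τ 1)).snd) :
      WithLp 2 (H × L))) (𝓝[>] 0) (𝓝 (WithLp.toLp 2 (w + s • p, J p))) := by
  let W : WithLp 2 (H × L) := WithLp.toLp 2 (w, 0)
  let Q : WithLp 2 (H × L) := WithLp.toLp 2 (0, J p)
  have h0' : ∀ τ, z τ 0 = a τ • W + (a τ)⁻¹ • Q := fun τ => by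
    rw [h0]
    refine WithLp.ofLp_injective 2 (Prod.ext ?_ ?_)
    · change a τ • w = a τ • w + (a τ)⁻¹ • (0 : H)
      rw [smul_zero, add_zero]
    · change (a τ)⁻¹ • J p = a τ • (0 : L) + (a τ)⁻¹ • J p
      rw [smul_zero, zero_add]
  have hτ0 : Tendsto (fun τ : ℝ => τ) (𝓝[>] 0) (𝓝 0) := nhdsWithin_le_nhds
  have hpos : ∀ᶠ τ : ℝ in 𝓝[>] 0, 0 < τ := self_mem_nhdsWithin
  let R : ℝ → WithLp 2 (H × L) := fun τ => U τ (z τ 1 - z τ 0)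
  have hsplit : ∀ τ, U τ (z τ 1) = a τ • U τ W + (a τ)⁻¹ • U τ Q + R τ := fun τ => by
    change _ = _ + U τ (z τ 1 - z τ 0)
    rw [map_sub, h0', map_add, map_smul, map_smul]
    abel
  have hlimW : Tendsto (fun τ => U τ W) (𝓝[>] 0) (𝓝 W) := by
    simpa [hU.zero_apply] using ((hU.continuous_apply W).tendsto 0).mono_left nhdsWithin_le_nhds
  have hlimQ : Tendsto (fun τ => U τ Q) (𝓝[>] 0) (𝓝 Q) := by
    simpa [hU.zero_apply] using ((hU.continuous_apply Q).tendsto 0).mono_left nhdsWithin_le_nhds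
  have hderiv : Tendsto (fun τ => τ⁻¹ • (U τ Q - Q)) (𝓝[>] 0) (𝓝 (WithLp.toLp 2 (p, 0))) := by
    have h := (hasDerivAt_iff_tendsto_slope.1 (hU.hasDerivAt 0 (WithLp.toLp 2 (p, 0)))).mono_left
      (nhdsWithin_mono 0 fun x (hx : 0 < x) => hx.ne')
    rw [waveInv_toLp_zero, hU.zero_apply] at h
    refine h.congr fun τ => ?_
    rw [slope_def_module, sub_zero, hU.zero_apply]
  let K : ℝ := ‖T‖ * (‖w‖ + s * ‖p‖)
  let E : ℝ → ℝ := fun τ => K * Real.exp ‖τ • potOp T‖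
  have hE : Tendsto E (𝓝[>] 0) (𝓝 (E 0)) := by
    have hc : Continuous E := by fun_prop
    exact (hc.tendsto 0).mono_left nhdsWithin_le_nhds
  have hR : ∀ᶠ τ in 𝓝[>] (0 : ℝ), ‖R τ‖ ≤ τ * a τ * E τ := by
    filter_upwards [hpos, hz] with τ hτ hzτ
    have h := hU.dist_le_of_scaled T w p hτ (ha τ hτ) (has τ hτ) hzτ (h0' τ)
    change ‖U τ _‖ ≤ _
    rw [hU.norm_apply, ← dist_eq_norm, ← mul_assoc]
    exact h
  have hR1 : Tendsto (fun τ => (a τ)⁻¹ • (R τ).fst) (𝓝[>] 0) (𝓝 0) := by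
    have hlim : Tendsto (fun τ => τ * E τ) (𝓝[>] 0) (𝓝 0) := by simpa using hτ0.mul hE
    refine squeeze_zero_norm' ?_ hlim
    filter_upwards [hpos, hR] with τ hτ hRτ
    have haτ := ha τ hτ
    rw [norm_smul, norm_inv, Real.norm_of_nonneg haτ.le, inv_mul_le_iff₀ haτ]
    calc _ ≤ ‖R τ‖ := norm_fst_le _
      _ ≤ _ := hRτ
      _ = _ := by ring
  have hR2 : Tendsto (fun τ => a τ • (R τ).snd) (𝓝[>] 0) (𝓝 0) := by
    have hlim : Tendsto (fun τ => τ * (τ / s) * E τ) (𝓝[>] 0) (𝓝 0) := by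
      simpa using (hτ0.mul (hτ0.div_const s)).mul hE
    refine squeeze_zero_norm' ?_ hlim
    filter_upwards [hpos, hR] with τ hτ hRτ
    have haτ := ha τ hτ
    have e : τ / s = a τ ^ 2 := by
      rw [div_eq_iff hs.ne', has τ hτ]
    rw [norm_smul, Real.norm_of_nonneg haτ.le, e]
    calc _ ≤ a τ * ‖R τ‖ := by gcongr; exact norm_snd_le _
      _ ≤ a τ * (τ * a τ * E τ) := by gcongr
      _ = _ := by ring
  have hfst : Continuous fun x : WithLp 2 (H × L) => x.fst := (fstOp H L).continuous
  have hsnd : Continuous fun x : WithLp 2 (H × L) => x.snd := (sndOp H L).continuous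
  have h1 : Tendsto (fun τ => (a τ)⁻¹ • (U τ (z τ 1)).fst) (𝓝[>] 0) (𝓝 (w + s • p)) := by
    have h := (((hfst.tendsto _).comp hlimW).add
      (((hfst.tendsto _).comp hderiv).const_smul s)).add hR1
    have e : W.fst + s • (WithLp.toLp 2 (p, (0 : L)) : WithLp 2 (H × L)).fst + 0 = w + s • p :=
      add_zero _
    rw [e] at h
    refine h.congr' ?_
    filter_upwards [hpos] with τ hτ
    have haτ := ha τ hτ
    rw [hsplit]
    change (U τ W).fst + s • τ⁻¹ • ((U τ Q).fst - (0 : H)) + (a τ)⁻¹ • (R τ).fst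
      = (a τ)⁻¹ • (a τ • (U τ W).fst + (a τ)⁻¹ • (U τ Q).fst + (R τ).fst)
    have e2 : ∀ b : ℝ, 0 < b → b ^ 2 * s = τ → s * τ⁻¹ = b⁻¹ * b⁻¹ := by
      rintro b hb rfl
      field_simp
    rw [sub_zero, smul_add, smul_add, inv_smul_smul₀ haτ.ne', smul_smul, smul_smul,
      e2 _ haτ (has τ hτ)]
  have h2 : Tendsto (fun τ => a τ • (U τ (z τ 1)).snd) (𝓝[>] 0) (𝓝 (J p)) := by
    have h := (((hτ0.div_const s).smul ((hsnd.tendsto _).comp hlimW)).add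
      ((hsnd.tendsto _).comp hlimQ)).add hR2
    rw [zero_div, zero_smul, zero_add, add_zero] at h
    refine h.congr' ?_
    filter_upwards [hpos] with τ hτ
    have haτ := ha τ hτ
    have e : τ / s = a τ ^ 2 := by
      rw [div_eq_iff hs.ne', has τ hτ]
    rw [hsplit, e]
    change a τ ^ 2 • (U τ W).snd + (U τ Q).snd + a τ • (R τ).snd
      = a τ • (a τ • (U τ W).snd + (a τ)⁻¹ • (U τ Q).snd + (R τ).snd)
    rw [smul_add, smul_add, smul_inv_smul₀ haτ.ne', smul_smul, sq]
  exact ((WithLp.prod_continuous_toLp 2 H L).tendsto _).comp (h1.prodMk_nhds h2)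

end AbstractDrift

section Dilation

variable {d : ℕ} {V : Torus d → ℝ}

theorem mulL2_const (c : ℝ) (f : L2 d) :
    mulL2 (continuous_const (y := c)) f = c • f := by
  refine Lp.ext ?_
  filter_upwards [coeFn_mulL2 (continuous_const (y := c)) f, Lp.coeFn_smul c f] with x h1 h2
  rw [h1, h2, Pi.smul_apply, smul_eq_mul]

theorem mulH1_const (c : ℝ) (w : H1 d) : mulH1 (IsSmooth.const c) w = c • w := by
  refine H1.toL2_injective ?_
  rw [toL2_mulH1, map_smul]
  exact mulL2_const c _

theorem multOp_zero (x : State d) : multOp (continuous_const (y := (0 : ℝ))) x = 0 :=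
  potOp_eq_zero (H := H1 d) (L := L2 d)
    (fun w => (mulL2_const 0 (H1.toL2 w)).trans (zero_smul ℝ _)) x

theorem dampOp_zero (x : State d) : dampOp (IsSmooth.const 0) x = 0 := by
  refine diagOp_eq_zero (H := H1 d) (L := L2 d)
    (fun w => (mulH1_const 0 w).trans (zero_smul ℝ _)) (fun p => ?_) x
  change -(mulL2 (continuous_const (y := (0 : ℝ))) p) = 0
  rw [mulL2_const, zero_smul, neg_zero]

/-- The dilation `(w, p) ↦ (e^c w, e^{-c} p)`. -/
def dilate (c : ℝ) (x : State d) : State d :=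
  WithLp.toLp 2 (Real.exp c • x.fst, Real.exp (-c) • x.snd)

theorem dilate_dilate (b c : ℝ) (x : State d) : dilate b (dilate c x) = dilate (b + c) x := by
  refine WithLp.ofLp_injective 2 (Prod.ext ?_ ?_)
  · change Real.exp b • Real.exp c • x.fst = Real.exp (b + c) • x.fst
    rw [smul_smul, Real.exp_add]
  · change Real.exp (-b) • Real.exp (-c) • x.snd = Real.exp (-(b + c)) • x.snd
    rw [smul_smul, neg_add, Real.exp_add]

theorem dilate_zero (x : State d) : dilate 0 x = x := by
  refine WithLp.ofLp_injective 2 (Prod.ext ?_ ?_)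
  · change Real.exp 0 • x.fst = x.fst
    rw [Real.exp_zero, one_smul]
  · change Real.exp (-0) • x.snd = x.snd
    rw [neg_zero, Real.exp_zero, one_smul]

/-- The flow over the time `τ` conjugated by the constant kicks by `± c / τ`, with the control
`c² / τ²` on the constant potential, converges to the dilation by `e^c`. -/
theorem reach_dilate (hd : 1 ≤ d) (hV : AdmissiblePotential V) (c : ℝ) (x : State d) :
    Reach V 0 x (dilate c x) := by
  obtain ⟨c₀, hc₀, hc⟩ := exists_norm_dilation_lt (X := State d) multOp_zero
    (dampOp (IsSmooth.const (d := d) 1))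
  have hsmall : ∀ c, |c| < c₀ → ∀ x : State d, Reach V 0 x (dilate c x) := by
    intro c hc' x
    have hx : dampOp (IsSmooth.const 1) (WithLp.toLp 2 (x.fst, 0) : State d)
        = WithLp.toLp 2 (x.fst, 0) :=
      diagOp_toLp_fst (H := H1 d) (L := L2 d) ((mulH1_const 1 x.fst).trans (one_smul ℝ _))
    have hy : dampOp (IsSmooth.const 1) (WithLp.toLp 2 (0, x.snd) : State d)
        = -WithLp.toLp 2 (0, x.snd) :=
      diagOp_toLp_snd (H := H1 d) (L := L2 d) (congrArg Neg.neg
        ((mulL2_const 1 x.snd).trans (one_smul ℝ _)))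
    have h := reach_limit hd hV (φ := fun _ => 1) (ψ := fun _ => 0) (IsSmooth.const 1)
      continuous_const (s := fun τ => c / τ)
      (c := fun τ => Pi.single ⟨0, by omega⟩ ((c / τ) ^ 2)) (s₀ := c) ?_ (fun τ hτ y => ?_)
      (fun r => isKickLine_const hd hV 1 r) (hc c hc')
      (hasDerivAt_dilation (X := State d) multOp_zero hx hy c)
    · have e : ∀ σ : ℝ, Real.exp (c * σ) • (WithLp.toLp 2 (x.fst, 0) : State d)
          + Real.exp (-(c * σ)) • WithLp.toLp 2 (0, x.snd) = dilate (c * σ) x := fun σ =>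
        (toLp_eq_add (H := H1 d) (L := L2 d) _ _ _ _).symm
      rw [e, e, mul_zero, mul_one, dilate_zero] at h
      exact h
    · refine tendsto_const_nhds.congr' ?_
      filter_upwards [self_mem_nhdsWithin] with τ (hτ : 0 < τ)
      rw [mul_div_cancel₀ _ hτ.ne']
    · rw [Finset.sum_eq_single ⟨0, by omega⟩ (fun i _ hi => by rw [Pi.single_eq_of_ne hi, zero_mul])
        (fun h => absurd (Finset.mem_univ _) h), Pi.single_eq_same]
      simp [controlPotential]
  -- a large dilation is an iterate of a small one
  obtain ⟨n, hn⟩ := exists_nat_gt (|c| / c₀)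
  have hn0 : (0 : ℝ) < n := (div_nonneg (abs_nonneg c) hc₀.le).trans_lt hn
  have hcn : |c / n| < c₀ := by
    rw [abs_div, abs_of_pos hn0, div_lt_iff₀ hn0, mul_comm]
    exact (div_lt_iff₀ hc₀).1 hn
  have hiter : ∀ m : ℕ, Reach V 0 x (dilate (m * (c / n)) x) := by
    intro m
    induction m with
    | zero =>
      rw [Nat.cast_zero, zero_mul, dilate_zero]
      exact Reach.refl V x
    | succ m ih =>
      have h := ih.trans_zero (hsmall _ hcn _)
      rwa [dilate_dilate, show c / n + m * (c / n) = ((m + 1 : ℕ) : ℝ) * (c / n) by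
        push_cast; ring] at h
  simpa [mul_div_cancel₀ c hn0.ne'] using hiter n

/-- The drift: the position can be moved in the direction of a velocity in `H¹`. -/
theorem reach_drift (hd : 1 ≤ d) (hV : AdmissiblePotential V) (w p : H1 d) {s : ℝ} (hs : 0 < s) :
    Reach V 0 (WithLp.toLp 2 (w, H1.toL2 p)) (WithLp.toLp 2 (w + s • p, H1.toL2 p)) := by
  obtain ⟨TV, hTV⟩ := hV.exists_mul hd
  obtain ⟨U, hU⟩ := exists_isUnitaryGroup_freeInv d
  let A : HOp (State d) (State d) := potOp (H := H1 d) (L := L2 d) TV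
  let x : State d := WithLp.toLp 2 (w, H1.toL2 p)
  -- the dilation by `e^b = √(τ / s)`
  let b : ℝ → ℝ := fun τ => Real.log √(τ / s)
  choose Z hZ0 hZ using fun τ : ℝ => exists_wave_flow d hU (τ • A) τ
  have hsmall : ∀ᶠ τ : ℝ in 𝓝[>] 0, ‖τ • A‖ ≤ 1 / 2 :=
    eventually_norm_smul_le (X := State d) A one_half_pos
  have hlim := IsUnitaryGroup.tendsto_drift (H := H1 d) (L := L2 d) (J := H1.incl d) hU TV w p hs
    (a := fun τ => Real.exp (b τ)) (fun τ _ => Real.exp_pos _) (fun τ hτ => by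
      have h : 0 < √(τ / s) := Real.sqrt_pos.2 (div_pos hτ hs)
      simp only [b]
      rw [Real.exp_log h, Real.sq_sqrt (div_pos hτ hs).le, div_mul_cancel₀ _ hs.ne'])
    (z := fun τ => Z τ (dilate (b τ) x))
    (hsmall.mono fun τ hτ => (hZ τ hτ).1 _) (fun τ => by
      rw [hZ0, ← Real.exp_neg]
      rfl)
  refine Reach.of_tendsto (y := fun τ => dilate (-b τ) (U τ (Z τ (dilate (b τ) x) 1))) ?_
    (hlim.congr fun τ => by
      rw [dilate.eq_1 (-b τ), neg_neg, Real.exp_neg])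
  filter_upwards [hsmall, self_mem_nhdsWithin] with τ hτ (hτ0 : 0 < τ)
  have h0 : Continuous fun _ : Torus d => (0 : ℝ) := continuous_const
  have hn0 : Continuous fun _ : Torus d => -(0 : ℝ) := continuous_const
  have hsol := (hZ τ hτ).1
  rw [← smul_add_add_eq_smul (X := State d) multOp_zero dampOp_zero A τ] at hsol
  have h3 := realizes_kick_flow_kick hU hTV (IsSmooth.const 0) h0 (c := 0)
    (fun y => by simp) hn0 hτ0 (hZ0 τ) hsol (hZ τ hτ).2
  have h4 := ((reach_dilate hd hV (b τ) x).trans (h3.reach _)).trans (reach_dilate hd hV (-b τ) _)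
  rw [kick_zero hn0 (fun _ => neg_zero), kick_zero _ (fun _ => rfl)] at h4
  simpa using h4

end Dilation

/-! ### Generic positions and controllability -/

section Generic

variable {d : ℕ} {V : Torus d → ℝ}

/-- If `f` and `g` have almost no common zeros, then `f + s g` vanishes only on a null set for all
but countably many `s`: the zero sets are essentially disjoint. -/
theorem exists_volume_zeroSet_eq_zero {f g : L2 d}
    (h : volume (zeroSet fun x => (f x, g x)) = 0) {ε : ℝ} (hε : 0 < ε) :
    ∃ s ∈ Ioo 0 ε, ∀ᵐ x, f x + s * g x ≠ 0 := by
  have hf : Measurable f := (Lp.stronglyMeasurable f).measurable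
  have hg : Measurable g := (Lp.stronglyMeasurable g).measurable
  let S : ℝ → Set (Torus d) := fun s => {x | f x + s * g x = 0} \ {x | g x = 0}
  have hS : ∀ s, MeasurableSet (S s) := fun s =>
    (measurableSet_eq_fun (hf.add (hg.const_mul s)) measurable_const).diff
      (measurableSet_eq_fun hg measurable_const)
  have hdisj : Pairwise (Function.onFun Disjoint S) := by
    intro s t hst
    refine Set.disjoint_left.2 fun x hx hx' => ?_
    obtain ⟨h1 : f x + s * g x = 0, h2 : ¬ g x = 0⟩ := hx
    obtain ⟨h3 : f x + t * g x = 0, -⟩ := hx'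
    have h4 : (s - t) * g x = 0 := by linarith
    exact (mul_ne_zero (sub_ne_zero.2 hst) h2) h4
  have hc := Measure.countable_meas_pos_of_disjoint_iUnion (μ := (volume : Measure (Torus d)))
    hS hdisj
  obtain ⟨s, hs, hs'⟩ := (hc.dense_compl ℝ).exists_mem_open isOpen_Ioo (nonempty_Ioo.2 hε)
  have hs0 : volume (S s) = 0 := by simpa using hs
  refine ⟨s, hs', ?_⟩
  filter_upwards [measure_eq_zero_iff_ae_notMem.1 hs0, measure_eq_zero_iff_ae_notMem.1 h]
    with x h1 h2 h3
  refine h1 ⟨h3, fun h4 : g x = 0 => h2 ?_⟩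
  have h5 : f x = 0 := by simpa [h4] using h3
  change (f x, g x) = 0
  rw [h4, h5]
  rfl

theorem volume_zeroSet_add_smul {w p : H1 d} {s : ℝ}
    (h : ∀ᵐ x, H1.toL2 w x + s * H1.toL2 p x ≠ 0) :
    volume (zeroSet (H1.toL2 (w + s • p))) = 0 := by
  rw [map_add, map_smul]
  refine measure_eq_zero_iff_ae_notMem.2 ?_
  filter_upwards [h, Lp.coeFn_add (H1.toL2 w) (s • H1.toL2 p), Lp.coeFn_smul s (H1.toL2 p)]
    with x h1 h2 h3 (h4 : _ = 0)
  rw [h2, Pi.add_apply, h3] at h4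
  exact h1 h4

/-- From a position without zeros everything is reached: kick the velocity to the difference of the
positions, drift, and kick again. The target position is perturbed by a small constant so that it
has almost no zeros. -/
theorem reach_of_volume_zeroSet (hd : 1 ≤ d) (hV : AdmissiblePotential V) {w : H1 d}
    (hw : volume (zeroSet (H1.toL2 w)) = 0) (p : L2 d) (y : State d) :
    Reach V 0 (WithLp.toLp 2 (w, p)) y := by
  let e : H1 d := ofSmooth (IsSmooth.const 1)
  have he : H1.toL2 e =ᵐ[volume] fun _ => 1 :=
    coeFn_ofContinuous (continuous_const (y := (1 : ℝ)))
  have hz : volume (zeroSet fun x => (H1.toL2 y.fst x, H1.toL2 e x)) = 0 := by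
    refine measure_eq_zero_iff_ae_notMem.2 ?_
    filter_upwards [he] with x h1 (h2 : _ = 0)
    have h3 := congrArg Prod.snd h2
    simp only [h1] at h3
    exact one_ne_zero h3
  have hcont : Continuous fun s : ℝ => (WithLp.toLp 2 (y.fst + s • e, y.snd) : State d) :=
    (WithLp.prod_continuous_toLp 2 (H1 d) (L2 d)).comp
      ((continuous_const.add (continuous_id.smul continuous_const)).prodMk continuous_const)
  refine Reach.of_forall_dist fun ε hε => ?_
  obtain ⟨δ, hδ, h⟩ := Metric.continuousAt_iff.1 (hcont.continuousAt (x := 0)) ε hε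
  obtain ⟨s, hs, hs'⟩ := exists_volume_zeroSet_eq_zero hz hδ
  have hw1 := volume_zeroSet_add_smul hs'
  have hd1 := h (show dist s 0 < δ by rw [Real.dist_eq, sub_zero, abs_of_pos hs.1]; exact hs.2)
  rw [zero_smul, add_zero] at hd1
  refine ⟨WithLp.toLp 2 (y.fst + s • e, y.snd), hd1, ?_⟩
  -- kick to the velocity `v`, drift by `v`, kick to the target velocity
  have h1 := reach_velocity hd hV hw p (H1.toL2 (y.fst + s • e - w))
  have h2 := reach_drift hd hV w (y.fst + s • e - w) one_pos
  rw [one_smul, add_sub_cancel] at h2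
  have h3 := (h1.trans_zero h2).trans_zero (reach_velocity hd hV hw1 _ y.snd)
  intro ε' hε'
  obtain ⟨T, hT, h5⟩ := h3 ε' hε'
  exact ⟨T, by linarith, h5⟩

end Generic

end BilinearWave

end

theorem theorem2 (d : ℕ) (hd : 1 ≤ d) (V : BilinearWave.Torus d → ℝ)
    (hV : BilinearWave.AdmissiblePotential V) :
    -- `W₀ = (w₀, w₁) ∈ H¹ × L²` with `|Z(w₀)| = 0`
    (∀ (w₀ : BilinearWave.H1 d) (w₁ : BilinearWave.L2 d),
      volume (BilinearWave.zeroSet (BilinearWave.H1.toL2 w₀)) = 0 →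
      BilinearWave.minimalTime V (WithLp.toLp 2 (w₀, w₁)) = 0) ∧
    -- `W₀ = (w₀, w₁) ∈ H¹ × H¹` with `|Z(W₀)| = 0`
    (∀ w₀ w₁ : BilinearWave.H1 d,
      volume (BilinearWave.zeroSet
        (fun x => (BilinearWave.H1.toL2 w₀ x, BilinearWave.H1.toL2 w₁ x))) = 0 →
      BilinearWave.minimalTime V (WithLp.toLp 2 (w₀, BilinearWave.H1.toL2 w₁)) = 0) := by
  refine ⟨fun w₀ w₁ h => BilinearWave.minimalTime_eq_zero
    (BilinearWave.reach_of_volume_zeroSet hd hV h w₁), fun w₀ w₁ h =>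
    BilinearWave.minimalTime_eq_zero fun y => ?_⟩
  obtain ⟨s, hs, hs'⟩ := BilinearWave.exists_volume_zeroSet_eq_zero h one_pos
  exact (BilinearWave.reach_drift hd hV w₀ w₁ hs.1).trans_zero
    (BilinearWave.reach_of_volume_zeroSet hd hV (BilinearWave.volume_zeroSet_add_smul hs') _ y)
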